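/- **Definitions.** A code of length $n$ over an alphabet $\Sigma$ is a set $C\subseteq\Sigma^n$; its rate is $\frac{\log|C|}{n\log|\Sigma|}$. A trace of $c\in\Sigma^n$ is the random string that remains when each symbol of $c$ is deleted independently with probability $q$. The code $C$ is $(T,q,\delta)$ trace reconstructible if there is a decoding function $\mathrm{Dec}:(\Sigma^*)^T\to C$ such that, for every $c\in C$, if $z_1,\dots,z_T$ are independent traces of $c$, then $\Pr[\mathrm{Dec}(z_1,\dots,z_T)\neq c]<\delta$. It is encodable in time $t$ if some bijection $\mathrm{Enc}:\{0,\dots,|C|-1\}\to C$ can be evaluated in time $t$ (the message is given in binary), and decodable in time $t$ if $\mathrm{Dec}$ can be evaluated in time $t$ (on tuples of strings of length at most $n$). Time is the number of steps of a unit-cost word RAM with words of $O(\log n)$ bits; the encoding and decoding programs are fixed for the whole family of codes (they do not depend on $n$) and have access to a precomputed description of the code of $O(n)$ words, and the time needed to construct that description is not counted. **Theorem.** There is an absolute constant $K>0$, and for every $q\in(0,1)$ there is a constant $K_q>0$ depending only on $q$, such that the following holds for all $q,\varepsilon\in(0,1)$. There are a positive integer $$T\le\Big\lceil K\log_{1/q}\tfrac{2}{\varepsilon}\Big\rceil,$$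 an alphabet $\Sigma$ of size $$2\le|\Sigma|\le 2^{K_q\cdot\frac1\varepsilon\log_2\frac2\varepsilon},$$ and constants $\gamma>0$ and $A$, all depending only on $q$ and $\varepsilon$, such that for infinitely many $n$ there is a code $C\subseteq\Sigma^n$ of rate at least $1-\varepsilon$ that is $(T,q,2^{-\gamma n})$ trace reconstructible, encodable in time $A\,n$, and decodable in time $A\,nT$ (by the decoding function that witnesses the trace reconstructibility), where $A$ also serves as the constant in the word length and in the length of the description. -/

import Mathlib

/-! ## Word RAM programs with a step count

Structured programs over finitely many registers and finitely many random-access arrays. All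
registers and array cells hold words of `w` bits, i.e. natural numbers below `2 ^ w`; every basic
instruction and every test costs one step. -/

namespace WordRAM

/-- The arithmetic operations of the machine. -/
inductive Op where
  | add
  | sub
  | mul
  | div
  | mod

/-- The arithmetic operations on words of `w` bits (`sub` is truncated at `0`, and division by `0`
returns `0`). -/
def Op.eval (w : ℕ) : Op → ℕ → ℕ → ℕ
  | .add, a, b => (a + b) % 2 ^ w
  | .sub, a, b => a - b
  | .mul, a, b => (a * b) % 2 ^ w
  | .div, a, b => a / b
  | .mod, a, b => a % b

/-- Programs. Registers and arrays are named by natural numbers that are fixed in the program. -/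
inductive Prog where
  /-- do nothing -/
  | skip : Prog
  /-- `reg r := c` -/
  | const (r c : ℕ) : Prog
  /-- `reg r := reg x` -/
  | copy (r x : ℕ) : Prog
  /-- `reg r := reg x o reg y` -/
  | op (o : Op) (r x y : ℕ) : Prog
  /-- `reg r := mem a [reg x]` -/
  | load (r a x : ℕ) : Prog
  /-- `mem a [reg x] := reg y` -/
  | store (a x y : ℕ) : Prog
  /-- first `p`, then `p'` -/
  | seq (p p' : Prog) : Prog
  /-- `if reg x < reg y then p else p'` -/
  | ite (x y : ℕ) (p p' : Prog) : Prog
  /-- `while reg x < reg y do p` -/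
  | loop (x y : ℕ) (p : Prog) : Prog

/-- Memory contents: registers, and arrays `mem a` with cells `mem a i`. -/
structure State where
  reg : ℕ → ℕ
  mem : ℕ → ℕ → ℕ

/-- Assign the value `v` to the register `r`. -/
def State.setReg (s : State) (r v : ℕ) : State :=
  { s with reg := Function.update s.reg r v }

/-- Assign the value `v` to the cell `i` of the array `a`. -/
def State.setMem (s : State) (a i v : ℕ) : State :=
  { s with mem := Function.update s.mem a (Function.update (s.mem a) i v) }

/-- `Runs w p s t s'`: with word length `w`, the program `p` started in the state `s` halts after
exactly `t` steps in the state `s'`. -/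
inductive Runs (w : ℕ) : Prog → State → ℕ → State → Prop where
  | skip (s : State) : Runs w .skip s 1 s
  | const (s : State) (r c : ℕ) : Runs w (.const r c) s 1 (s.setReg r (c % 2 ^ w))
  | copy (s : State) (r x : ℕ) : Runs w (.copy r x) s 1 (s.setReg r (s.reg x))
  | op (s : State) (o : Op) (r x y : ℕ) :
      Runs w (.op o r x y) s 1 (s.setReg r (o.eval w (s.reg x) (s.reg y)))
  | load (s : State) (r a x : ℕ) : Runs w (.load r a x) s 1 (s.setReg r (s.mem a (s.reg x)))
  | store (s : State) (a x y : ℕ) : Runs w (.store a x y) s 1 (s.setMem a (s.reg x) (s.reg y))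
  | seq {p p' : Prog} {s s' s'' : State} {t t' : ℕ} :
      Runs w p s t s' → Runs w p' s' t' s'' → Runs w (.seq p p') s (t + t') s''
  | ite_true {x y : ℕ} {p p' : Prog} {s s' : State} {t : ℕ} :
      s.reg x < s.reg y → Runs w p s t s' → Runs w (.ite x y p p') s (t + 1) s'
  | ite_false {x y : ℕ} {p p' : Prog} {s s' : State} {t : ℕ} :
      ¬ s.reg x < s.reg y → Runs w p' s t s' → Runs w (.ite x y p p') s (t + 1) s'
  | loop_done {x y : ℕ} {p : Prog} {s : State} :
      ¬ s.reg x < s.reg y → Runs w (.loop x y p) s 1 s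
  | loop_step {x y : ℕ} {p : Prog} {s s' s'' : State} {t t' : ℕ} :
      s.reg x < s.reg y → Runs w p s t s' → Runs w (.loop x y p) s' t' s'' →
      Runs w (.loop x y p) s (t + t' + 1) s''

/-- The initial state on a list of input strings: the `j`-th string stands in the array `j` and
its length in the register `j`; everything else is `0`. -/
def init (w : ℕ) (inp : List (List ℕ)) : State where
  reg j := (inp.getD j []).length % 2 ^ w
  mem j i := (inp.getD j []).getD i 0 % 2 ^ w

/-- With word length `w`, on the input strings `inp`, the program `p` halts after at most `t` steps
with the string `out` in the first cells of the array `0`. -/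
def Computes (w : ℕ) (p : Prog) (inp : List (List ℕ)) (t : ℕ) (out : List ℕ) : Prop :=
  ∃ t' ≤ t, ∃ s : State, Runs w p (init w inp) t' s ∧
    ∀ i (hi : i < out.length), s.mem 0 i = out[i]

end WordRAM

/-! ## Codes and coded trace reconstruction

The alphabet is `Fin Q`, and a code of length `n` is a `Finset (Fin n → Fin Q)`. -/

namespace TraceCode

/-- The rate of a code. -/
noncomputable def rate {n Q : ℕ} (C : Finset (Fin n → Fin Q)) : ℝ :=
  Real.log C.card / (n * Real.log Q)

/-- What remains of `c` when the symbols at the positions `i` with `D i = true` are deleted. -/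
def trace {n Q : ℕ} (c : Fin n → Fin Q) (D : Fin n → Bool) : List (Fin Q) :=
  ((List.finRange n).filter fun i => !D i).map c

/-- The probability of a deletion pattern when each symbol is deleted independently with
probability `q`. -/
noncomputable def patternProb {n : ℕ} (q : ℝ) (D : Fin n → Bool) : ℝ :=
  ∏ i, if D i then q else 1 - q

open Classical in
/-- The probability that the decoding function `Dec`, applied to `T` independent traces of `c`
(outputs of the deletion channel with deletion probability `q`), does not return `c`. -/
noncomputable def failProb {n Q T : ℕ} {C : Finset (Fin n → Fin Q)} (q : ℝ)
    (Dec : (Fin T → List (Fin Q)) → C) (c : Fin n → Fin Q) : ℝ :=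
  ∑ D : Fin T → Fin n → Bool,
    if (Dec (fun t => trace c (D t)) : Fin n → Fin Q) ≠ c then ∏ t, patternProb q (D t) else 0

/-- `Dec` witnesses that the code `C` is `(T, q, δ)` trace reconstructible. -/
def Reconstructs {n Q T : ℕ} {C : Finset (Fin n → Fin Q)} (q δ : ℝ)
    (Dec : (Fin T → List (Fin Q)) → C) : Prop :=
  ∀ c ∈ C, failProb q Dec c < δ

/-- A word over `Fin Q` as a string of natural numbers. -/
def toStr {n Q : ℕ} (c : Fin n → Fin Q) : List ℕ :=
  List.ofFn fun i => (c i : ℕ)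

/-- The binary digits of `m`, least significant first, padded to the length `L`. -/
def bits (L m : ℕ) : List ℕ :=
  (List.range L).map fun i => (m.testBit i).toNat

/-- The program `p` evaluates the encoding function `Enc`, a bijection from `{0, …, |C| - 1}`
onto `C`, in time `t`. The input is the description `d` of the code, and the message in binary;
the output is the codeword. -/
def EncodesInTime {n Q : ℕ} {C : Finset (Fin n → Fin Q)} (w : ℕ) (p : WordRAM.Prog)
    (d : List ℕ) (t : ℕ) (Enc : Fin C.card ≃ C) : Prop :=
  ∀ m : Fin C.card, WordRAM.Computes w p [d, bits (Nat.clog 2 C.card) m] t (toStr (Enc m).1)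

/-- The program `p` evaluates the decoding function `Dec` in time `t`. The input is the
description `d` of the code, and `T` strings of length at most `n`, which need not be
subsequences of a codeword; the output is a codeword. -/
def DecodesInTime {n Q T : ℕ} {C : Finset (Fin n → Fin Q)} (w : ℕ) (p : WordRAM.Prog)
    (d : List ℕ) (t : ℕ) (Dec : (Fin T → List (Fin Q)) → C) : Prop :=
  ∀ z : Fin T → List (Fin Q), (∀ j, (z j).length ≤ n) →
    WordRAM.Computes w p (d :: List.ofFn fun j => (z j).map fun a => (a : ℕ)) t (toStr (Dec z).1)

end TraceCode

/-!
The codes are concatenated codes. The outer code, over the residues modulo a power `M` of two, has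
rate `2 ^ b / (2 ^ b + 4)` and corrects a constant fraction of errors. It is built from random
bipartite expanders (`exists_isExpander`): a message is followed by an encoding of its check symbols,
of which there are only a fraction as many, with a smaller code of a similar kind; once the check
symbols have been recovered, repeated majority votes over them remove the errors in the message
(`card_round_ne_le`). Encoding takes `O(N)` operations and decoding `O(N log N)` for the length `N`
(`exists_code_high_rate`).

Each outer symbol becomes a block of `L` letters, where `L` is of the order of `log N`. The data in a
block are protected by a greedily chosen code (`exists_block_code`). The traces fail to determine a
block only if they agree with traces of another block, and given the deletion patterns, these traces
fix every position that is not deleted in all of them. A position is deleted in all `T` traces with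
probability `q ^ T`, and `q ^ T < ε / 8` for a `T` of the order of `log_{1/q} (2 / ε)`. Therefore the
greedy code loses only a fraction `ε / 8` of the positions, and besides a factor `4 ^ (L T)` for the
number of pairs of patterns, which is negligible when a letter has `h` bits of data with `h` a large
multiple of `T / ε`.

What remains is to find out which part of a trace belongs to which block. For this, `2 ^ a`
consecutive blocks form a frame, and each letter also records the parity of the number of its frame,
the place of its block in the frame, and a letter of an index code, over an alphabet whose size
depends on `q` only, that can be decoded from a single trace; the index codewords in the blocks of a
frame give the digits of the frame number. A trace is scanned once: every maximal run of letters of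
equal parity is taken for a frame and is stored under the number that it announces. A bad block, in
which too many letters are deleted, can delete or disguise a frame, so that runs merge or are stored
in a wrong place, but the damage is local: at most four stored frames are wrong per bad frame
(`wrongRows_scanRows_le`), and so the number of wrong outer symbols is at most a constant times the
number of bad blocks (`card_word_ne_le`). The blocks are bad independently of each other with a
probability exponentially small in `L`. That a constant fraction of them is bad, which the outer
code would not survive, has therefore a probability exponentially small in `n = N L`
(`exists_prob_many_bad_lt`).

As for time, the inner decoders are tables indexed by strings, or by `T`-tuples of strings, of length
at most `L`. There are at most `(|Σ| + 1) ^ (L T)` of these, which is at most `n` for the chosen `L`;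
and the `O(N log N)` operations of the outer decoder are `O(n)`, since `log N` is of the order of `L`.
The bound on the number of frames by the range of the frame numbers requires the number of blocks in
a frame to exceed about `T log |Σ|`. The place in the frame then takes `a = O(log (2 / ε))` bits for
fixed `q`, which the rate can afford (`exists_parameters`).

The word RAM runs a fixed interpreter. The precomputed description holds the tables and two
straight-line programs, which the interpreter executes with a constant number of steps for each
instruction (`interpreter_computes`, `exists_description`). So it suffices to evaluate encoder and
decoder by straight-line programs of size `O(n)` with one mutable array. These are never written
down: `Avail` says that quantities can be computed by such a program, `Frm` that a quantity is given
by a formula with a certain number of operations, and `Frm.avail` turns the second into the first.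
-/


/-! ### Straight-line programs and their interpreter -/

namespace WordRAM

/-- The instructions of a straight-line machine. Its values form a growing sequence: the `k`-th
instruction appends the `k`-th value, computed from earlier values, which are named by their
positions. Besides, there is one mutable array (`fetch` and `store`), one array of constants
(`look`), and the input strings with their lengths (`input` and `len`). -/
inductive Instr where
  | const (c : ℕ)
  | op (o : Op) (a b : ℕ)
  | look (a : ℕ)
  | fetch (a : ℕ)
  | store (a b : ℕ)
  | copy (a : ℕ)
  | input (j a : ℕ)
  | len (j : ℕ)

/-- The memory of the straight-line machine: the values computed so far and the mutable array. -/
structure Mem where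
  cnt : ℕ
  val : ℕ → ℕ
  arr : ℕ → ℕ

/-- The memory before the first instruction. -/
def Mem.start : Mem := ⟨0, fun _ => 0, fun _ => 0⟩

/-- The value appended by an instruction. -/
def Instr.value (w : ℕ) (tab : ℕ → ℕ) (inp : ℕ → ℕ → ℕ) (len : ℕ → ℕ) (M : Mem) : Instr → ℕ
  | .const c => c
  | .op o a b => o.eval w (M.val a) (M.val b)
  | .look a => tab (M.val a)
  | .fetch a => M.arr (M.val a)
  | .store _ _ => 0
  | .copy a => M.val a
  | .input j a => inp j (M.val a)
  | .len j => len j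

/-- The effect of an instruction on the mutable array. -/
def Instr.newArr (M : Mem) : Instr → ℕ → ℕ
  | .store a b => Function.update M.arr (M.val a) (M.val b)
  | _ => M.arr

/-- One step of the straight-line machine. -/
def Mem.step (w : ℕ) (tab : ℕ → ℕ) (inp : ℕ → ℕ → ℕ) (len : ℕ → ℕ) (M : Mem) (i : Instr) : Mem :=
  ⟨M.cnt + 1, Function.update M.val M.cnt (i.value w tab inp len M), i.newArr M⟩

/-- The execution of a straight-line program. -/
def Mem.exec (w : ℕ) (tab : ℕ → ℕ) (inp : ℕ → ℕ → ℕ) (len : ℕ → ℕ) (M : Mem) (l : List Instr) :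
    Mem :=
  l.foldl (Mem.step w tab inp len) M

/-- The number of an operation. -/
def Op.num : Op → ℕ
  | .add => 1
  | .sub => 2
  | .mul => 3
  | .div => 4
  | .mod => 5

/-- The number of an instruction. -/
def Instr.num : Instr → ℕ
  | .const _ => 0
  | .op o _ _ => o.num
  | .look _ => 6
  | .fetch _ => 7
  | .store _ _ => 8
  | .copy _ => 9
  | .input j _ => 10 + 2 * j
  | .len j => 11 + 2 * j

/-- The first operand of an instruction. -/
def Instr.arg1 : Instr → ℕ
  | .const c => c
  | .op _ a _ => a
  | .look a => a
  | .fetch a => a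
  | .store a _ => a
  | .copy a => a
  | .input _ a => a
  | .len _ => 0

/-- The second operand of an instruction. -/
def Instr.arg2 : Instr → ℕ
  | .op _ _ b => b
  | .store _ b => b
  | _ => 0

/-- An instruction as three words. -/
def Instr.words (i : Instr) : List ℕ := [i.num, i.arg1, i.arg2]

/-- All operands of the instruction are below `B`, and it refers only to the input strings with
numbers `1, …, J`. -/
def Instr.Fits (J B : ℕ) : Instr → Prop
  | .input j a => 1 ≤ j ∧ j ≤ J ∧ a < B
  | .len j => 1 ≤ j ∧ j ≤ J
  | i => i.arg1 < B ∧ i.arg2 < B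

/-! The arrays `0, …, J` hold the description and the inputs, `J + 1` the values, and `J + 2` the
mutable array of the straight-line machine. -/

/-- Branch according to the value of the register `J + 4`, which is compared with `k`, `k + 1`, … -/
def dispatch (J : ℕ) : ℕ → List Prog → Prog
  | _, [] => .skip
  | k, p :: ps => .seq (.const (J + 10) (k + 1)) (.ite (J + 4) (J + 10) p (dispatch J (k + 1) ps))

/-- The reactions of the interpreter to the instruction numbers `10, 11, …`: access to the input
strings `j`, `j + 1`, … -/
def inputCases (J : ℕ) : ℕ → ℕ → List Prog
  | _, 0 => []
  | j, k + 1 => .load (J + 9) j (J + 7) :: .copy (J + 9) j :: inputCases J (j + 1) k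

/-- The reactions of the interpreter to all instruction numbers. -/
def cases (J : ℕ) : List Prog :=
  [.copy (J + 9) (J + 5),
   .op .add (J + 9) (J + 7) (J + 8), .op .sub (J + 9) (J + 7) (J + 8),
   .op .mul (J + 9) (J + 7) (J + 8), .op .div (J + 9) (J + 7) (J + 8),
   .op .mod (J + 9) (J + 7) (J + 8),
   .seq (.op .add (J + 10) (J + 12) (J + 7)) (.load (J + 9) 0 (J + 10)),
   .load (J + 9) (J + 2) (J + 7),
   .seq (.store (J + 2) (J + 7) (J + 8)) (.const (J + 9) 0),
   .copy (J + 9) (J + 7)] ++ inputCases J 0 (J + 1)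

/-- Fetch and execute one instruction. -/
def body (J : ℕ) : Prog :=
  .seq (.load (J + 4) 0 (J + 1)) <| .seq (.op .add (J + 1) (J + 1) (J + 11)) <|
  .seq (.load (J + 5) 0 (J + 1)) <| .seq (.op .add (J + 1) (J + 1) (J + 11)) <|
  .seq (.load (J + 6) 0 (J + 1)) <| .seq (.op .add (J + 1) (J + 1) (J + 11)) <|
  .seq (.load (J + 7) (J + 1) (J + 5)) <| .seq (.load (J + 8) (J + 1) (J + 6)) <|
  .seq (dispatch J 0 (cases J)) <| .seq (.store (J + 1) (J + 3) (J + 9)) <|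
  .op .add (J + 3) (J + 3) (J + 11)

/-- Copy one value to the array `0`. -/
def outBody (J : ℕ) : Prog :=
  .seq (.load (J + 9) (J + 1) (J + 6)) <| .seq (.store 0 (J + 5) (J + 9)) <|
  .seq (.op .add (J + 5) (J + 5) (J + 11)) <| .op .add (J + 6) (J + 6) (J + 11)

/-- The interpreter for straight-line programs that work on `J` input strings besides the
description. The cells `h` and `h + 1` of the description contain the positions of the beginning
and of the end of the program, the cell `4` the position of the table of constants, and the cell
`5` the number `n` of output values; the output consists of the last `n` values. -/
def interpreter (J h : ℕ) : Prog :=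
  .seq (.const (J + 11) 1) <| .seq (.const (J + 10) h) <| .seq (.load (J + 1) 0 (J + 10)) <|
  .seq (.const (J + 10) (h + 1)) <| .seq (.load (J + 2) 0 (J + 10)) <|
  .seq (.const (J + 10) 4) <| .seq (.load (J + 12) 0 (J + 10)) <|
  .seq (.const (J + 10) 5) <| .seq (.load (J + 13) 0 (J + 10)) <|
  .seq (.loop (J + 1) (J + 2) (body J)) <|
  .seq (.const (J + 5) 0) <| .seq (.op .sub (J + 6) (J + 3) (J + 13)) <|
  .loop (J + 5) (J + 13) (outBody J)

theorem State.reg_setReg_of_ne (s : State) {r j : ℕ} (v : ℕ) (h : j ≠ r) :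
    (s.setReg r v).reg j = s.reg j :=
  Function.update_of_ne h _ _

theorem State.mem_setMem_of_ne (s : State) {a j : ℕ} (i v : ℕ) (h : j ≠ a) :
    (s.setMem a i v).mem j = s.mem j :=
  Function.update_of_ne h _ _

/-- A case runs with a loss of two steps per case that is passed over. It may assume nothing about the
register `J + 10`, which the comparisons overwrite. -/
theorem dispatch_runs {w J : ℕ} {Post : State → Prop} {t : ℕ} (ps : List Prog) :
    ∀ (k i : ℕ) (hi : i < ps.length) (s : State), k + ps.length < 2 ^ w → s.reg (J + 4) = k + i →
    (∀ v, ∃ t' ≤ t, ∃ s', Runs w ps[i] (s.setReg (J + 10) v) t' s' ∧ Post s') →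
    ∃ t' ≤ t + 2 * i + 2, ∃ s', Runs w (dispatch J k ps) s t' s' ∧ Post s' := by
  induction ps with
  | nil => intro k i hi; simp at hi
  | cons p ps ih =>
    intro k i hi s hk hs H
    simp only [List.length_cons] at hi hk
    have hmod : (k + 1) % 2 ^ w = k + 1 := Nat.mod_eq_of_lt (by omega)
    have h4 : (s.setReg (J + 10) (k + 1)).reg (J + 4) = k + i := by
      simp [State.setReg, hs]
    have h10 : (s.setReg (J + 10) (k + 1)).reg (J + 10) = k + 1 := by
      simp [State.setReg]
    have hc : Runs w (.const (J + 10) (k + 1)) s 1 (s.setReg (J + 10) (k + 1)) := by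
      have := Runs.const (w := w) s (J + 10) (k + 1)
      rwa [hmod] at this
    cases i with
    | zero =>
      obtain ⟨t', ht', s', hr, hp⟩ := H (k + 1)
      exact ⟨1 + (t' + 1), by omega, s',
        .seq hc (.ite_true (by rw [h4, h10]; omega) (by simpa using hr)), hp⟩
    | succ i =>
      obtain ⟨t', ht', s', hr, hp⟩ := ih (k + 1) i (by omega) (s.setReg (J + 10) (k + 1)) (by omega)
        (by rw [h4]; ring) (fun v => by
          obtain ⟨t', ht', s', hr, hp⟩ := H v
          refine ⟨t', ht', s', ?_, hp⟩
          simpa [State.setReg] using hr)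
      exact ⟨1 + (t' + 1), by omega, s', .seq hc (.ite_false (by rw [h4, h10]; omega) hr), hp⟩

/-- The state `s` of the interpreter represents the memory `M` of the straight-line machine. -/
structure Sim (J : ℕ) (d : ℕ → ℕ) (inp : ℕ → ℕ → ℕ) (len : ℕ → ℕ) (off n last : ℕ) (M : Mem)
    (s : State) : Prop where
  desc : s.mem 0 = d
  inputs : ∀ j, 1 ≤ j → j ≤ J → s.mem j = inp j
  lens : ∀ j, 1 ≤ j → j ≤ J → s.reg j = len j
  vals : s.mem (J + 1) = M.val
  arr : s.mem (J + 2) = M.arr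
  cnt : s.reg (J + 3) = M.cnt
  one : s.reg (J + 11) = 1
  off : s.reg (J + 12) = off
  num : s.reg (J + 13) = n
  last : s.reg (J + 2) = last

section Sim

variable {w J : ℕ} {d : ℕ → ℕ} {inp : ℕ → ℕ → ℕ} {len : ℕ → ℕ} {off n last : ℕ} {M : Mem}
  {s : State}

theorem Sim.setReg (h : Sim J d inp len off n last M s) {r : ℕ}
    (hr : r = J + 1 ∨ (J + 4 ≤ r ∧ r ≤ J + 10)) (v : ℕ) :
    Sim J d inp len off n last M (s.setReg r v) where
  desc := h.desc
  inputs := h.inputs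
  lens j h1 h2 := (s.reg_setReg_of_ne v (by omega)).trans (h.lens j h1 h2)
  vals := h.vals
  arr := h.arr
  cnt := (s.reg_setReg_of_ne v (by omega)).trans h.cnt
  one := (s.reg_setReg_of_ne v (by omega)).trans h.one
  off := (s.reg_setReg_of_ne v (by omega)).trans h.off
  num := (s.reg_setReg_of_ne v (by omega)).trans h.num
  last := (s.reg_setReg_of_ne v (by omega)).trans h.last

theorem getElem_inputCases (J : ℕ) : ∀ k j i : ℕ, i < k →
    (inputCases J j k)[2 * i]? = some (.load (J + 9) (j + i) (J + 7)) ∧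
    (inputCases J j k)[2 * i + 1]? = some (.copy (J + 9) (j + i)) := by
  intro k
  induction k with
  | zero => intro j i hi; omega
  | succ k ih =>
    intro j i hi
    cases i with
    | zero => simp [inputCases]
    | succ i =>
      obtain ⟨h1, h2⟩ := ih (j + 1) i (by omega)
      rw [show 2 * (i + 1) = 2 * i + 1 + 1 by ring]
      simp only [inputCases, List.getElem?_cons_succ, h1, h2]
      rw [show j + 1 + i = j + (i + 1) by ring]
      simp

theorem length_inputCases (J : ℕ) : ∀ k j, (inputCases J j k).length = 2 * k := by
  intro k
  induction k with
  | zero => intro j; rfl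
  | succ k ih => intro j; simp [inputCases, ih]; ring

theorem length_cases (J : ℕ) : (cases J).length = 12 + 2 * J := by
  simp [cases, length_inputCases]; ring

/-- The part of the interpreter that computes the value of an instruction. -/
theorem exists_case_runs (h : Sim J d inp len off n last M s) {i : Instr} {B : ℕ}
    (hfit : i.Fits J B) (h5 : s.reg (J + 5) = i.arg1) (h7 : s.reg (J + 7) = M.val i.arg1)
    (h8 : s.reg (J + 8) = M.val i.arg2) :
    ∃ p, (cases J)[i.num]? = some p ∧ ∃ t' ≤ 2, ∃ s', Runs w p s t' s' ∧
      Sim J d inp len off n last ⟨M.cnt, M.val, i.newArr M⟩ s' ∧ s'.reg (J + 1) = s.reg (J + 1) ∧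
      s'.reg (J + 9) = i.value w (fun x => d ((off + x) % 2 ^ w)) inp len M := by
  have hset : ∀ v, Sim J d inp len off n last M (s.setReg (J + 9) v) :=
    fun v => h.setReg (by omega) v
  have hpc : ∀ v, (s.setReg (J + 9) v).reg (J + 1) = s.reg (J + 1) := fun v => by
    simp [State.setReg]
  have hv : ∀ v, (s.setReg (J + 9) v).reg (J + 9) = v := fun v => by simp [State.setReg]
  cases i with
  | const c =>
    exact ⟨_, rfl, 1, by omega, _, .copy .., hset _, hpc _, by rw [hv]; exact h5⟩
  | op o a b =>
    refine ⟨.op o (J + 9) (J + 7) (J + 8), ?_, 1, by omega, _, .op .., hset _, hpc _, ?_⟩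
    · cases o <;> rfl
    · rw [hv, h7, h8]; rfl
  | look a =>
    refine ⟨_, rfl, 2, le_rfl, _, .seq (.op ..) (.load ..),
      (h.setReg (r := J + 10) (by omega) _).setReg (by omega) _, by simp [State.setReg], ?_⟩
    simp [State.setReg, Instr.value, h.desc, h.off, h7, Op.eval, Instr.arg1]
  | fetch a =>
    refine ⟨_, rfl, 1, by omega, _, .load .., hset _, hpc _, ?_⟩
    rw [hv, h7, h.arr]; rfl
  | store a b =>
    refine ⟨_, rfl, 2, le_rfl, _, .seq (.store ..) (.const ..), ?_, by simp [State.setReg,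
      State.setMem], by simp [State.setReg, Instr.value]⟩
    have h' : Sim J d inp len off n last ⟨M.cnt, M.val, (Instr.store a b).newArr M⟩
        (s.setMem (J + 2) (s.reg (J + 7)) (s.reg (J + 8))) :=
      { desc := (s.mem_setMem_of_ne _ _ (by omega)).trans h.desc
        inputs := fun j h1 h2 => (s.mem_setMem_of_ne _ _ (by omega)).trans (h.inputs j h1 h2)
        lens := h.lens
        vals := (s.mem_setMem_of_ne _ _ (by omega)).trans h.vals
        arr := by
          rw [State.setMem]
          simp only [Function.update_self, h.arr, h7, h8]; rfl
        cnt := h.cnt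
        one := h.one
        off := h.off
        num := h.num
        last := h.last }
    exact h'.setReg (by omega) _
  | copy a =>
    refine ⟨_, rfl, 1, by omega, _, .copy .., hset _, hpc _, ?_⟩
    rw [hv, h7]; rfl
  | input j a =>
    obtain ⟨h1, h2, -⟩ := hfit
    refine ⟨.load (J + 9) j (J + 7), ?_, 1, by omega, _, .load .., hset _, hpc _, ?_⟩
    · rw [cases, List.getElem?_append_right (by simp [Instr.num])]
      have := (getElem_inputCases J (J + 1) 0 j (by omega)).1
      simpa [Instr.num] using this
    · rw [hv, h7, h.inputs j h1 h2]; rfl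
  | len j =>
    obtain ⟨h1, h2⟩ := hfit
    refine ⟨.copy (J + 9) j, ?_, 1, by omega, _, .copy .., hset _, hpc _, ?_⟩
    · rw [cases, List.getElem?_append_right (by simp [Instr.num]; omega)]
      have := (getElem_inputCases J (J + 1) 0 j (by omega)).2
      rw [Nat.zero_add] at this
      rw [← this]
      simp [Instr.num]
      congr 1; omega
    · rw [hv, h.lens j h1 h2]; rfl

theorem Instr.num_lt {i : Instr} {B : ℕ} (h : i.Fits J B) : i.num < 12 + 2 * J := by
  cases i with
  | op o a b => cases o <;> simp [Instr.num, Op.num] <;> omega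
  | input j a => have := h.2.1; simp only [Instr.num]; omega
  | len j => have := h.2; simp only [Instr.num]; omega
  | _ => simp only [Instr.num]; omega

/-- One passage through the loop simulates one instruction of the straight-line machine. -/
theorem body_runs (h : Sim J d inp len off n last M s) {i : Instr} {B pc : ℕ}
    (hfit : i.Fits J B) (hpc : s.reg (J + 1) = pc) (h0 : d pc = i.num) (h1 : d (pc + 1) = i.arg1)
    (h2 : d (pc + 2) = i.arg2) (hw : pc + 3 < 2 ^ w) (hcnt : M.cnt + 1 < 2 ^ w)
    (hJ : 12 + 2 * J < 2 ^ w) :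
    ∃ t' ≤ 4 * J + 40, ∃ s', Runs w (body J) s t' s' ∧
      Sim J d inp len off n last (M.step w (fun x => d ((off + x) % 2 ^ w)) inp len i) s' ∧
      s'.reg (J + 1) = pc + 3 := by
  have e1 : (pc + 1) % 2 ^ w = pc + 1 := Nat.mod_eq_of_lt (by omega)
  have e2 : (pc + 1 + 1) % 2 ^ w = pc + 2 := Nat.mod_eq_of_lt (by omega)
  have e3 : (pc + 2 + 1) % 2 ^ w = pc + 3 := Nat.mod_eq_of_lt (by omega)
  have e4 : (M.cnt + 1) % 2 ^ w = M.cnt + 1 := Nat.mod_eq_of_lt (by omega)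
  -- the state after the operands have been fetched
  set s1 : State := (((((((s.setReg (J + 4) i.num).setReg (J + 1) (pc + 1)).setReg (J + 5)
    i.arg1).setReg (J + 1) (pc + 2)).setReg (J + 6) i.arg2).setReg (J + 1) (pc + 3)).setReg (J + 7)
    (M.val i.arg1)).setReg (J + 8) (M.val i.arg2) with hs1
  have S1 : Sim J d inp len off n last M s1 := by
    refine Sim.setReg (Sim.setReg (Sim.setReg (Sim.setReg (Sim.setReg (Sim.setReg (Sim.setReg
      (Sim.setReg h ?_ _) ?_ _) ?_ _) ?_ _) ?_ _) ?_ _) ?_ _) ?_ _ <;> omega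
  have key : ∀ v, ∃ t' ≤ 2, ∃ s', Runs w ((cases J)[i.num]'(by
      rw [length_cases]; exact Instr.num_lt hfit)) (s1.setReg (J + 10) v) t' s' ∧
      (Sim J d inp len off n last ⟨M.cnt, M.val, i.newArr M⟩ s' ∧ s'.reg (J + 1) = pc + 3 ∧
      s'.reg (J + 9) = i.value w (fun x => d ((off + x) % 2 ^ w)) inp len M) := by
    intro v
    obtain ⟨p, hp, t', ht', s', hr, hS, hpc', hv⟩ := exists_case_runs (w := w)
      (S1.setReg (r := J + 10) (by omega) v) hfit (by simp [hs1, State.setReg])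
      (by simp [hs1, State.setReg]) (by simp [hs1, State.setReg])
    obtain ⟨_, hp'⟩ := List.getElem?_eq_some_iff.1 hp
    refine ⟨t', ht', s', by rw [hp']; exact hr, hS, ?_, hv⟩
    rw [hpc']; simp [hs1, State.setReg]
  obtain ⟨t', ht', s2, hr, hS, hpc2, hv⟩ := dispatch_runs (w := w) (J := J) (cases J) 0 i.num
    (by rw [length_cases]; exact Instr.num_lt hfit) s1 (by rw [length_cases]; omega)
    (by simp [hs1, State.setReg]) key
  have hnum := Instr.num_lt hfit
  refine ⟨1 + (1 + (1 + (1 + (1 + (1 + (1 + (1 + (t' + (1 + 1))))))))), by omega,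
    (s2.setMem (J + 1) (s2.reg (J + 3)) (s2.reg (J + 9))).setReg (J + 3) (M.cnt + 1),
    ?_, ?_, ?_⟩
  · refine .seq (s' := s.setReg (J + 4) i.num) ?_ <|
      .seq (s' := (s.setReg (J + 4) i.num).setReg (J + 1) (pc + 1)) ?_ <|
      .seq (s' := ((s.setReg (J + 4) i.num).setReg (J + 1) (pc + 1)).setReg (J + 5) i.arg1) ?_ <|
      .seq (s' := (((s.setReg (J + 4) i.num).setReg (J + 1) (pc + 1)).setReg (J + 5)
        i.arg1).setReg (J + 1) (pc + 2)) ?_ <|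
      .seq (s' := ((((s.setReg (J + 4) i.num).setReg (J + 1) (pc + 1)).setReg (J + 5)
        i.arg1).setReg (J + 1) (pc + 2)).setReg (J + 6) i.arg2) ?_ <|
      .seq (s' := (((((s.setReg (J + 4) i.num).setReg (J + 1) (pc + 1)).setReg (J + 5)
        i.arg1).setReg (J + 1) (pc + 2)).setReg (J + 6) i.arg2).setReg (J + 1) (pc + 3)) ?_ <|
      .seq (s' := ((((((s.setReg (J + 4) i.num).setReg (J + 1) (pc + 1)).setReg (J + 5)
        i.arg1).setReg (J + 1) (pc + 2)).setReg (J + 6) i.arg2).setReg (J + 1) (pc + 3)).setReg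
        (J + 7) (M.val i.arg1)) ?_ <|
      .seq (s' := s1) ?_ <| .seq hr <| .seq (.store ..) ?_
    · convert Runs.load s (J + 4) 0 (J + 1) using 2
      rw [hpc, h.desc, h0]
    · convert Runs.op _ .add (J + 1) (J + 1) (J + 11) using 2
      simp [State.setReg, Op.eval, hpc, h.one, e1]
    · convert Runs.load _ (J + 5) 0 (J + 1) using 2
      simp [State.setReg, h.desc, h1]
    · convert Runs.op _ .add (J + 1) (J + 1) (J + 11) using 2
      simp [State.setReg, Op.eval, h.one, e2]
    · convert Runs.load _ (J + 6) 0 (J + 1) using 2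
      simp [State.setReg, h.desc, h2]
    · convert Runs.op _ .add (J + 1) (J + 1) (J + 11) using 2
      simp [State.setReg, Op.eval, h.one, e3]
    · convert Runs.load _ (J + 7) (J + 1) (J + 5) using 2
      simp [State.setReg, h.vals]
    · convert Runs.load _ (J + 8) (J + 1) (J + 6) using 2
      simp [State.setReg, h.vals]
    · convert Runs.op _ .add (J + 3) (J + 3) (J + 11) using 2
      simp [State.setMem, Op.eval, hS.one, hS.cnt, e4]
  · exact
      { desc := by
          simp only [State.setMem, State.setReg]; rw [Function.update_of_ne (by omega)]
          exact hS.desc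
        inputs := fun j h1 h2 => by
          simp only [State.setMem, State.setReg]; rw [Function.update_of_ne (by omega)]
          exact hS.inputs j h1 h2
        lens := fun j h1 h2 => by
          simp only [State.setMem, State.setReg]; rw [Function.update_of_ne (by omega)]
          exact hS.lens j h1 h2
        vals := by
          simp only [State.setMem, State.setReg, Function.update_self, hS.vals, hS.cnt, hv]; rfl
        arr := by
          simp only [State.setMem, State.setReg]; rw [Function.update_of_ne (by omega)]
          exact hS.arr
        cnt := by simp [State.setReg, Mem.step]
        one := by simpa [State.setMem, State.setReg] using hS.one
        off := by simpa [State.setMem, State.setReg] using hS.off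
        num := by simpa [State.setMem, State.setReg] using hS.num
        last := by simpa [State.setMem, State.setReg] using hS.last }
  · simpa [State.setMem, State.setReg] using hpc2

/-- The main loop of the interpreter executes the straight-line program. -/
theorem loop_body_runs {B : ℕ} (hJ : 12 + 2 * J < 2 ^ w) (hlast : last < 2 ^ w) (l : List Instr) :
    ∀ (pc : ℕ) (M : Mem) (s : State), Sim J d inp len off n last M s → s.reg (J + 1) = pc →
    last = pc + 3 * l.length → M.cnt + l.length < 2 ^ w →
    (∀ i ∈ l, i.Fits J B) →
    (∀ k (hk : k < l.length), d (pc + 3 * k) = l[k].num ∧ d (pc + 3 * k + 1) = l[k].arg1 ∧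
      d (pc + 3 * k + 2) = l[k].arg2) →
    ∃ t' ≤ (4 * J + 41) * l.length + 1, ∃ s', Runs w (.loop (J + 1) (J + 2) (body J)) s t' s' ∧
      Sim J d inp len off n last (M.exec w (fun x => d ((off + x) % 2 ^ w)) inp len l) s' := by
  induction l with
  | nil =>
    intro pc M s h hpc hst _ _ _
    refine ⟨1, by simp, s, .loop_done ?_, h⟩
    rw [hpc, h.last, hst]; simp
  | cons i l ih =>
    intro pc M s h hpc hst hc hfit hd
    simp only [List.length_cons] at hst hc
    have hd0 := hd 0 (by simp)
    simp only [mul_zero, add_zero, List.getElem_cons_zero] at hd0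
    obtain ⟨t1, ht1, s1, hr1, hS1, hpc1⟩ := body_runs (w := w) h (hfit i (by simp)) hpc hd0.1 hd0.2.1
      hd0.2.2 (by omega) (by omega) hJ
    obtain ⟨t2, ht2, s2, hr2, hS2⟩ := ih (pc + 3) _ s1 hS1 hpc1 (by omega)
      (by simp only [Mem.step]; omega) (fun i hi => hfit i (by simp [hi])) (fun k hk => by
        have := hd (k + 1) (by simpa using hk)
        simpa [mul_add, add_assoc, add_comm, add_left_comm] using this)
    refine ⟨t1 + t2 + 1, ?_, s2, .loop_step ?_ hr1 hr2, hS2⟩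
    · simp only [List.length_cons]; linarith
    · rw [hpc, h.last]; omega

/-- The final loop of the interpreter copies the last values to the array `0`. -/
theorem loop_outBody_runs (V : ℕ → ℕ) : ∀ (r i p : ℕ) (s : State), i + r = n → p + r < 2 ^ w →
    n < 2 ^ w → s.reg (J + 5) = i → s.reg (J + 6) = p → s.reg (J + 11) = 1 →
    s.reg (J + 13) = n → s.mem (J + 1) = V → ∃ t' ≤ 5 * r + 1, ∃ s',
      Runs w (.loop (J + 5) (J + 13) (outBody J)) s t' s' ∧
      (∀ k < i, s'.mem 0 k = s.mem 0 k) ∧ ∀ k < r, s'.mem 0 (i + k) = V (p + k) := by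
  intro r
  induction r with
  | zero =>
    intro i p s hi _ _ h5 _ _ h13 _
    exact ⟨1, by simp, s, .loop_done (by omega), fun _ _ => rfl, fun k hk => by omega⟩
  | succ r ih =>
    intro i p s hi hp hn h5 h6 h11 h13 hV
    have e1 : (i + 1) % 2 ^ w = i + 1 := Nat.mod_eq_of_lt (by omega)
    have e2 : (p + 1) % 2 ^ w = p + 1 := Nat.mod_eq_of_lt (by omega)
    set s1 := ((((s.setReg (J + 9) (V p)).setMem 0 i (V p)).setReg (J + 5) (i + 1)).setReg
      (J + 6) (p + 1)) with hs1
    obtain ⟨t', ht', s', hr, hlow, hval⟩ := ih (i + 1) (p + 1) s1 (by omega) (by omega) hn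
      (by simp [hs1, State.setReg]) (by simp [hs1, State.setReg])
      (by simp [hs1, State.setReg, State.setMem, h11])
      (by simp [hs1, State.setReg, State.setMem, h13])
      (by simp [hs1, State.setReg, State.setMem, hV])
    have hbody : Runs w (outBody J) s (1 + (1 + (1 + 1))) s1 := by
      refine .seq (s' := s.setReg (J + 9) (V p)) ?_ <|
        .seq (s' := (s.setReg (J + 9) (V p)).setMem 0 i (V p)) ?_ <|
        .seq (s' := ((s.setReg (J + 9) (V p)).setMem 0 i (V p)).setReg (J + 5) (i + 1)) ?_ ?_
      · convert Runs.load s (J + 9) (J + 1) (J + 6) using 2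
        rw [hV, h6]
      · convert Runs.store _ 0 (J + 5) (J + 9) using 2 <;> simp [State.setReg, h5]
      · convert Runs.op _ .add (J + 5) (J + 5) (J + 11) using 2
        simp [State.setReg, State.setMem, Op.eval, h5, h11, e1]
      · convert Runs.op _ .add (J + 6) (J + 6) (J + 11) using 2
        simp [State.setReg, State.setMem, Op.eval, h6, h11, e2]
    have hm : ∀ k, s1.mem 0 k = if k = i then V p else s.mem 0 k := fun k => by
      simp [hs1, State.setReg, State.setMem, Function.update_apply]
    refine ⟨_, ?_, s', .loop_step (by omega) hbody hr, fun k hk => ?_, fun k hk => ?_⟩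
    · omega
    · rw [hlow k (by omega), hm, if_neg (by omega)]
    · cases k with
      | zero => rw [add_zero, hlow i (by omega), hm, if_pos rfl]; rfl
      | succ k =>
        have := hval k (by omega)
        rw [show i + (k + 1) = i + 1 + k by ring, this]
        congr 1; ring

end Sim

/-- The interpreter evaluates the straight-line program that stands in the description. -/
theorem interpreter_computes {w J h n off p : ℕ} {d : List ℕ} {inp : List (List ℕ)}
    {l : List Instr} {dd : ℕ → ℕ} {M : Mem} {ii : ℕ → ℕ → ℕ} {ll : ℕ → ℕ} {B : ℕ}
    (hdd : dd = fun i => d.getD i 0 % 2 ^ w) (hinp : inp.length = J)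
    (hii : ∀ j, 1 ≤ j → j ≤ J → ii j = (init w (d :: inp)).mem j)
    (hll : ∀ j, 1 ≤ j → j ≤ J → ll j = (init w (d :: inp)).reg j)
    (hM : M = Mem.start.exec w (fun x => dd ((off + x) % 2 ^ w)) ii ll l)
    (hJ : 12 + 2 * J < 2 ^ w) (hw : h + 5 < 2 ^ w) (hlen : l.length < 2 ^ w)
    (hp : p + 3 * l.length < 2 ^ w) (h0 : dd h = p) (h1 : dd (h + 1) = p + 3 * l.length)
    (h4 : dd 4 = off) (h5 : dd 5 = n) (hn : n ≤ l.length) (hfit : ∀ i ∈ l, i.Fits J B)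
    (hwords : ∀ k (hk : k < l.length), dd (p + 3 * k) = l[k].num ∧
      dd (p + 3 * k + 1) = l[k].arg1 ∧ dd (p + 3 * k + 2) = l[k].arg2)
    {out : List ℕ} (hout : out.length = n)
    (hval : ∀ k (hk : k < out.length), M.val (l.length - n + k) = out[k]) :
    Computes w (interpreter J h) (d :: inp) ((4 * J + 41) * l.length + 5 * n + 20) out := by
  have hcnt : ∀ (l : List Instr) (M : Mem) (tab : ℕ → ℕ), (M.exec w tab ii ll l).cnt =
      M.cnt + l.length := by
    intro l
    induction l with
    | nil => intro M tab; rfl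
    | cons i l ih => intro M tab; rw [List.length_cons, Mem.exec, List.foldl_cons]; exact
        (ih _ _).trans (by simp only [Mem.step]; ring)
  have hMc : M.cnt = l.length := by rw [hM, hcnt]; simp [Mem.start]
  set s0 := init w (d :: inp) with hs0
  have hmem0 : s0.mem 0 = dd := by rw [hdd]; rfl
  have m1 : 1 % 2 ^ w = 1 := Nat.mod_eq_of_lt (by omega)
  have m2 : h % 2 ^ w = h := Nat.mod_eq_of_lt (by omega)
  have m3 : (h + 1) % 2 ^ w = h + 1 := Nat.mod_eq_of_lt (by omega)
  have m4 : 4 % 2 ^ w = 4 := Nat.mod_eq_of_lt (by omega)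
  have m5 : 5 % 2 ^ w = 5 := Nat.mod_eq_of_lt (by omega)
  have hz : ∀ k, s0.reg (J + 1 + k) = 0 := fun k => by
    rw [hs0]; simp only [init]
    rw [List.getD_eq_default _ _ (by simp [hinp])]; simp
  have hzm : ∀ k, s0.mem (J + 1 + k) = fun _ => 0 := fun k => by
    rw [hs0]; simp only [init]
    rw [List.getD_eq_default _ _ (by simp [hinp])]; simp
  set s1 := (((((((((s0.setReg (J + 11) 1).setReg (J + 10) h).setReg (J + 1) p).setReg (J + 10)
    (h + 1)).setReg (J + 2) (p + 3 * l.length)).setReg (J + 10) 4).setReg (J + 12) off).setReg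
    (J + 10) 5).setReg (J + 13) n) with hs1
  have hmem : s1.mem = s0.mem := rfl
  have hS : Sim J dd ii ll off n (p + 3 * l.length) Mem.start s1 :=
    { desc := hmem0
      inputs := fun j h1 h2 => (hii j h1 h2).symm
      lens := fun j h1 h2 => by
        rw [hll j h1 h2]
        rw [hs1]
        iterate 9 rw [State.reg_setReg_of_ne _ _ (by omega)]
      vals := hzm 0
      arr := hzm 1
      cnt := by simpa [hs1, State.setReg, Mem.start] using hz 2
      one := by simp [hs1, State.setReg]
      off := by simp [hs1, State.setReg]
      num := by simp [hs1, State.setReg]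
      last := by simp [hs1, State.setReg] }
  obtain ⟨t2, ht2, s2, hr2, hS2⟩ := loop_body_runs (w := w) hJ hp l p Mem.start s1 hS
    (by simp [hs1, State.setReg]) rfl (by simpa [Mem.start] using hlen) hfit hwords
  rw [← hM] at hS2
  set s3 := (s2.setReg (J + 5) 0).setReg (J + 6) (l.length - n) with hs3
  obtain ⟨t4, ht4, s4, hr4, -, hout4⟩ := loop_outBody_runs (w := w) (J := J) (n := n) M.val n 0
    (l.length - n) s3 (by omega) (by omega) (by omega) (by simp [hs3, State.setReg])
    (by simp [hs3, State.setReg]) (by simpa [hs3, State.setReg] using hS2.one)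
    (by simpa [hs3, State.setReg] using hS2.num) hS2.vals
  refine ⟨1 + (1 + (1 + (1 + (1 + (1 + (1 + (1 + (1 + (t2 + (1 + (1 + t4))))))))))), by linarith, s4,
    ?_, fun k hk => ?_⟩
  · refine .seq (s' := s0.setReg (J + 11) 1) ?_ <|
      .seq (s' := (s0.setReg (J + 11) 1).setReg (J + 10) h) ?_ <|
      .seq (s' := ((s0.setReg (J + 11) 1).setReg (J + 10) h).setReg (J + 1) p) ?_ <|
      .seq (s' := (((s0.setReg (J + 11) 1).setReg (J + 10) h).setReg (J + 1) p).setReg (J + 10)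
        (h + 1)) ?_ <|
      .seq (s' := ((((s0.setReg (J + 11) 1).setReg (J + 10) h).setReg (J + 1) p).setReg (J + 10)
        (h + 1)).setReg (J + 2) (p + 3 * l.length)) ?_ <|
      .seq (s' := (((((s0.setReg (J + 11) 1).setReg (J + 10) h).setReg (J + 1) p).setReg (J + 10)
        (h + 1)).setReg (J + 2) (p + 3 * l.length)).setReg (J + 10) 4) ?_ <|
      .seq (s' := ((((((s0.setReg (J + 11) 1).setReg (J + 10) h).setReg (J + 1) p).setReg (J + 10)
        (h + 1)).setReg (J + 2) (p + 3 * l.length)).setReg (J + 10) 4).setReg (J + 12) off) ?_ <|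
      .seq (s' := (((((((s0.setReg (J + 11) 1).setReg (J + 10) h).setReg (J + 1) p).setReg (J + 10)
        (h + 1)).setReg (J + 2) (p + 3 * l.length)).setReg (J + 10) 4).setReg (J + 12) off).setReg
        (J + 10) 5) ?_ <| .seq (s' := s1) ?_ <| .seq hr2 <|
      .seq (s' := s2.setReg (J + 5) 0) ?_ <| .seq (s' := s3) ?_ hr4
    · convert Runs.const s0 (J + 11) 1 using 2; rw [m1]
    · convert Runs.const _ (J + 10) h using 2; rw [m2]
    · convert Runs.load _ (J + 1) 0 (J + 10) using 2; simp [State.setReg, hmem0, h0]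
    · convert Runs.const _ (J + 10) (h + 1) using 2; rw [m3]
    · convert Runs.load _ (J + 2) 0 (J + 10) using 2; simp [State.setReg, hmem0, h1]
    · convert Runs.const _ (J + 10) 4 using 2; rw [m4]
    · convert Runs.load _ (J + 12) 0 (J + 10) using 2; simp [State.setReg, hmem0, h4]
    · convert Runs.const _ (J + 10) 5 using 2; rw [m5]
    · convert Runs.load _ (J + 13) 0 (J + 10) using 2; simp [State.setReg, hmem0, h5]
    · convert Runs.const _ (J + 5) 0 using 2; rw [Nat.zero_mod]
    · convert Runs.op _ .sub (J + 6) (J + 3) (J + 13) using 2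
      simp [State.setReg, Op.eval, hS2.cnt, hS2.num, hMc]
  · rw [← hval k hk, ← hout4 k (by omega)]
    simp

end WordRAM

/-! ### Computable quantities -/

namespace WordRAM

/-- What a straight-line program works on: the number `J` of input strings, the word length, a
table of constants with `size` entries, and the input strings and their lengths, which depend on
an element of `I`. -/
structure Env (I : Type*) where
  J : ℕ
  w : ℕ
  size : ℕ
  tab : ℕ → ℕ
  inp : I → ℕ → ℕ → ℕ
  len : I → ℕ → ℕ

variable {I : Type*} {E : Env I} {s c c' : ℕ} {Φ Φ' : Set (I → ℕ)} {σ : I → ℕ → ℕ}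
  {f g : I → ℕ}

/-- The memory of the straight-line machine after running `l` on the input `x`; the table of
constants may continue arbitrarily beyond its size. -/
def Env.run (E : Env I) (tab : ℕ → ℕ) (x : I) (l : List Instr) : Mem :=
  Mem.start.exec E.w tab (E.inp x) (E.len x) l

/-- The function `t` extends the table of constants. -/
def Env.Extends (E : Env I) (t : ℕ → ℕ) : Prop := ∀ i < E.size, t i = E.tab i

/-- A straight-line program of at most `s` instructions computes all the quantities in `Φ`, each
as the value of a fixed instruction, and leaves the mutable array in the state `σ`. -/
def Avail (E : Env I) (s : ℕ) (Φ : Set (I → ℕ)) (σ : I → ℕ → ℕ) : Prop :=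
  ∃ l : List Instr, l.length ≤ s ∧ (∀ i ∈ l, i.Fits E.J (max l.length (2 ^ E.w))) ∧
    (∀ φ ∈ Φ, ∃ k < l.length, ∀ t, E.Extends t → ∀ x, (E.run t x l).val k = φ x) ∧
    ∀ t, E.Extends t → ∀ x, (E.run t x l).arr = σ x

/-- A straight-line program of at most `s` instructions ends with the `n` values `out x`. -/
def Evaluates (E : Env I) (s n : ℕ) (out : I → Fin n → ℕ) : Prop :=
  ∃ l : List Instr, l.length ≤ s ∧ n ≤ l.length ∧
    (∀ i ∈ l, i.Fits E.J (max l.length (2 ^ E.w))) ∧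
    ∀ t, E.Extends t → ∀ x, ∀ k : Fin n, (E.run t x l).val (l.length - n + k) = out x k

/-- The quantity is the value of a formula with `c` operations over the quantities in `Φ` and the
mutable array in the state `σ`. -/
inductive Frm (E : Env I) (Φ : Set (I → ℕ)) (σ : I → ℕ → ℕ) : ℕ → (I → ℕ) → Prop where
  | wire {f : I → ℕ} : f ∈ Φ → Frm E Φ σ 0 f
  | const {a : ℕ} : a < 2 ^ E.w → Frm E Φ σ 1 fun _ => a
  | op (o : Op) {c c' : ℕ} {f g : I → ℕ} : Frm E Φ σ c f → Frm E Φ σ c' g →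
      Frm E Φ σ (c + c' + 1) fun x => o.eval E.w (f x) (g x)
  | look {c : ℕ} {f : I → ℕ} : Frm E Φ σ c f → (∀ x, f x < E.size) →
      Frm E Φ σ (c + 1) fun x => E.tab (f x)
  | fetch {c : ℕ} {f : I → ℕ} : Frm E Φ σ c f → Frm E Φ σ (c + 1) fun x => σ x (f x)
  | input {j c : ℕ} {f : I → ℕ} : 1 ≤ j → j ≤ E.J → Frm E Φ σ c f →
      Frm E Φ σ (c + 1) fun x => E.inp x j (f x)
  | len {j : ℕ} : 1 ≤ j → j ≤ E.J → Frm E Φ σ 1 fun x => E.len x j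
  | mono {c c' : ℕ} {f : I → ℕ} : Frm E Φ σ c f → c ≤ c' → Frm E Φ σ c' f

theorem Instr.Fits.mono {i : Instr} {J B B' : ℕ} (h : i.Fits J B) (hB : B ≤ B') : i.Fits J B' := by
  cases i <;> simp only [Instr.Fits] at * <;> omega

theorem Env.run_append_singleton (E : Env I) (t : ℕ → ℕ) (x : I) (l : List Instr) (i : Instr) :
    E.run t x (l ++ [i]) = (E.run t x l).step E.w t (E.inp x) (E.len x) i := by
  simp [Env.run, Mem.exec]

theorem Env.run_cnt (E : Env I) (t : ℕ → ℕ) (x : I) (l : List Instr) :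
    (E.run t x l).cnt = l.length := by
  induction l using List.reverseRecOn with
  | nil => rfl
  | append_singleton l i ih => rw [E.run_append_singleton]; simp [Mem.step, ih]

theorem Env.run_append_singleton_val (E : Env I) (t : ℕ → ℕ) (x : I) (l : List Instr) (i : Instr)
    {k : ℕ} (hk : k < l.length) : (E.run t x (l ++ [i])).val k = (E.run t x l).val k := by
  rw [E.run_append_singleton, Mem.step, E.run_cnt]
  exact Function.update_of_ne (by omega) _ _

theorem Env.run_append_singleton_val_length (E : Env I) (t : ℕ → ℕ) (x : I) (l : List Instr)
    (i : Instr) : (E.run t x (l ++ [i])).val l.length =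
      i.value E.w t (E.inp x) (E.len x) (E.run t x l) := by
  rw [E.run_append_singleton, Mem.step, E.run_cnt]
  exact Function.update_self _ _ _

theorem Avail.start (E : Env I) : Avail E 0 ∅ fun _ _ => 0 :=
  ⟨[], by simp, by simp, by simp, fun _ _ _ => rfl⟩

theorem Avail.mono {s' : ℕ} (h : Avail E s Φ σ) (hs : s ≤ s') (hΦ : Φ' ⊆ Φ) : Avail E s' Φ' σ := by
  obtain ⟨l, h1, h2, h3, h4⟩ := h
  exact ⟨l, h1.trans hs, h2, fun φ hφ => h3 φ (hΦ hφ), h4⟩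

theorem fits_append {J w : ℕ} {l : List Instr} {i : Instr}
    (h : ∀ i ∈ l, i.Fits J (max l.length (2 ^ w))) (hi : i.Fits J (max l.length (2 ^ w))) :
    ∀ j ∈ l ++ [i], j.Fits J (max (l ++ [i]).length (2 ^ w)) := by
  intro j hj
  have hle : max l.length (2 ^ w) ≤ max (l ++ [i]).length (2 ^ w) := by simp; omega
  rcases List.mem_append.1 hj with hj | hj
  · exact (h j hj).mono hle
  · rw [List.mem_singleton.1 hj]; exact hi.mono hle

/-- One more instruction makes one more quantity available. -/
theorem avail_append_singleton {l : List Instr} (hs : l.length ≤ s)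
    (hfit : ∀ i ∈ l, i.Fits E.J (max l.length (2 ^ E.w)))
    (hΦ : ∀ φ ∈ Φ, ∃ k < l.length, ∀ t, E.Extends t → ∀ x, (E.run t x l).val k = φ x)
    {i : Instr} (hi : i.Fits E.J (max l.length (2 ^ E.w)))
    (hf : ∀ t, E.Extends t → ∀ x, i.value E.w t (E.inp x) (E.len x) (E.run t x l) = f x)
    (hσ : ∀ t, E.Extends t → ∀ x, i.newArr (E.run t x l) = σ x) :
    Avail E (s + 1) (insert f Φ) σ := by
  refine ⟨l ++ [i], by simpa using hs, fits_append hfit hi, ?_, fun t ht x => ?_⟩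
  · rintro φ (rfl | hφ)
    · exact ⟨l.length, by simp, fun t ht x => by rw [E.run_append_singleton_val_length, hf t ht]⟩
    · obtain ⟨k, hk, h⟩ := hΦ φ hφ
      exact ⟨k, by simp; omega, fun t ht x => by
        rw [E.run_append_singleton_val _ _ _ _ hk, h t ht]⟩
  · rw [E.run_append_singleton, Mem.step]; exact hσ t ht x

theorem lt_max_left {a b c : ℕ} (h : a < b) : a < max b c := h.trans_le (le_max_left _ _)

/-- The value of a formula can be made available. -/
theorem Frm.avail (h : Frm E Φ σ c f) : ∀ (s : ℕ) (Φ' : Set (I → ℕ)), Φ ⊆ Φ' → Avail E s Φ' σ →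
    Avail E (s + c) (insert f Φ') σ := by
  induction h with
  | wire hf => intro s Φ' hs h; rwa [Set.insert_eq_of_mem (hs hf)]
  | const hc =>
    rintro s Φ' hs ⟨l, h1, h2, h3, h4⟩
    exact avail_append_singleton h1 h2 h3 (i := .const _)
      ⟨hc.trans_le (le_max_right _ _), show 0 < _ from lt_max_of_lt_right (by positivity)⟩
      (fun _ _ _ => rfl) h4
  | @op o c c' f g hf hg ihf ihg =>
    intro s Φ' hs h
    obtain ⟨l, h1, h2, h3, h4⟩ := ihg _ _ (hs.trans (Set.subset_insert _ _)) (ihf s Φ' hs h)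
    obtain ⟨k, hk, hkv⟩ := h3 f (by simp)
    obtain ⟨k', hk', hkv'⟩ := h3 g (by simp)
    refine (avail_append_singleton h1 h2 h3 (i := .op o k k')
      (f := fun x => o.eval E.w (f x) (g x)) ⟨lt_max_left hk, lt_max_left hk'⟩
      (fun t ht x => ?_) h4).mono (by omega) ?_
    · simp only [Instr.value, hkv t ht, hkv' t ht]
    · exact Set.insert_subset_insert ((Set.subset_insert _ _).trans (Set.subset_insert _ _))
  | @look c f hf hsize ih =>
    intro s Φ' hs h
    obtain ⟨l, h1, h2, h3, h4⟩ := ih s Φ' hs h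
    obtain ⟨k, hk, hkv⟩ := h3 f (by simp)
    refine (avail_append_singleton h1 h2 h3 (i := .look k) (f := fun x => E.tab (f x))
      ⟨lt_max_left hk, show 0 < _ from lt_max_of_lt_right (by positivity)⟩
      (fun t ht x => ?_) h4).mono (by omega) (Set.insert_subset_insert (Set.subset_insert _ _))
    simp only [Instr.value, hkv t ht, ht _ (hsize x)]
  | @fetch c f hf ih =>
    intro s Φ' hs h
    obtain ⟨l, h1, h2, h3, h4⟩ := ih s Φ' hs h
    obtain ⟨k, hk, hkv⟩ := h3 f (by simp)
    refine (avail_append_singleton h1 h2 h3 (i := .fetch k) (f := fun x => σ x (f x))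
      ⟨lt_max_left hk, show 0 < _ from lt_max_of_lt_right (by positivity)⟩
      (fun t ht x => ?_) h4).mono (by omega) (Set.insert_subset_insert (Set.subset_insert _ _))
    simp only [Instr.value, hkv t ht, h4 t ht]
  | @input j c f hj hj' hf ih =>
    intro s Φ' hs h
    obtain ⟨l, h1, h2, h3, h4⟩ := ih s Φ' hs h
    obtain ⟨k, hk, hkv⟩ := h3 f (by simp)
    refine (avail_append_singleton h1 h2 h3 (i := .input j k) (f := fun x => E.inp x j (f x))
      ⟨hj, hj', lt_max_left hk⟩
      (fun t ht x => ?_) h4).mono (by omega) (Set.insert_subset_insert (Set.subset_insert _ _))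
    simp only [Instr.value, hkv t ht]
  | @len j hj hj' =>
    rintro s Φ' hs ⟨l, h1, h2, h3, h4⟩
    exact avail_append_singleton h1 h2 h3 (i := .len j) ⟨hj, hj'⟩ (fun _ _ _ => rfl) h4
  | mono hf hc ih =>
    intro s Φ' hs h
    exact (ih s Φ' hs h).mono (by omega) subset_rfl

theorem Avail.frm (h : Avail E s Φ σ) (hf : Frm E Φ σ c f) : Avail E (s + c) (insert f Φ) σ :=
  hf.avail s Φ subset_rfl h

/-- The values of a finite family of formulas can be made available. -/
theorem Avail.family {ι : Type*} (h : Avail E s Φ σ) (S : Finset ι) {f : ι → I → ℕ} {c : ι → ℕ}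
    (hf : ∀ k ∈ S, Frm E Φ σ (c k) (f k)) :
    Avail E (s + ∑ k ∈ S, c k) (Φ ∪ f '' S) σ := by
  classical
  induction S using Finset.induction_on with
  | empty => simpa using h
  | insert a S ha ih =>
    have := (hf a (by simp)).avail _ _ Set.subset_union_left
      (ih fun k hk => hf k (by simp [hk]))
    rw [Finset.sum_insert ha]
    refine this.mono (by omega) ?_
    rw [Finset.coe_insert, Set.image_insert_eq, Set.union_insert]

/-- A store instruction whose operands are values of formulas. -/
theorem Avail.store (h : Avail E s Φ σ) (hf : Frm E Φ σ c f) (hg : Frm E Φ σ c' g) :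
    Avail E (s + c + c' + 1) Φ fun x => Function.update (σ x) (f x) (g x) := by
  obtain ⟨l, h1, h2, h3, h4⟩ := hg.avail _ _ (Set.subset_insert _ _) (h.frm hf)
  obtain ⟨k, hk, hkv⟩ := h3 f (by simp)
  obtain ⟨k', hk', hkv'⟩ := h3 g (by simp)
  refine (avail_append_singleton h1 h2 h3 (i := .store k k') (f := fun _ => 0)
    ⟨lt_max_left hk, lt_max_left hk'⟩ (fun t ht x => rfl) (fun t ht x => ?_)).mono (by omega)
    ((Set.subset_insert _ _).trans ((Set.subset_insert _ _).trans (Set.subset_insert _ _)))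
  simp only [Instr.newArr, hkv t ht, hkv' t ht, h4 t ht]

/-- Available quantities can be brought into the order of an output string. -/
theorem Avail.evaluates {n : ℕ} (h : Avail E s Φ σ) {out : I → Fin n → ℕ}
    (hout : ∀ k, (fun x => out x k) ∈ Φ) : Evaluates E (s + n) n out := by
  induction n with
  | zero =>
    obtain ⟨l, h1, h2, -, -⟩ := h
    exact ⟨l, h1, by omega, h2, fun _ _ _ k => k.elim0⟩
  | succ n ih =>
    obtain ⟨l, h1, h2, h3, h4⟩ := h
    -- the copies are produced one by one, so the statement is strengthened accordingly
    have key : ∀ r ≤ n + 1, ∃ l' : List Instr, l'.length = l.length + r ∧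
        (∀ i ∈ l', i.Fits E.J (max l'.length (2 ^ E.w))) ∧
        (∀ k < l.length, ∀ t x, (E.run t x l').val k = (E.run t x l).val k) ∧
        ∀ k : Fin (n + 1), k < r → ∀ t, E.Extends t → ∀ x,
          (E.run t x l').val (l.length + k) = out x k := by
      intro r
      induction r with
      | zero => exact fun _ => ⟨l, rfl, h2, fun _ _ _ _ => rfl, fun k hk => by omega⟩
      | succ r ihr =>
        intro hr
        obtain ⟨l', g1, g2, g3, g4⟩ := ihr (by omega)
        obtain ⟨k, hk, hkv⟩ := h3 _ (hout ⟨r, by omega⟩)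
        refine ⟨l' ++ [.copy k], by simp [g1]; ring, fits_append g2 (i := .copy k)
          ⟨lt_max_left (show k < _ by omega), show 0 < _ from lt_max_of_lt_right (by positivity)⟩, fun k hk t x => ?_,
          fun k' hk' t ht x => ?_⟩
        · rw [E.run_append_singleton_val _ _ _ _ (by omega), g3 k hk]
        · rcases Nat.lt_succ_iff_lt_or_eq.1 hk' with hlt | heq
          · rw [E.run_append_singleton_val _ _ _ _ (by omega), g4 k' hlt t ht]
          · have := E.run_append_singleton_val_length t x l' (.copy k)
            rw [g1] at this
            rw [heq, this, Instr.value, g3 k hk, hkv t ht]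
            congr 1; exact Fin.ext heq.symm
    obtain ⟨l', g1, g2, -, g4⟩ := key (n + 1) le_rfl
    refine ⟨l', by omega, by omega, g2, fun t ht x k => ?_⟩
    rw [← g4 k k.2 t ht x]
    congr 1; omega

/-! Formulas for arithmetic without overflow and for tests. -/

section Formulas

theorem Frm.congr (h : Frm E Φ σ c f) (hfg : ∀ x, f x = g x) : Frm E Φ σ c g := by
  rwa [show g = f from funext fun x => (hfg x).symm]

theorem Frm.of_subset (h : Frm E Φ σ c f) (hΦ : Φ ⊆ Φ') : Frm E Φ' σ c f := by
  induction h with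
  | wire h => exact .wire (hΦ h)
  | const h => exact .const h
  | op o _ _ ih1 ih2 => exact .op o ih1 ih2
  | look _ h ih => exact .look ih h
  | fetch _ ih => exact .fetch ih
  | input h h' _ ih => exact .input h h' ih
  | len h h' => exact .len h h'
  | mono _ h ih => exact .mono ih h

theorem Frm.add (hf : Frm E Φ σ c f) (hg : Frm E Φ σ c' g) (h : ∀ x, f x + g x < 2 ^ E.w) :
    Frm E Φ σ (c + c' + 1) fun x => f x + g x :=
  (Frm.op .add hf hg).congr fun x => Nat.mod_eq_of_lt (h x)

theorem Frm.mul (hf : Frm E Φ σ c f) (hg : Frm E Φ σ c' g) (h : ∀ x, f x * g x < 2 ^ E.w) :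
    Frm E Φ σ (c + c' + 1) fun x => f x * g x :=
  (Frm.op .mul hf hg).congr fun x => Nat.mod_eq_of_lt (h x)

theorem Frm.sub (hf : Frm E Φ σ c f) (hg : Frm E Φ σ c' g) :
    Frm E Φ σ (c + c' + 1) fun x => f x - g x :=
  .op .sub hf hg

theorem Frm.div (hf : Frm E Φ σ c f) (hg : Frm E Φ σ c' g) :
    Frm E Φ σ (c + c' + 1) fun x => f x / g x :=
  .op .div hf hg

theorem Frm.mod (hf : Frm E Φ σ c f) (hg : Frm E Φ σ c' g) :
    Frm E Φ σ (c + c' + 1) fun x => f x % g x :=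
  .op .mod hf hg

theorem Frm.sum {ι : Type*} (S : Finset ι) {f : ι → I → ℕ} {c : ι → ℕ}
    (hf : ∀ k ∈ S, Frm E Φ σ (c k) (f k)) (h : ∀ x, ∑ k ∈ S, f k x < 2 ^ E.w) :
    Frm E Φ σ (∑ k ∈ S, (c k + 1) + 1) fun x => ∑ k ∈ S, f k x := by
  classical
  induction S using Finset.induction_on with
  | empty => exact (Frm.const (a := 0) (by positivity)).congr fun x => by simp
  | insert a S ha ih =>
    have hx : ∀ x, f a x + ∑ k ∈ S, f k x < 2 ^ E.w := fun x => by
      have := h x; rwa [Finset.sum_insert ha] at this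
    rw [Finset.sum_insert ha]
    refine (((hf a (by simp)).add (ih (fun k hk => hf k (by simp [hk])) fun x =>
      (Nat.le_add_left _ _).trans_lt (hx x)) hx).congr fun x => ?_).mono (by omega)
    rw [Finset.sum_insert ha]

/-- The truth value of `f x < g x`. -/
theorem Frm.lt (hf : Frm E Φ σ c f) (hg : Frm E Φ σ c' g) (hw : 1 ≤ E.w) :
    Frm E Φ σ (c + c' + 5) fun x => if f x < g x then 1 else 0 := by
  have h1 : Frm E Φ σ 1 fun _ => 1 := .const (Nat.one_lt_two_pow (by omega))
  refine ((h1.sub (h1.sub (hg.sub hf))).congr fun x => ?_).mono (by omega)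
  split_ifs <;> omega

/-- The truth value of `f x = g x`. -/
theorem Frm.eq (hf : Frm E Φ σ c f) (hg : Frm E Φ σ c' g) (hw : 1 ≤ E.w)
    (hf' : ∀ x, f x < 2 ^ E.w) (hg' : ∀ x, g x < 2 ^ E.w) :
    Frm E Φ σ (2 * c + 2 * c' + 5) fun x => if f x = g x then 1 else 0 := by
  have h1 : Frm E Φ σ 1 fun _ => 1 := .const (Nat.one_lt_two_pow (by omega))
  refine ((h1.sub ((hf.sub hg).add (hg.sub hf) fun x => ?_)).congr fun x => ?_).mono (by omega)
  · have := hf' x; have := hg' x; omega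
  · split_ifs <;> omega

theorem Frm.and {P P' : I → Prop} [DecidablePred P] [DecidablePred P']
    (hf : Frm E Φ σ c fun x => if P x then 1 else 0)
    (hg : Frm E Φ σ c' fun x => if P' x then 1 else 0) (hw : 1 ≤ E.w) :
    Frm E Φ σ (c + c' + 1) fun x => if P x ∧ P' x then 1 else 0 := by
  refine (hf.mul hg fun x => ?_).congr fun x => ?_
  · have := Nat.one_lt_two_pow (n := E.w) (by omega)
    split_ifs <;> simp
    all_goals omega
  · split_ifs <;> simp_all

theorem Frm.not {P : I → Prop} [DecidablePred P]
    (hf : Frm E Φ σ c fun x => if P x then 1 else 0) (hw : 1 ≤ E.w) :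
    Frm E Φ σ (c + 2) fun x => if ¬ P x then 1 else 0 := by
  have h1 : Frm E Φ σ 1 fun _ => 1 := .const (Nat.one_lt_two_pow (by omega))
  refine ((h1.sub hf).congr fun x => ?_).mono (by omega)
  split_ifs <;> simp_all

/-- Selection between two values according to a test. -/
theorem Frm.ite {P : I → Prop} [DecidablePred P] {p : ℕ}
    (hp : Frm E Φ σ p fun x => if P x then 1 else 0)
    (hf : Frm E Φ σ c f) (hg : Frm E Φ σ c' g) (hw : 1 ≤ E.w) (hf' : ∀ x, f x < 2 ^ E.w)
    (hg' : ∀ x, g x < 2 ^ E.w) :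
    Frm E Φ σ (2 * p + c + c' + 5) fun x => if P x then f x else g x := by
  refine (((hp.mul hf fun x => ?_).add ((hp.not hw).mul hg fun x => ?_) fun x => ?_).congr
    fun x => ?_).mono (by omega)
  · have := hf' x; split_ifs <;> simp [this]
  · have := hg' x; split_ifs <;> simp [this]
  · have := hf' x; have := hg' x; split_ifs <;> simpa
  · split_ifs <;> simp

end Formulas

/-! The description that makes the interpreter evaluate two straight-line programs. -/

/-- The instructions of a program as a list of words. -/
def encode (l : List Instr) : List ℕ := l.flatMap Instr.words

theorem length_encode (l : List Instr) : (encode l).length = 3 * l.length := by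
  induction l with
  | nil => rfl
  | cons i l ih => simp only [encode, List.flatMap_cons, List.length_append] at ih ⊢
                   rw [ih]; simp [Instr.words]; ring

theorem getElem?_encode (l : List Instr) : ∀ k (hk : k < l.length),
    (encode l)[3 * k]? = some l[k].num ∧ (encode l)[3 * k + 1]? = some l[k].arg1 ∧
    (encode l)[3 * k + 2]? = some l[k].arg2 := by
  induction l with
  | nil => intro k hk; simp at hk
  | cons i l ih =>
    intro k hk
    cases k with
    | zero => simp [encode, Instr.words]
    | succ k =>
      have := ih k (by simpa using hk)
      rw [show 3 * (k + 1) = 3 * k + 1 + 1 + 1 by ring]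
      simpa [encode, Instr.words] using this

theorem Instr.arg_lt {i : Instr} {J B : ℕ} (h : i.Fits J B) (hB : 0 < B) :
    i.arg1 < B ∧ i.arg2 < B := by
  cases i <;> simp only [Instr.Fits, Instr.arg1, Instr.arg2] at * <;> omega

variable {I₁ I₂ : Type*}

/-- Two straight-line programs on the same table have a common description. -/
theorem exists_description {E₁ : Env I₁} {E₂ : Env I₂} {J₁ J₂ w size n s₁ s₂ : ℕ} {tab : ℕ → ℕ}
    {out₁ : I₁ → Fin n → ℕ} {out₂ : I₂ → Fin n → ℕ}
    (hE₁ : E₁.J = J₁ ∧ E₁.w = w ∧ E₁.size = size ∧ E₁.tab = tab)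
    (hE₂ : E₂.J = J₂ ∧ E₂.w = w ∧ E₂.size = size ∧ E₂.tab = tab)
    (h₁ : Evaluates E₁ s₁ n out₁) (h₂ : Evaluates E₂ s₂ n out₂)
    (hw : 12 + 2 * J₁ + 2 * J₂ + 3 * s₁ + 3 * s₂ + size < 2 ^ w) (htab : ∀ i < size, tab i < 2 ^ w) :
    ∃ d : List ℕ, d.length ≤ 6 + 3 * s₁ + 3 * s₂ + size ∧
      (∀ x (inp : List (List ℕ)), inp.length = J₁ →
        (∀ j < J₁, E₁.inp x (j + 1) = (fun i => (inp.getD j []).getD i 0 % 2 ^ w) ∧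
          E₁.len x (j + 1) = (inp.getD j []).length % 2 ^ w) →
        Computes w (interpreter J₁ 0) (d :: inp) ((4 * J₁ + 41) * s₁ + 5 * n + 20)
          (List.ofFn (out₁ x))) ∧
      (∀ x (inp : List (List ℕ)), inp.length = J₂ →
        (∀ j < J₂, E₂.inp x (j + 1) = (fun i => (inp.getD j []).getD i 0 % 2 ^ w) ∧
          E₂.len x (j + 1) = (inp.getD j []).length % 2 ^ w) →
        Computes w (interpreter J₂ 2) (d :: inp) ((4 * J₂ + 41) * s₂ + 5 * n + 20)
          (List.ofFn (out₂ x))) := by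
  obtain ⟨l₁, a1, a2, a3, a4⟩ := h₁
  obtain ⟨l₂, b1, b2, b3, b4⟩ := h₂
  set off := 6 + 3 * l₁.length + 3 * l₂.length with hoff
  set hd : List ℕ := [6, 6 + 3 * l₁.length, 6 + 3 * l₁.length, off, off, n] with hhd
  set d : List ℕ := hd ++ encode l₁ ++ encode l₂ ++ (List.range size).map tab with hd'
  set dd : ℕ → ℕ := fun i => d.getD i 0 % 2 ^ w with hdd
  have hlen : hd.length = 6 := rfl
  have hdl : d.length = off + size := by simp [hd', length_encode, hlen, hoff]; omega
  have e0 : dd 0 = 6 := Nat.mod_eq_of_lt (by simp [hd', hhd]; omega)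
  have e1 : dd 1 = 6 + 3 * l₁.length := by
    have : d.getD 1 0 = 6 + 3 * l₁.length := by simp [hd', hhd]
    rw [hdd]; simp only [this]; exact Nat.mod_eq_of_lt (by omega)
  have e2 : dd 2 = 6 + 3 * l₁.length := by
    have : d.getD 2 0 = 6 + 3 * l₁.length := by simp [hd', hhd]
    rw [hdd]; simp only [this]; exact Nat.mod_eq_of_lt (by omega)
  have e3 : dd 3 = off := by
    have : d.getD 3 0 = off := by simp [hd', hhd]
    rw [hdd]; simp only [this]; exact Nat.mod_eq_of_lt (by omega)
  have e4 : dd 4 = off := by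
    have : d.getD 4 0 = off := by simp [hd', hhd]
    rw [hdd]; simp only [this]; exact Nat.mod_eq_of_lt (by omega)
  have e5 : dd 5 = n := by
    have : d.getD 5 0 = n := by simp [hd', hhd]
    rw [hdd]; simp only [this]; exact Nat.mod_eq_of_lt (by omega)
  have htab' : ∀ i < size, dd ((off + i) % 2 ^ w) = tab i := fun i hi => by
    rw [Nat.mod_eq_of_lt (by omega), hdd]
    have : d.getD (off + i) 0 = tab i := by
      rw [List.getD_eq_getElem?_getD, hd', List.getElem?_append_right
        (by simp [length_encode, hlen, hoff]; omega)]
      have : off + i - (hd ++ encode l₁ ++ encode l₂).length = i := by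
        simp [length_encode, hlen, hoff]; omega
      rw [this]; simp [hi]
    simp only [this]; exact Nat.mod_eq_of_lt (htab i hi)
  have hget : ∀ (J : ℕ), 12 + 2 * J < 2 ^ w → ∀ (l : List Instr) (p : ℕ) (pre post : List ℕ), d = pre ++ encode l ++ post →
      pre.length = p → (∀ i ∈ l, i.Fits J (max l.length (2 ^ w))) → l.length < 2 ^ w →
      ∀ k (hk : k < l.length), dd (p + 3 * k) = l[k].num ∧
      dd (p + 3 * k + 1) = l[k].arg1 ∧ dd (p + 3 * k + 2) = l[k].arg2 := by
    intro J hJ l p pre post hdeq hp hfit hl k hk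
    have hF := hfit l[k] (List.getElem_mem hk)
    rw [max_eq_right hl.le] at hF
    obtain ⟨g1, g2, g3⟩ := getElem?_encode l k hk
    have hk3 : 3 * k + 2 < (encode l).length := by rw [length_encode]; omega
    have key : ∀ i, 3 * k ≤ i → i ≤ 3 * k + 2 → d.getD (p + i) 0 = ((encode l)[i]?).getD 0 := by
      intro i h1 h2
      rw [List.getD_eq_getElem?_getD, hdeq, List.append_assoc, List.getElem?_append_right
        (by omega), hp, Nat.add_sub_cancel_left, List.getElem?_append_left (by omega)]
    have hA := Instr.arg_lt hF (by omega)
    have hN := Instr.num_lt hF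
    refine ⟨?_, ?_, ?_⟩
    · simp only [hdd, key (3 * k) le_rfl (by omega), g1, Option.getD_some]
      exact Nat.mod_eq_of_lt (by omega)
    · simp only [hdd, add_assoc, key (3 * k + 1) (by omega) (by omega), g2, Option.getD_some]
      exact Nat.mod_eq_of_lt hA.1
    · simp only [hdd, add_assoc, key (3 * k + 2) (by omega) (by omega), g3, Option.getD_some]
      exact Nat.mod_eq_of_lt hA.2
  obtain ⟨rfl, rfl, rfl, rfl⟩ := hE₁
  obtain ⟨rfl, c2, c3, c4⟩ := hE₂
  refine ⟨d, by omega, fun x inp hinp hx => ?_, fun x inp hinp hx => ?_⟩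
  · have hx' : ∀ j, 1 ≤ j → j ≤ E₁.J → E₁.inp x j = (init E₁.w (d :: inp)).mem j ∧
        E₁.len x j = (init E₁.w (d :: inp)).reg j := by
      intro j h1 h2
      obtain ⟨j, rfl⟩ := Nat.exists_eq_add_of_le' h1
      exact hx j (by omega)
    have := interpreter_computes (w := E₁.w) (h := 0) (p := 6) (off := off) hdd hinp
      (fun j h1 h2 => (hx' j h1 h2).1)
      (fun j h1 h2 => (hx' j h1 h2).2) (M := E₁.run (fun x => dd ((off + x) % 2 ^ E₁.w)) x l₁) rfl
      (by omega) (by omega) (by omega) (by omega) e0 e1 e4 e5 a2 a3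
      (hget E₁.J (by omega) l₁ 6 hd (encode l₂ ++ (List.range E₁.size).map E₁.tab) (by simp [hd']) hlen a3
        (by omega)) (out := List.ofFn (out₁ x)) (by simp)
      (fun k hk => by
        simp only [List.length_ofFn] at hk
        rw [List.getElem_ofFn]
        exact a4 _ htab' x ⟨k, hk⟩)
    obtain ⟨t', ht', r⟩ := this
    exact ⟨t', ht'.trans (by gcongr), r⟩
  · have hx' : ∀ j, 1 ≤ j → j ≤ E₂.J → E₂.inp x j = (init E₁.w (d :: inp)).mem j ∧
        E₂.len x j = (init E₁.w (d :: inp)).reg j := by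
      intro j h1 h2
      obtain ⟨j, rfl⟩ := Nat.exists_eq_add_of_le' h1
      exact hx j (by omega)
    rw [c2] at b3
    have := interpreter_computes (w := E₁.w) (h := 2) (p := 6 + 3 * l₁.length) (off := off) hdd hinp
      (fun j h1 h2 => (hx' j h1 h2).1) (fun j h1 h2 => (hx' j h1 h2).2)
      (M := E₂.run (fun x => dd ((off + x) % 2 ^ E₁.w)) x l₂) (by rw [Env.run, c2])
      (by omega) (by omega) (by omega) (by omega) e2 e3 e4 e5 b2 b3
      (hget E₂.J (by omega) l₂ (6 + 3 * l₁.length) (hd ++ encode l₁) ((List.range E₁.size).map E₁.tab)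
        (by simp [hd']) (by simp [hlen, length_encode]) b3
        (by omega)) (out := List.ofFn (out₂ x)) (by simp)
      (fun k hk => by
        simp only [List.length_ofFn] at hk
        rw [List.getElem_ofFn]
        refine b4 _ (fun i hi => ?_) x ⟨k, hk⟩
        rw [c4]; exact htab' i (c3 ▸ hi))
    obtain ⟨t', ht', r⟩ := this
    exact ⟨t', ht'.trans (by gcongr), r⟩

end WordRAM

/-! ### Expander graphs -/

namespace ExpanderCode

open Finset

variable {ι κ G : Type*} [Fintype ι] [Fintype κ] [DecidableEq ι] [DecidableEq κ]

/-- The neighbourhood of `S` in the bipartite multigraph in which the vertex `v` on the left is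
joined to the vertices `f v i` on the right. -/
def nbr {d : ℕ} (f : ι → Fin d → κ) (S : Finset ι) : Finset κ :=
  (S ×ˢ (univ : Finset (Fin d))).image fun e => f e.1 e.2

/-- A left-regular graph of degree `32` in which sets of at most `α |ι|` vertices on the left have
at least `15/16` of the largest conceivable number of neighbours. -/
def IsExpander (α : ℝ) (f : ι → Fin 32 → κ) : Prop :=
  ∀ S : Finset ι, (S.card : ℝ) ≤ α * Fintype.card ι → 30 * S.card ≤ (nbr f S).card

theorem pow_self_le_three_pow_mul_factorial (k : ℕ) : (k : ℝ) ^ k ≤ 3 ^ k * k.factorial := by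
  have h := Real.pow_div_factorial_le_exp (k : ℝ) (by positivity) k
  rw [div_le_iff₀ (by positivity)] at h
  refine h.trans ?_
  gcongr
  calc Real.exp k = Real.exp 1 ^ k := by rw [← Real.exp_nat_mul]; simp
    _ ≤ 3 ^ k := by
      gcongr
      exact Real.exp_one_lt_d9.le.trans (by norm_num)

/-- The number of graphs in which the `s` vertices of a given set have fewer than `30 s` neighbours,
relative to the number of all graphs. -/
theorem choose_mul_pow_le {n m s : ℕ} (hm : 0 < m) (hs : s ≤ n) :
    (m.choose (30 * s) : ℝ) * ((30 * s : ℕ) : ℝ) ^ (32 * s) * (m : ℝ) ^ (32 * (n - s)) ≤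
      (m : ℝ) ^ (32 * n) * (3 ^ 30 * 900 * (s : ℝ) ^ 2 / (m : ℝ) ^ 2) ^ s := by
  have hm' : (0 : ℝ) < m := by exact_mod_cast hm
  have h1 : (m.choose (30 * s) : ℝ) ≤ (m : ℝ) ^ (30 * s) / (30 * s).factorial :=
    Nat.choose_le_pow_div _ _
  have h2 := pow_self_le_three_pow_mul_factorial (30 * s)
  have hf : (0 : ℝ) < (30 * s).factorial := by positivity
  have e1 : ((30 * s : ℕ) : ℝ) ^ (32 * s) =
      ((30 * s : ℕ) : ℝ) ^ (30 * s) * (900 * (s : ℝ) ^ 2) ^ s := by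
    rw [show 32 * s = 30 * s + 2 * s by ring, pow_add]
    congr 1
    rw [pow_mul]
    push_cast
    congr 1; ring
  have e2 : (m : ℝ) ^ (32 * n) = (m : ℝ) ^ (30 * s) * (m : ℝ) ^ (32 * (n - s)) * ((m : ℝ) ^ 2) ^ s := by
    rw [← pow_mul, ← pow_add, ← pow_add]
    congr 1
    omega
  calc _ ≤ (m : ℝ) ^ (30 * s) / (30 * s).factorial * (3 ^ (30 * s) * (30 * s).factorial *
        (900 * (s : ℝ) ^ 2) ^ s) * (m : ℝ) ^ (32 * (n - s)) := by
        rw [e1]; gcongr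
    _ = _ := by
        rw [e2, div_pow, mul_assoc (3 ^ 30 : ℝ), mul_pow (3 ^ 30 : ℝ), ← pow_mul (3 : ℝ)]
        field_simp

/-- The union bound over all sets of `s` vertices: the share of the graphs in which some such set has
fewer than `30 s` neighbours is at most `(1 / 4) ^ s`, so that the sum over all `s ≥ 1` is below `1`. -/
theorem choose_mul_expansion_le {b n m s : ℕ} (hm : 0 < m) (hs : 0 < s) (hnm : n ≤ 2 ^ b * m)
    (hα : (s : ℝ) ≤ 1 / (4 * 3 ^ 31 * 900 * 4 ^ b) * n) :
    (n.choose s : ℝ) * (3 ^ 30 * 900 * (s : ℝ) ^ 2 / (m : ℝ) ^ 2) ^ s ≤ (1 / 4) ^ s := by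
  have hm' : (0 : ℝ) < m := by exact_mod_cast hm
  have hs' : (0 : ℝ) < s := by exact_mod_cast hs
  have h1 : (n.choose s : ℝ) ≤ (n : ℝ) ^ s / s.factorial := Nat.choose_le_pow_div _ _
  have h2 := pow_self_le_three_pow_mul_factorial s
  have h3 : (n : ℝ) ^ s / s.factorial ≤ (3 * n / s) ^ s := by
    rw [div_pow, mul_pow, div_le_div_iff₀ (by positivity) (by positivity)]
    calc (n : ℝ) ^ s * s ^ s ≤ n ^ s * (3 ^ s * s.factorial) := by gcongr
      _ = _ := by ring
  have hnm' : (n : ℝ) ≤ 2 ^ b * m := by exact_mod_cast hnm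
  calc _ ≤ (3 * n / s : ℝ) ^ s * (3 ^ 30 * 900 * (s : ℝ) ^ 2 / (m : ℝ) ^ 2) ^ s := by
        gcongr; exact h1.trans h3
    _ = (3 ^ 31 * 900 * (n * s) / (m : ℝ) ^ 2) ^ s := by
        rw [← mul_pow]; congr 1; field_simp
    _ ≤ (1 / 4) ^ s := by
        refine pow_le_pow_left₀ (by positivity) ?_ s
        rw [div_le_div_iff₀ (by positivity) (by positivity)]
        have h4 : (n : ℝ) * s ≤ 1 / (4 * 3 ^ 31 * 900 * 4 ^ b) * (2 ^ b * m) ^ 2 := by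
          calc (n : ℝ) * s ≤ n * (1 / (4 * 3 ^ 31 * 900 * 4 ^ b) * n) := by gcongr
            _ = 1 / (4 * 3 ^ 31 * 900 * 4 ^ b) * n ^ 2 := by ring
            _ ≤ _ := by gcongr
        have h5 : (1 / (4 * 3 ^ 31 * 900 * 4 ^ b) * (2 ^ b * m) ^ 2 : ℝ) =
            1 / (4 * 3 ^ 31 * 900) * m ^ 2 := by
          rw [mul_pow, ← pow_mul, mul_comm b 2, pow_mul]
          norm_num
          field_simp
        rw [h5] at h4
        linarith

/-- A random graph is an expander. -/
theorem exists_isExpander (b : ℕ) (hcard : Fintype.card ι ≤ 2 ^ b * Fintype.card κ) :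
    ∃ f : ι → Fin 32 → κ, IsExpander (1 / (4 * 3 ^ 31 * 900 * 4 ^ b)) f := by
  set α : ℝ := 1 / (4 * 3 ^ 31 * 900 * 4 ^ b) with hα
  set n := Fintype.card ι with hn
  set m := Fintype.card κ with hm
  rcases Nat.eq_zero_or_pos m with hm0 | hm0
  · have : IsEmpty ι := Fintype.card_eq_zero_iff.1 (by rw [hm0] at hcard; omega)
    exact ⟨fun v => this.elim v, fun S _ => by simp [Finset.eq_empty_of_isEmpty S]⟩
  have hm0' : (0 : ℝ) < m := by exact_mod_cast hm0
  by_contra hcon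
  push Not at hcon
  -- graphs in which the neighbourhood of `S` lies in a set `R` of size `30 |S|`
  set small : Finset (Finset ι) := univ.filter fun S => 0 < S.card ∧ (S.card : ℝ) ≤ α * n
  set W : Finset ι → Finset κ → Finset (ι × Fin 32 → κ) := fun S R =>
    Fintype.piFinset fun e => if e.1 ∈ S then R else univ with hW
  have hWcard : ∀ S R, (W S R).card = R.card ^ (32 * S.card) * m ^ (32 * (n - S.card)) := by
    intro S R
    rw [hW, Fintype.card_piFinset]
    have : ∀ e : ι × Fin 32, (if e.1 ∈ S then R else univ).card = if e.1 ∈ S then R.card else m :=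
      fun e => by split_ifs <;> rfl
    simp_rw [this]
    have h1 : (univ.filter fun e : ι × Fin 32 => e.1 ∈ S) = S ×ˢ univ := by ext; simp
    have h2 : (univ.filter fun e : ι × Fin 32 => ¬ e.1 ∈ S) = Sᶜ ×ˢ univ := by ext; simp
    rw [Finset.prod_ite, prod_const, prod_const, h1, h2, card_product, card_product, card_univ,
      Fintype.card_fin, card_compl, mul_comm S.card, mul_comm (_ - S.card)]
  have hcover : (univ : Finset (ι × Fin 32 → κ)) ⊆
      small.biUnion fun S => (univ.powersetCard (30 * S.card)).biUnion fun R => W S R := by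
    intro F _
    have := hcon fun v i => F (v, i)
    simp only [IsExpander, not_forall, not_le] at this
    obtain ⟨S, hS, hlt⟩ := this
    have hSpos : 0 < S.card := by omega
    have hSm : 30 * S.card ≤ m := by
      have h1 : (S.card : ℝ) ≤ α * (2 ^ b * m) := hS.trans (by
        have : (n : ℝ) ≤ 2 ^ b * m := by exact_mod_cast hcard
        have : 0 ≤ α := by positivity
        gcongr)
      have h2 : α * (2 ^ b * m) ≤ m / 30 := by
        rw [hα, div_mul_eq_mul_div, div_le_div_iff₀ (by positivity) (by norm_num)]
        have : (2 : ℝ) ^ b ≤ 4 ^ b := by gcongr; norm_num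
        have := mul_le_mul_of_nonneg_left this hm0'.le
        have : (0 : ℝ) ≤ m * 4 ^ b := by positivity
        linarith
      have : (30 * S.card : ℝ) ≤ m := by linarith
      exact_mod_cast this
    obtain ⟨R, hR1, -, hR2⟩ := Finset.exists_subsuperset_card_eq (subset_univ
      (nbr (fun v i => F (v, i)) S)) hlt.le (by rwa [card_univ])
    simp only [mem_biUnion, mem_powersetCard]
    refine ⟨S, mem_filter.2 ⟨mem_univ _, hSpos, hS⟩, R, ⟨subset_univ _, hR2⟩, ?_⟩
    rw [hW, Fintype.mem_piFinset]
    intro e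
    split_ifs with he
    · exact hR1 (mem_image.2 ⟨e, by simp [he], rfl⟩)
    · simp
  have hle := Finset.card_le_card hcover
  rw [card_univ, Fintype.card_fun, Fintype.card_prod, Fintype.card_fin, ← hn, ← hm] at hle
  have hreal : (m : ℝ) ^ (n * 32) ≤ ∑ S ∈ small, (m : ℝ) ^ (32 * n) *
      (3 ^ 30 * 900 * (S.card : ℝ) ^ 2 / (m : ℝ) ^ 2) ^ S.card := by
    calc (m : ℝ) ^ (n * 32) ≤ ((∑ S ∈ small, ∑ R ∈ univ.powersetCard (30 * S.card), (W S R).card : ℕ)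
          : ℝ) := by
          rw [← Nat.cast_pow, Nat.cast_le]
          exact hle.trans (card_biUnion_le.trans (Finset.sum_le_sum fun S _ => card_biUnion_le))
      _ ≤ _ := by
          push_cast
          refine Finset.sum_le_sum fun S _ => ?_
          refine le_trans (le_of_eq ?_) (choose_mul_pow_le (n := n) hm0 (Finset.card_le_univ S))
          rw [Finset.sum_congr rfl (g := fun _ => (((30 * S.card : ℕ) : ℝ) ^ (32 * S.card) *
            (m : ℝ) ^ (32 * (n - S.card))))]
          · rw [sum_const, card_powersetCard, card_univ, nsmul_eq_mul, mul_assoc]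
          · intro R hR
            rw [hWcard, (mem_powersetCard.1 hR).2]; push_cast; rfl
  rw [← Finset.mul_sum, mul_comm n 32] at hreal
  have hsum : ∑ S ∈ small, (3 ^ 30 * 900 * (S.card : ℝ) ^ 2 / (m : ℝ) ^ 2) ^ S.card ≤ 1 / 2 := by
    calc _ ≤ ∑ S ∈ (univ : Finset ι).powerset, if 0 < S.card ∧ (S.card : ℝ) ≤ α * n then
          (3 ^ 30 * 900 * (S.card : ℝ) ^ 2 / (m : ℝ) ^ 2) ^ S.card else 0 := by
          rw [Finset.powerset_univ, Finset.sum_filter]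
      _ = ∑ s ∈ range (n + 1), n.choose s • if 0 < s ∧ (s : ℝ) ≤ α * n then
          (3 ^ 30 * 900 * (s : ℝ) ^ 2 / (m : ℝ) ^ 2) ^ s else 0 := by
          rw [Finset.sum_powerset_apply_card (fun s : ℕ => if 0 < s ∧ (s : ℝ) ≤ α * n then
          (3 ^ 30 * 900 * (s : ℝ) ^ 2 / (m : ℝ) ^ 2) ^ s else 0)]
          rfl
      _ ≤ ∑ s ∈ range (n + 1), if s = 0 then (0 : ℝ) else (1 / 4) ^ s := by
          refine Finset.sum_le_sum fun s _ => ?_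
          rcases Nat.eq_zero_or_pos s with rfl | hs
          · simp
          · rw [if_neg hs.ne', nsmul_eq_mul]
            split_ifs with h
            · exact choose_mul_expansion_le hm0 hs hcard h.2
            · rw [mul_zero]; positivity
      _ = ∑ s ∈ range n, (1 / 4 : ℝ) ^ (s + 1) := by
          rw [Finset.sum_range_succ']; simp
      _ ≤ 1 / 2 := by
          simp_rw [pow_succ]
          rw [← Finset.sum_mul, geom_sum_eq (by norm_num)]
          have : (0 : ℝ) ≤ (1 / 4) ^ n := by positivity
          rw [show (1 / 4 - 1 : ℝ) = -(3 / 4) by norm_num]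
          linarith
  have hpos : (0 : ℝ) < (m : ℝ) ^ (32 * n) := by positivity
  nlinarith

/-! ### Decoding by majority -/

section Round

variable [AddCommGroup G] [DecidableEq G]

/-- The check symbols: the sum of `x` over the edges that end in `c`. -/
def checks {d : ℕ} (f : ι → Fin d → κ) (x : ι → G) (c : κ) : G :=
  ∑ e : ι × Fin d with f e.1 e.2 = c, x e.1

open Classical in
/-- The value that is taken more than half of the times, or `0` if there is none. -/
noncomputable def majority {d : ℕ} (e : Fin d → G) : G :=
  if h : ∃ g, d < 2 * (univ.filter fun i => e i = g).card then h.choose else 0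

/-- One round of decoding: every symbol is replaced by the majority of the values that the
check symbols `w` predict for it from the other symbols. -/
noncomputable def round {d : ℕ} (f : ι → Fin d → κ) (w : κ → G) (y : ι → G) (v : ι) : G :=
  majority fun i => w (f v i) - checks f y (f v i) + y v

theorem majority_eq {d : ℕ} {e : Fin d → G} {g : G}
    (h : d < 2 * (univ.filter fun i => e i = g).card) : majority e = g := by
  classical
  have hex : ∃ g, d < 2 * (univ.filter fun i => e i = g).card := ⟨g, h⟩
  rw [majority, dif_pos hex]
  by_contra hne
  have h1 := hex.choose_spec
  have hdisj : Disjoint (univ.filter fun i => e i = hex.choose) (univ.filter fun i => e i = g) := by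
    rw [Finset.disjoint_filter]
    intro i _ h1 h2
    exact hne (h1.symm.trans h2)
  have := Finset.card_le_univ ((univ.filter fun i => e i = hex.choose) ∪
    (univ.filter fun i => e i = g))
  rw [card_union_of_disjoint hdisj, Fintype.card_fin] at this
  omega

omit [Fintype κ] in
/-- If the check symbol on the `i`-th edge of `v` predicts a wrong value for `v`, then this check
symbol is wrong or also involves another wrong symbol. -/
theorem check_ne_or_exists_ne_of_ne {d : ℕ} (f : ι → Fin d → κ) {x y : ι → G} {w : κ → G} {v : ι}
    {i : Fin d} (h : w (f v i) - checks f y (f v i) + y v ≠ x v) :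
    w (f v i) ≠ checks f x (f v i) ∨
      ∃ e : ι × Fin d, e ≠ (v, i) ∧ y e.1 ≠ x e.1 ∧ f e.1 e.2 = f v i := by
  by_contra hcon
  push Not at hcon
  obtain ⟨h1, h2⟩ := hcon
  apply h
  rw [h1]
  have : checks f x (f v i) - checks f y (f v i) = x v - y v := by
    rw [checks, checks, ← Finset.sum_sub_distrib]
    rw [Finset.sum_eq_single (v, i)]
    · intro e he hne
      have := h2 e hne
      by_cases hy : y e.1 = x e.1
      · rw [hy, sub_self]
      · exact absurd (mem_filter.1 he).2 (this hy)
    · intro hni; exact absurd (by simp) hni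
  rw [this]; abel

/-- One round of decoding reduces the number of wrong symbols, up to a small multiple of the
number of wrong check symbols. If there were too many wrong symbols afterwards, then together with
the wrong symbols before they would have too few neighbours, since a symbol that becomes or stays
wrong shares half of its check symbols with other wrong symbols. -/
theorem card_round_ne_le {α : ℝ} {f : ι → Fin 32 → κ} (hf : IsExpander α f) (x y : ι → G) (w : κ → G)
    (h : 3 * (((univ.filter fun v => y v ≠ x v).card : ℝ) +
      (univ.filter fun c => w c ≠ checks f x c).card) ≤ α * Fintype.card ι) :
    8 * (univ.filter fun v => round f w y v ≠ x v).card ≤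
      2 * (univ.filter fun v => y v ≠ x v).card + (univ.filter fun c => w c ≠ checks f x c).card := by
  classical
  set S := univ.filter fun v => y v ≠ x v with hS
  set U := univ.filter fun c => w c ≠ checks f x c with hU
  set S' := univ.filter fun v => round f w y v ≠ x v with hS'
  -- an edge is unclean if its check symbol is wrong or also involves another wrong symbol
  let unclean : ι × Fin 32 → Prop := fun e => f e.1 e.2 ∈ U ∨
    ∃ e' : ι × Fin 32, e' ≠ e ∧ e'.1 ∈ S ∧ f e'.1 e'.2 = f e.1 e.2
  have hwrong : ∀ v ∈ S', 16 ≤ (univ.filter fun i => unclean (v, i)).card := by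
    intro v hv
    by_contra hlt
    have hv' : round f w y v ≠ x v := (mem_filter.1 hv).2
    apply hv'
    apply majority_eq
    have hsub : (univ.filter fun i => ¬ unclean (v, i)) ⊆
        univ.filter fun i => w (f v i) - checks f y (f v i) + y v = x v := by
      intro i hi
      rw [mem_filter] at hi ⊢
      refine ⟨mem_univ _, ?_⟩
      by_contra hne
      apply hi.2
      rcases check_ne_or_exists_ne_of_ne f hne with h1 | ⟨e, h1, h2, h3⟩
      · exact Or.inl (by simp [hU, h1])
      · exact Or.inr ⟨e, h1, by simp [hS, h2], h3⟩
    have h1 := Finset.card_le_card hsub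
    have h2 := Finset.card_filter_add_card_filter_not (s := (univ : Finset (Fin 32)))
      (fun i => unclean (v, i))
    rw [card_univ, Fintype.card_fin] at h2
    omega
  have key : ∀ S'' ⊆ S', ((S ∪ S'').card : ℝ) ≤ α * Fintype.card ι →
      8 * S''.card ≤ 2 * S.card + U.card := by
    intro S'' hsub hsmall
    have hexp := hf _ hsmall
    set A := S'' \ S
    set B := S'' ∩ S
    have hAB : S''.card = A.card + B.card := by
      rw [add_comm]; exact (Finset.card_inter_add_card_sdiff S'' S).symm
    have hSA : (S ∪ S'').card = S.card + A.card := by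
      rw [← Finset.union_sdiff_self_eq_union, Finset.card_union_of_disjoint disjoint_sdiff]
    have hA : ((A ×ˢ (univ : Finset (Fin 32))).filter fun e => ¬ unclean e).card ≤ 16 * A.card := by
      rw [Finset.card_filter, Finset.sum_product]
      calc _ ≤ ∑ v ∈ A, 16 := by
            refine Finset.sum_le_sum fun v hv => ?_
            rw [← Finset.card_filter]
            have h1 := hwrong v (hsub (mem_sdiff.1 hv).1)
            have h2 := Finset.card_filter_add_card_filter_not (s := (univ : Finset (Fin 32)))
              (fun i => unclean (v, i))
            rw [card_univ, Fintype.card_fin] at h2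
            omega
        _ = 16 * A.card := by rw [sum_const, smul_eq_mul, mul_comm]
    have hB : 16 * B.card ≤ ((S ×ˢ (univ : Finset (Fin 32))).filter fun e => unclean e).card := by
      calc 16 * B.card = ∑ v ∈ B, 16 := by rw [sum_const, smul_eq_mul, mul_comm]
        _ ≤ ∑ v ∈ B, (univ.filter fun i => unclean (v, i)).card :=
            Finset.sum_le_sum fun v hv => hwrong v (hsub (mem_inter.1 hv).1)
        _ ≤ ∑ v ∈ S, (univ.filter fun i => unclean (v, i)).card :=
            Finset.sum_le_sum_of_subset inter_subset_right
        _ = _ := by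
            rw [Finset.card_filter, Finset.sum_product]
            exact Finset.sum_congr rfl fun v _ => by rw [Finset.card_filter]
    have hN : nbr f (S ∪ S'') ⊆ U ∪ (nbr f S \ U) ∪
        ((A ×ˢ (univ : Finset (Fin 32))).filter fun e => ¬ unclean e).image
          fun e => f e.1 e.2 := by
      intro c hc
      obtain ⟨e, he, rfl⟩ := mem_image.1 hc
      have he1 := (mem_product.1 he).1
      by_cases hcU : f e.1 e.2 ∈ U
      · simp [hcU]
      by_cases hcS : f e.1 e.2 ∈ nbr f S
      · simp [hcS]
      have heS : e.1 ∉ S := fun h => hcS (mem_image.2 ⟨e, by simp [h], rfl⟩)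
      refine mem_union_right _ (mem_image.2 ⟨e, mem_filter.2 ⟨mem_product.2 ⟨?_, mem_univ _⟩, ?_⟩,
        rfl⟩)
      · exact mem_sdiff.2 ⟨(mem_union.1 he1).resolve_left heS, heS⟩
      · rintro (h1 | ⟨e', -, h1, h2⟩)
        · exact hcU h1
        · exact hcS (h2 ▸ mem_image.2 ⟨e', by simp [h1], rfl⟩)
    have hNS : 2 * (nbr f S \ U).card +
        ((S ×ˢ (univ : Finset (Fin 32))).filter fun e => unclean e).card ≤ 64 * S.card := by
      have h1 : ∑ e ∈ S ×ˢ (univ : Finset (Fin 32)), (if unclean e then 1 else 2) +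
          ((S ×ˢ (univ : Finset (Fin 32))).filter fun e => unclean e).card = 64 * S.card := by
        rw [Finset.card_filter, ← Finset.sum_add_distrib]
        rw [Finset.sum_congr rfl (g := fun _ => 2) (fun e _ => by split_ifs <;> rfl)]
        rw [sum_const, card_product, card_univ, Fintype.card_fin, smul_eq_mul]; ring
      have h2 : 2 * (nbr f S \ U).card ≤
          ∑ e ∈ S ×ˢ (univ : Finset (Fin 32)), (if unclean e then 1 else 2) := by
        calc 2 * (nbr f S \ U).card = ∑ c ∈ nbr f S \ U, 2 := by
              rw [sum_const, smul_eq_mul, mul_comm]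
          _ ≤ ∑ c ∈ nbr f S \ U, ∑ e ∈ S ×ˢ (univ : Finset (Fin 32)) with f e.1 e.2 = c,
                (if unclean e then 1 else 2) := by
              refine Finset.sum_le_sum fun c hc => ?_
              obtain ⟨hc1, hc2⟩ := mem_sdiff.1 hc
              obtain ⟨e, he, rfl⟩ := mem_image.1 hc1
              by_cases hun : unclean e
              · obtain ⟨e', h1, h2, h3⟩ := hun.resolve_left hc2
                have hsub : {e, e'} ⊆ (S ×ˢ (univ : Finset (Fin 32))).filter
                    fun e'' => f e''.1 e''.2 = f e.1 e.2 := by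
                  intro e'' he''
                  rcases mem_insert.1 he'' with rfl | he''
                  · exact mem_filter.2 ⟨he, rfl⟩
                  · rw [mem_singleton.1 he'']
                    exact mem_filter.2 ⟨by simp [h2], h3⟩
                refine le_trans ?_ (Finset.sum_le_sum_of_subset hsub)
                rw [Finset.sum_pair h1.symm]
                split_ifs <;> omega
              · refine le_trans ?_ (Finset.single_le_sum (fun _ _ => Nat.zero_le _)
                  (mem_filter.2 ⟨he, rfl⟩))
                rw [if_neg hun]
          _ ≤ ∑ c, ∑ e ∈ S ×ˢ (univ : Finset (Fin 32)) with f e.1 e.2 = c,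
                (if unclean e then 1 else 2) := Finset.sum_le_sum_of_subset (subset_univ _)
          _ = _ := Finset.sum_fiberwise _ _ _
      omega
    have h1 := (Finset.card_le_card hN).trans (card_union_le _ _)
    have h2 := card_union_le U (nbr f S \ U)
    have h3 := Finset.card_image_le (s := (A ×ˢ (univ : Finset (Fin 32))).filter
      fun e => ¬ unclean e) (f := fun e => f e.1 e.2)
    omega
  by_contra hlt
  push Not at hlt
  rcases Nat.eq_zero_or_pos (S.card + U.card) with h0 | h0
  · -- without errors nothing changes
    have hS0 : S = ∅ := Finset.card_eq_zero.1 (by omega)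
    have hU0 : U = ∅ := Finset.card_eq_zero.1 (by omega)
    have : S'.Nonempty := Finset.card_pos.1 (by omega)
    obtain ⟨v, hv⟩ := this
    have := hwrong v hv
    have hnone : (univ.filter fun i => unclean (v, i)) = ∅ := by
      refine Finset.filter_eq_empty_iff.2 fun i _ => ?_
      rintro (h1 | ⟨e, -, h1, -⟩)
      · rw [hU0] at h1; simp at h1
      · rw [hS0] at h1; simp at h1
    rw [hnone] at this
    simp at this
  · obtain ⟨S'', hsub, hcard⟩ := Finset.exists_subset_card_eq
      (show (2 * S.card + U.card) / 8 + 1 ≤ S'.card by omega)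
    have := key S'' hsub (le_trans ?_ h)
    · omega
    · have h1 := card_union_le S S''
      have : (S ∪ S'').card ≤ 3 * (S.card + U.card) := by omega
      exact_mod_cast this

/-- With correct check symbols, repeated rounds correct all errors. -/
theorem iterate_round_eq {α : ℝ} {f : ι → Fin 32 → κ} (hf : IsExpander α f) (x y : ι → G)
    (h : 3 * ((univ.filter fun v => y v ≠ x v).card : ℝ) ≤ α * Fintype.card ι) {r : ℕ}
    (hr : Fintype.card ι < 4 ^ r) : (round f (checks f x))^[r] y = x := by
  have key : ∀ t, 4 ^ t * (univ.filter fun v => (round f (checks f x))^[t] y v ≠ x v).card ≤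
      (univ.filter fun v => y v ≠ x v).card := by
    intro t
    induction t with
    | zero => rw [pow_zero, one_mul]; rfl
    | succ t ih =>
      have hle : (univ.filter fun v => (round f (checks f x))^[t] y v ≠ x v).card ≤
          (univ.filter fun v => y v ≠ x v).card :=
        le_trans (Nat.le_mul_of_pos_left _ (by positivity)) ih
      have hU : (univ.filter fun c => checks f x c ≠ checks f x c).card = 0 := by simp
      have := card_round_ne_le hf x ((round f (checks f x))^[t] y) (checks f x) (by
        rw [hU]
        have : ((univ.filter fun v => (round f (checks f x))^[t] y v ≠ x v).card : ℝ) ≤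
          (univ.filter fun v => y v ≠ x v).card := by exact_mod_cast hle
        push_cast; linarith)
      rw [hU] at this
      simp only [Function.iterate_succ', Function.comp_apply]
      rw [pow_succ]
      nlinarith [Nat.pow_pos (n := t) (show 0 < 4 by norm_num)]
  have h1 := (key r).trans (Finset.card_le_univ _)
  have h2 : (univ.filter fun v => (round f (checks f x))^[r] y v ≠ x v).card = 0 := by
    by_contra h0
    have : 4 ^ r ≤ 4 ^ r * (univ.filter fun v => (round f (checks f x))^[r] y v ≠ x v).card :=
      Nat.le_mul_of_pos_right _ (Nat.pos_of_ne_zero h0)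
    omega
  ext v
  by_contra hne
  have : v ∈ univ.filter fun v => (round f (checks f x))^[r] y v ≠ x v := by simp [hne]
  rw [Finset.card_eq_zero.1 h2] at this
  simp at this

end Round

end ExpanderCode

/-! ### Linear-time codes from expanders -/

namespace ExpanderCode

open Finset WordRAM

/-- The map `F` between vectors of words modulo `M` can be evaluated by straight-line programs with
at most `s` instructions whenever the word length admits numbers below `B`. -/
def Computable {M : ℕ} {ι κ : Type*} (B s : ℕ) (F : (ι → ZMod M) → κ → ZMod M) : Prop :=
  ∀ ⦃I : Type⦄ (E : Env I) (Φ : Set (I → ℕ)) (σ : I → ℕ → ℕ) (t : ℕ) (X : I → ι → ZMod M),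
    B ≤ 2 ^ E.w → (∀ i, (fun x => (X x i).val) ∈ Φ) → Avail E t Φ σ →
    Avail E (t + s) (Φ ∪ Set.range fun k x => (F (X x) k).val) σ

section Computable

variable {M B s s' : ℕ} {ι κ μ : Type*}

theorem Computable.mono {F : (ι → ZMod M) → κ → ZMod M} (h : Computable B s F) (hs : s ≤ s') :
    Computable B s' F :=
  fun _ E Φ σ t X hB hX hA => (h E Φ σ t X hB hX hA).mono (by omega) subset_rfl

/-- A map is computable if each of its components is the value of a formula. -/
theorem Computable.of_frm [Fintype κ] {F : (ι → ZMod M) → κ → ZMod M} (c : κ → ℕ)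
    (h : ∀ ⦃I : Type⦄ (E : Env I) (Φ : Set (I → ℕ)) (σ : I → ℕ → ℕ) (X : I → ι → ZMod M),
      B ≤ 2 ^ E.w → (∀ i, (fun x => (X x i).val) ∈ Φ) →
      ∀ k, Frm E Φ σ (c k) fun x => (F (X x) k).val) : Computable B (∑ k, c k) F := by
  intro I E Φ σ t X hB hX hA
  refine (hA.family univ (f := fun k x => (F (X x) k).val) fun k _ => h E Φ σ X hB hX k).mono
    le_rfl ?_
  simp

variable [NeZero M]

theorem val_checks [Fintype ι] [DecidableEq κ] {d : ℕ} (f : ι → Fin d → κ) (x : ι → ZMod M)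
    (c : κ) : (checks f x c).val = (∑ e : ι × Fin d with f e.1 e.2 = c, (x e.1).val) % M := by
  rw [← ZMod.val_natCast]
  congr 1
  push_cast
  simp [checks]

theorem computable_checks [Fintype ι] [Fintype κ] [DecidableEq κ] {d : ℕ} (f : ι → Fin d → κ)
    (hB : (d * Fintype.card ι + 100) * M ≤ B) :
    Computable B (d * Fintype.card ι + 3 * Fintype.card κ)
      (checks f : (ι → ZMod M) → κ → ZMod M) := by
  have hM : 0 < M := NeZero.pos M
  have h := Computable.of_frm (B := B) (F := (checks f : (ι → ZMod M) → κ → ZMod M))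
    (fun c => (univ.filter fun e : ι × Fin d => f e.1 e.2 = c).card + 3) (by
      intro I E Φ σ X hB' hX k
      have h1 : Frm E Φ σ (∑ e : ι × Fin d with f e.1 e.2 = k, (0 + 1) + 1) fun x =>
          ∑ e : ι × Fin d with f e.1 e.2 = k, (X x e.1).val := by
        refine Frm.sum _ (fun e _ => .wire (hX e.1)) fun x => lt_of_lt_of_le ?_ hB'
        refine lt_of_lt_of_le ?_ hB
        calc ∑ e : ι × Fin d with f e.1 e.2 = k, (X x e.1).val
            ≤ ∑ e : ι × Fin d, M := (Finset.sum_le_sum_of_subset (Finset.subset_univ _)).trans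
              (Finset.sum_le_sum fun e _ => (ZMod.val_lt _).le)
          _ < (d * Fintype.card ι + 100) * M := by
              simp only [sum_const, card_univ, Fintype.card_prod, Fintype.card_fin, smul_eq_mul]
              nlinarith
      have h2 : Frm E Φ σ 1 fun _ => M := .const <|
        lt_of_lt_of_le (by nlinarith [Nat.zero_le (d * Fintype.card ι * M)]) (hB.trans hB')
      refine ((h1.mod h2).congr fun x => (val_checks f (X x) k).symm).mono ?_
      rw [sum_const]; simp)
  refine h.mono (le_of_eq ?_)
  rw [Finset.sum_add_distrib, ← Finset.card_eq_sum_card_fiberwise (fun _ _ => by simp)]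
  simp [Fintype.card_prod]
  ring

/-- The majority as a quotient of two sums, which turns it into a formula without case distinctions:
only the entries that agree with the majority contribute. If there is no majority, then the quotient
is `0 / 0 = 0`. -/
theorem val_majority {d : ℕ} (e : Fin d → ZMod M) : (majority e).val =
    (∑ i, if d < 2 * (univ.filter fun k => e k = e i).card then (e i).val else 0) /
      ∑ i, if d < 2 * (univ.filter fun k => e k = e i).card then 1 else 0 := by
  classical
  by_cases h : ∃ g, d < 2 * (univ.filter fun k => e k = g).card
  · obtain ⟨g, hg⟩ := h
    rw [majority_eq hg]
    have hiff : ∀ i, d < 2 * (univ.filter fun k => e k = e i).card ↔ e i = g := fun i =>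
      ⟨fun hi => (majority_eq hi).symm.trans (majority_eq hg), fun hi => by rw [hi]; exact hg⟩
    have h1 : ∀ i, (if d < 2 * (univ.filter fun k => e k = e i).card then (e i).val else 0) =
        if e i = g then g.val else 0 := fun i => by
      simp only [hiff]
      split_ifs with h
      · rw [h]
      · rfl
    rw [Finset.sum_congr rfl fun i _ => h1 i]
    simp only [hiff]
    rw [← Finset.sum_filter, ← Finset.sum_filter, sum_const, sum_const, smul_eq_mul, smul_eq_mul,
      mul_one, Nat.mul_div_cancel_left]
    omega
  · rw [majority, dif_neg h]
    push Not at h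
    have : ∀ i, ¬ d < 2 * (univ.filter fun k => e k = e i).card := fun i => by
      have := h (e i); omega
    simp [this]

theorem frm_majority {I : Type*} {E : Env I} {Φ : Set (I → ℕ)} {σ : I → ℕ → ℕ} {d c : ℕ}
    {e : I → Fin d → ZMod M} (he : ∀ i, Frm E Φ σ c fun x => (e x i).val)
    (hB : (2 * d + 2) * (M + 1) ≤ 2 ^ E.w) (hd : 0 < d) :
    Frm E Φ σ (d * ((d * (4 * c + 6) + 9) * 3 + c + 20) * 2 + 3) fun x => (majority (e x)).val := by
  have hM : 0 < M := NeZero.pos M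
  have hpow : 2 * d + 2 < 2 ^ E.w := by nlinarith
  have hMw : M < 2 ^ E.w := by nlinarith
  have hw : 1 ≤ E.w := by
    by_contra h
    have : E.w = 0 := by omega
    rw [this] at hpow; omega
  have hval : ∀ (i) (x), (e x i).val < 2 ^ E.w := fun i x => (ZMod.val_lt _).trans hMw
  have hcount : ∀ i, Frm E Φ σ (d * (4 * c + 6) + 1) fun x =>
      (univ.filter fun k => e x k = e x i).card := by
    intro i
    have h1 : ∀ k ∈ (univ : Finset (Fin d)), Frm E Φ σ (4 * c + 5) fun x =>
        if (e x k).val = (e x i).val then 1 else 0 := fun k _ =>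
      (Frm.eq (he k) (he i) hw (hval k) (hval i)).mono (by omega)
    refine ((Frm.sum univ h1 fun x => ?_).congr fun x => ?_).mono ?_
    · refine lt_of_le_of_lt (Finset.sum_le_sum (g := fun _ => 1) fun k _ => ?_) ?_
      · split_ifs <;> simp
      · simp; omega
    · rw [Finset.card_filter]
      refine Finset.sum_congr rfl fun k _ => ?_
      simp only [(ZMod.val_injective M).eq_iff]
    · simp
  have hle : ∀ i x, (univ.filter fun k => e x k = e x i).card ≤ d := fun i x => by
    simpa using Finset.card_le_univ (univ.filter fun k => e x k = e x i)
  have htest : ∀ i, Frm E Φ σ (d * (4 * c + 6) + 9) fun x =>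
      if d < 2 * (univ.filter fun k => e x k = e x i).card then 1 else 0 := by
    intro i
    have h2 : Frm E Φ σ 1 fun _ => 2 := .const (by omega)
    have hd' : Frm E Φ σ 1 fun _ => d := .const (by omega)
    refine Frm.mono (Frm.lt hd' (h2.mul (hcount i) fun x => ?_) hw) (by omega)
    have := hle i x; omega
  have h0 : Frm E Φ σ 1 fun _ => 0 := .const (by omega)
  have hsel : ∀ i ∈ (univ : Finset (Fin d)), Frm E Φ σ ((d * (4 * c + 6) + 9) * 2 + c + 6) fun x =>
      if d < 2 * (univ.filter fun k => e x k = e x i).card then (e x i).val else 0 := fun i _ => by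
    refine Frm.mono (Frm.ite (htest i) (he i) h0 hw (hval i) fun _ => ?_) (by omega)
    omega
  refine (((Frm.sum univ hsel fun x => ?_).div (Frm.sum univ (fun i _ => htest i)
    fun x => ?_)).congr fun x => ?_).mono ?_
  · refine lt_of_le_of_lt (Finset.sum_le_sum (g := fun _ => M) fun k _ => ?_) ?_
    · split_ifs
      · exact (ZMod.val_lt _).le
      · exact Nat.zero_le _
    · simp; nlinarith
  · refine lt_of_le_of_lt (Finset.sum_le_sum (g := fun _ => 1) fun k _ => ?_) ?_
    · split_ifs <;> simp
    · simp; omega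
  · rw [val_majority]
  · simp only [sum_const, card_univ, Fintype.card_fin, smul_eq_mul]
    generalize d * (4 * c + 6) = p
    nlinarith [Nat.zero_le (d * c), Nat.zero_le (d * p)]

/-- A bound for the number of instructions that replace one symbol in a decoding round. -/
def roundCost : ℕ := 32 * ((32 * (4 * 6 + 6) + 9) * 3 + 6 + 20) * 2 + 3

theorem computable_round [Fintype ι] [Fintype κ] [DecidableEq κ] (f : ι → Fin 32 → κ)
    (hB : (32 * Fintype.card ι + 100) * (M + 1) ≤ B) :
    Computable B (32 * Fintype.card ι + 3 * Fintype.card κ + Fintype.card ι * roundCost)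
      fun u : (κ ⊕ ι) → ZMod M => round f (u ∘ Sum.inl) (u ∘ Sum.inr) := by
  intro I E Φ σ t X hB' hX hA
  have hM : 0 < M := NeZero.pos M
  have hA' := computable_checks (M := M) f (B := B) (by nlinarith) E Φ σ t
    (fun x => X x ∘ Sum.inr) hB' (fun i => hX _) hA
  have hw : (32 * Fintype.card ι + 100) * (M + 1) ≤ 2 ^ E.w := hB.trans hB'
  have hMw : 4 * M < 2 ^ E.w := by nlinarith
  have hest : ∀ v, ∀ i : Fin 32, Frm E (Φ ∪ Set.range fun k x =>
      (checks f (X x ∘ Sum.inr) k).val) σ 6 fun x =>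
      (X x (.inl (f v i)) - checks f (X x ∘ Sum.inr) (f v i) + X x (.inr v)).val := by
    intro v i
    have g1 : Frm E (Φ ∪ Set.range fun k x => (checks f (X x ∘ Sum.inr) k).val) σ 0
      fun x => (X x (.inl (f v i))).val := .wire (Or.inl (hX _))
    have g2 : Frm E (Φ ∪ Set.range fun k x => (checks f (X x ∘ Sum.inr) k).val) σ 0
      fun x => (X x (.inr v)).val := .wire (Or.inl (hX _))
    have g3 : Frm E (Φ ∪ Set.range fun k x => (checks f (X x ∘ Sum.inr) k).val) σ 0
      fun x => (checks f (X x ∘ Sum.inr) (f v i)).val := .wire (Or.inr ⟨f v i, rfl⟩)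
    have gM : Frm E (Φ ∪ Set.range fun k x => (checks f (X x ∘ Sum.inr) k).val) σ 1
      fun _ => M := .const (by omega)
    have b1 : ∀ x, (X x (.inl (f v i))).val < M := fun x => ZMod.val_lt _
    have b2 : ∀ x, (X x (.inr v)).val < M := fun x => ZMod.val_lt _
    have b3 : ∀ x, (checks f (X x ∘ Sum.inr) (f v i)).val < M := fun x => ZMod.val_lt _
    refine (((g1.add (gM.sub g3) fun x => ?_).add g2 fun x => ?_).mod gM).congr fun x => ?_
    · have := b1 x; omega
    · have := b1 x; have := b2 x; omega
    · rw [← ZMod.val_natCast]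
      congr 1
      rw [Nat.cast_add, Nat.cast_add, Nat.cast_sub (b3 x).le]
      simp
      ring
  refine (hA'.family univ (f := fun v x => (round f (X x ∘ Sum.inl) (X x ∘ Sum.inr) v).val)
    (c := fun _ => roundCost) fun v _ => frm_majority (hest v) (by nlinarith) (by norm_num)).mono
    (by simp [add_assoc]) ?_
  rw [Finset.coe_univ, Set.image_univ]
  exact Set.union_subset_union_left _ Set.subset_union_left

/-- Repeated rounds with the same check symbols. -/
theorem computable_iterate_round [Fintype ι] [Fintype κ] [DecidableEq κ] (f : ι → Fin 32 → κ)
    (hB : (32 * Fintype.card ι + 100) * (M + 1) ≤ B) (r : ℕ) :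
    Computable B (r * (32 * Fintype.card ι + 3 * Fintype.card κ + Fintype.card ι * roundCost))
      fun u : (κ ⊕ ι) → ZMod M => (round f (u ∘ Sum.inl))^[r] (u ∘ Sum.inr) := by
  induction r with
  | zero =>
    intro I E Φ σ t X hB' hX hA
    refine hA.mono (by simp) (Set.union_subset subset_rfl ?_)
    rintro _ ⟨k, rfl⟩
    exact hX _
  | succ r ih =>
    intro I E Φ σ t X hB' hX hA
    have h1 := ih E Φ σ t X hB' hX hA
    have h2 := computable_round f hB E _ σ _ (fun x => Sum.elim (X x ∘ Sum.inl)
      ((round f (X x ∘ Sum.inl))^[r] (X x ∘ Sum.inr))) hB' (by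
        rintro (c | v)
        · exact Or.inl (hX _)
        · exact Or.inr ⟨v, rfl⟩) h1
    refine h2.mono (le_of_eq (by ring)) (Set.union_subset_union
      Set.subset_union_left ?_)
    simp only [Function.iterate_succ', Function.comp_apply, Sum.elim_comp_inl, Sum.elim_comp_inr]
    exact subset_rfl

end Computable

open Classical in
/-- The number of positions in which two vectors differ. -/
noncomputable def dist {ι G : Type*} [Fintype ι] (x y : ι → G) : ℕ :=
  (univ.filter fun i => x i ≠ y i).card

theorem dist_eq {ι G : Type*} [Fintype ι] [DecidableEq G] (x y : ι → G) :
    dist x y = (univ.filter fun i => x i ≠ y i).card := by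
  unfold dist; congr

theorem dist_sum {ι κ G : Type*} [Fintype ι] [Fintype κ] (x y : ι ⊕ κ → G) :
    dist x y = dist (x ∘ Sum.inl) (y ∘ Sum.inl) + dist (x ∘ Sum.inr) (y ∘ Sum.inr) := by
  classical
  simp only [dist_eq, Finset.card_filter]
  rw [Fintype.sum_sum_type]; rfl

theorem eq_of_dist_eq_zero {ι G : Type*} [Fintype ι] {x y : ι → G} (h : dist x y = 0) :
    x = y := by
  classical
  rw [dist_eq, Finset.card_eq_zero] at h
  ext i
  by_contra hne
  have : i ∈ univ.filter fun i => x i ≠ y i := by simp [hne]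
  rw [h] at this
  simp at this

/-- The expansion of the graphs in which the number of vertices on the right is `2 ^ (-b)` times the
number of vertices on the left. -/
noncomputable def expansion (b : ℕ) : ℝ := 1 / (4 * 3 ^ 31 * 900 * 4 ^ b)

theorem expansion_pos (b : ℕ) : 0 < expansion b := by unfold expansion; positivity

theorem expansion_le_one (b : ℕ) : expansion b ≤ 1 := by
  unfold expansion
  rw [div_le_one (by positivity)]
  have : (1 : ℝ) ≤ 4 ^ b := one_le_pow₀ (by norm_num)
  nlinarith

/-- Codes of rate `1 / 4`, for message lengths that are powers of two. The message `x` is followed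
by the encoding `z` of its check symbols, of half the length, and by check symbols for `z`. The
latter reduce the number of errors in `z` to what the shorter code tolerates; the decoded check
symbols of `x` then correct all the errors in `x`. -/
theorem exists_code (M B : ℕ) [NeZero M] (i : ℕ) (hB : 400 * 2 ^ i * (M + 1) ≤ B) :
    ∃ (ι : Type) (_ : Fintype ι) (enc : (Fin (2 ^ i) → ZMod M) → ι → ZMod M)
      (dec : (ι → ZMod M) → Fin (2 ^ i) → ZMod M), Fintype.card ι = 4 * 2 ^ i ∧
      (∀ x y, (dist y (enc x) : ℝ) ≤ expansion 1 / 3 * 2 ^ i → dec y = x) ∧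
      Computable B (201 * 2 ^ i) enc ∧
      Computable B ((134 + 4 * roundCost) * 2 ^ i * (i + 1)) dec := by
  classical
  induction i with
  | zero =>
    refine ⟨Fin 4, inferInstance, fun x _ => x 0, fun y _ => y 0, by simp, ?_, ?_, ?_⟩
    · intro x y h
      have h1 := expansion_le_one 1
      have : (dist y (fun _ => x 0) : ℝ) < 1 := by
        refine h.trans_lt ?_; norm_num; linarith
      have h0 : dist y (fun _ : Fin 4 => x 0) = 0 := by
        have : dist y (fun _ : Fin 4 => x 0) < 1 := by exact_mod_cast this
        omega
      have := eq_of_dist_eq_zero h0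
      ext k
      rw [this]
      exact congrArg x (Subsingleton.elim (α := Fin 1) _ _)
    · intro I E Φ σ t X _ hX hA
      refine hA.mono (by omega) (Set.union_subset subset_rfl ?_)
      rintro _ ⟨k, rfl⟩
      exact hX _
    · intro I E Φ σ t X _ hX hA
      refine hA.mono (by omega) (Set.union_subset subset_rfl ?_)
      rintro _ ⟨k, rfl⟩
      exact hX _
  | succ i ih =>
    obtain ⟨ι, hι, enc, dec, hcard, hdec, cenc, cdec⟩ := ih (by rw [pow_succ] at hB; nlinarith)
    obtain ⟨fA, hA⟩ := exists_isExpander (ι := Fin (2 ^ (i + 1))) (κ := Fin (2 ^ i)) 1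
      (by simp [pow_succ, mul_comm])
    obtain ⟨fB, hfB⟩ := exists_isExpander (ι := ι) (κ := Fin (2 ^ (i + 1))) 1
      (by rw [hcard]; simp [pow_succ]; omega)
    have hp : 0 < 2 ^ i := by positivity
    have hp' : 2 ^ (i + 1) = 2 * 2 ^ i := by rw [pow_succ, mul_comm]
    rw [hp'] at hB
    refine ⟨Fin (2 ^ (i + 1)) ⊕ (ι ⊕ Fin (2 ^ (i + 1))), inferInstance,
      fun x => Sum.elim x (Sum.elim (enc (checks fA x)) (checks fB (enc (checks fA x)))),
      fun y => (round fA (dec (round fB (y ∘ Sum.inr ∘ Sum.inr) (y ∘ Sum.inr ∘ Sum.inl))))^[i + 2]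
        (y ∘ Sum.inl), ?_, ?_, ?_, ?_⟩
    · simp only [Fintype.card_sum, hcard, Fintype.card_fin]; omega
    · intro x y h
      rw [dist_sum, dist_sum] at h
      simp only [Sum.elim_comp_inl, Sum.elim_comp_inr] at h
      set z := enc (checks fA x)
      set e1 := dist (y ∘ Sum.inl) x with he1
      set e2 := dist ((y ∘ Sum.inr) ∘ Sum.inl) z with he2
      set e3 := dist ((y ∘ Sum.inr) ∘ Sum.inr) (checks fB z) with he3
      have hα := expansion_pos 1
      push_cast at h
      rw [dist_eq] at he1 he2 he3
      have n1 : (0 : ℝ) ≤ e1 := by positivity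
      have n2 : (0 : ℝ) ≤ e2 := by positivity
      have n3 : (0 : ℝ) ≤ e3 := by positivity
      have h1 := card_round_ne_le hfB z (y ∘ Sum.inr ∘ Sum.inl) (y ∘ Sum.inr ∘ Sum.inr) (by
        rw [hcard]
        change 3 * (((univ.filter fun v => ((y ∘ Sum.inr) ∘ Sum.inl) v ≠ z v).card : ℝ) +
          (univ.filter fun c => ((y ∘ Sum.inr) ∘ Sum.inr) c ≠ checks fB z c).card) ≤
          expansion 1 * _
        rw [← he2, ← he3]
        push_cast
        rw [pow_succ] at h
        nlinarith [mul_pos hα (show (0 : ℝ) < 2 ^ i by positivity)])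
      change 8 * _ ≤ 2 * (univ.filter fun v => ((y ∘ Sum.inr) ∘ Sum.inl) v ≠ z v).card +
          (univ.filter fun c => ((y ∘ Sum.inr) ∘ Sum.inr) c ≠ checks fB z c).card at h1
      rw [← he2, ← he3] at h1
      have h2 : dec (round fB (y ∘ Sum.inr ∘ Sum.inr) (y ∘ Sum.inr ∘ Sum.inl)) = checks fA x := by
        apply hdec
        rw [dist_eq]
        have h1' : (8 : ℝ) * ((univ.filter fun v => round fB (y ∘ Sum.inr ∘ Sum.inr)
          (y ∘ Sum.inr ∘ Sum.inl) v ≠ z v).card : ℝ) ≤ 2 * e2 + e3 := by exact_mod_cast h1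
        rw [pow_succ] at h
        nlinarith [mul_pos hα (show (0 : ℝ) < 2 ^ i by positivity)]
      simp only [h2]
      refine iterate_round_eq hA x _ ?_ ?_
      · rw [← he1]
        rw [Fintype.card_fin]
        push_cast
        change 3 * (e1 : ℝ) ≤ expansion 1 * _
        linarith
      · rw [Fintype.card_fin, show (4 : ℕ) = 2 ^ 2 by norm_num, ← pow_mul]
        exact Nat.pow_lt_pow_right (by norm_num) (by omega)
    · intro I E Φ σ t X hB' hX hAv
      have h1 := computable_checks (M := M) fA (B := B) (by rw [Fintype.card_fin, hp']; nlinarith)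
        E Φ σ t X hB' hX hAv
      have h2 := cenc E _ σ _ (fun x => checks fA (X x)) hB' (fun k => Or.inr ⟨k, rfl⟩) h1
      have h3 := computable_checks (M := M) fB (B := B) (by rw [hcard]; nlinarith)
        E _ σ _ (fun x => enc (checks fA (X x))) hB' (fun k => Or.inr ⟨k, rfl⟩) h2
      refine h3.mono ?_ ?_
      · rw [hcard, Fintype.card_fin, Fintype.card_fin, hp']; omega
      · rintro _ (h | ⟨k | k | k, rfl⟩)
        · exact Or.inl (Or.inl (Or.inl h))
        · exact Or.inl (Or.inl (Or.inl (hX k)))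
        · exact Or.inl (Or.inr ⟨k, rfl⟩)
        · exact Or.inr ⟨k, rfl⟩
    · intro I E Φ σ t X hB' hX hAv
      have h1 := computable_round (M := M) fB (B := B) (by rw [hcard]; nlinarith) E Φ σ t
        (fun x => Sum.elim (X x ∘ Sum.inr ∘ Sum.inr) (X x ∘ Sum.inr ∘ Sum.inl)) hB'
        (by rintro (k | k) <;> exact hX _) hAv
      have h2 := cdec E _ σ _ (fun x => round fB (X x ∘ Sum.inr ∘ Sum.inr)
        (X x ∘ Sum.inr ∘ Sum.inl)) hB' (fun k => Or.inr ⟨k, rfl⟩) h1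
      have h3 := computable_iterate_round (M := M) fA (B := B)
        (by rw [Fintype.card_fin, hp']; nlinarith) (i + 2) E _ σ _ (fun x => Sum.elim
          (dec (round fB (X x ∘ Sum.inr ∘ Sum.inr) (X x ∘ Sum.inr ∘ Sum.inl))) (X x ∘ Sum.inl)) hB'
        (by
          rintro (k | k)
          · exact Or.inr ⟨k, rfl⟩
          · exact Or.inl (Or.inl (hX _))) h2
      refine h3.mono ?_ ?_
      · rw [hcard, Fintype.card_fin, Fintype.card_fin, hp']
        generalize roundCost = R
        generalize 2 ^ i = p
        nlinarith [Nat.zero_le (p * i), Nat.zero_le (p * i * R), Nat.zero_le p,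
          Nat.zero_le (p * R)]
      · exact Set.union_subset_union_left _ (Set.subset_union_left.trans Set.subset_union_left)

/-- Codes of rate `2 ^ b / (2 ^ b + 4)` that tolerate a constant fraction of errors, with encoding
in time `O(N)` and decoding in time `O(N log N)` for the length `N`. -/
theorem exists_code_high_rate (M B : ℕ) [NeZero M] (i b : ℕ)
    (hB : 400 * 2 ^ (i + b) * (M + 1) ≤ B) :
    ∃ (enc : (Fin (2 ^ (i + b)) → ZMod M) → Fin (2 ^ i * (2 ^ b + 4)) → ZMod M)
      (dec : (Fin (2 ^ i * (2 ^ b + 4)) → ZMod M) → Fin (2 ^ (i + b)) → ZMod M),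
      (∀ x y, (dist y (enc x) : ℝ) ≤ expansion (b + 1) / 3 * 2 ^ i → dec y = x) ∧
      Computable B (300 * 2 ^ (i + b)) enc ∧
      Computable B ((300 + 8 * roundCost) * 2 ^ (i + b) * (i + b + 1)) dec := by
  classical
  have hp : 0 < 2 ^ (i + b) := by positivity
  have hle : 2 ^ i ≤ 2 ^ (i + b) := Nat.pow_le_pow_right (by norm_num) (by omega)
  obtain ⟨ι, hι, enc, dec, hcard, hdec, cenc, cdec⟩ := exists_code M B i (by nlinarith)
  obtain ⟨fA, hA⟩ := exists_isExpander (ι := Fin (2 ^ (i + b))) (κ := Fin (2 ^ i)) b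
      (by simp [pow_add, mul_comm])
  have hN : Fintype.card (Fin (2 ^ (i + b)) ⊕ ι) = 2 ^ i * (2 ^ b + 4) := by
    rw [Fintype.card_sum, hcard, Fintype.card_fin, pow_add]; ring
  let e := Fintype.equivFinOfCardEq hN
  refine ⟨fun x k => Sum.elim x (enc (checks fA x)) (e.symm k),
    fun y => (round fA (dec (fun k => y (e (.inr k)))))^[i + b + 1] (fun k => y (e (.inl k))),
    ?_, ?_, ?_⟩
  · intro x y h
    have hd : dist y (fun k => Sum.elim x (enc (checks fA x)) (e.symm k)) =
        dist (fun k => y (e k)) (Sum.elim x (enc (checks fA x))) := by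
      rw [dist_eq, dist_eq, Finset.card_filter, Finset.card_filter]
      exact Fintype.sum_equiv e.symm _ _ fun k => by simp
    rw [hd, dist_sum] at h
    simp only [Sum.elim_comp_inl, Sum.elim_comp_inr] at h
    set e1 := dist ((fun k => y (e k)) ∘ Sum.inl) x with he1
    set e2 := dist ((fun k => y (e k)) ∘ Sum.inr) (enc (checks fA x)) with he2
    push_cast at h
    have n1 : (0 : ℝ) ≤ e1 := by positivity
    have n2 : (0 : ℝ) ≤ e2 := by positivity
    have hmono : expansion (b + 1) ≤ expansion b ∧ expansion (b + 1) ≤ expansion 1 := by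
      have : (1 : ℝ) ≤ 4 ^ b := one_le_pow₀ (by norm_num)
      constructor <;> (unfold expansion; gcongr) <;> norm_num
    have h2 : dec (fun k => y (e (.inr k))) = checks fA x := by
      apply hdec
      change (e2 : ℝ) ≤ _
      have : expansion (b + 1) / 3 * 2 ^ i ≤ expansion 1 / 3 * (2 : ℝ) ^ i := by
        gcongr; exact hmono.2
      linarith
    simp only [h2]
    refine iterate_round_eq hA x _ ?_ ?_
    · rw [dist_eq] at he1
      change 3 * ((univ.filter fun v => ((fun k => y (e k)) ∘ Sum.inl) v ≠ x v).card : ℝ) ≤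
        expansion b * _
      rw [← he1, Fintype.card_fin]
      push_cast
      have h3 : expansion (b + 1) / 3 * 2 ^ i ≤ expansion b / 3 * (2 : ℝ) ^ (i + b) := by
        have := expansion_pos b
        gcongr
        · exact hmono.1
        · norm_num
        · omega
      linarith
    · rw [Fintype.card_fin]
      exact Nat.pow_lt_pow_left (by norm_num : 2 < 4) (by omega) |>.trans_le' (by
        exact Nat.pow_le_pow_right (by norm_num) (by omega))
  · intro I E Φ σ t X hB' hX hAv
    have h1 := computable_checks (M := M) fA (B := B) (by rw [Fintype.card_fin]; nlinarith)
      E Φ σ t X hB' hX hAv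
    have h2 := cenc E _ σ _ (fun x => checks fA (X x)) hB' (fun k => Or.inr ⟨k, rfl⟩) h1
    refine h2.mono ?_ ?_
    · rw [Fintype.card_fin, Fintype.card_fin]; omega
    · rintro _ (h | ⟨k, rfl⟩)
      · exact Or.inl (Or.inl h)
      · rcases hk : e.symm k with k' | k'
        · simp only [Sum.elim_inl, hk]; exact Or.inl (Or.inl (hX _))
        · simp only [Sum.elim_inr, hk]; exact Or.inr ⟨k', rfl⟩
  · intro I E Φ σ t X hB' hX hAv
    have h2 := cdec E Φ σ t (fun x k => X x (e (.inr k))) hB' (fun k => hX _) hAv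
    have h3 := computable_iterate_round (M := M) fA (B := B)
      (by rw [Fintype.card_fin]; nlinarith) (i + b + 1) E _ σ _ (fun x => Sum.elim
        (dec (fun k => X x (e (.inr k)))) (fun k => X x (e (.inl k)))) hB'
      (by
        rintro (k | k)
        · exact Or.inr ⟨k, rfl⟩
        · exact Or.inl (hX _)) h2
    refine h3.mono ?_ ?_
    · rw [Fintype.card_fin, Fintype.card_fin]
      generalize roundCost = R
      have h1 : (134 + 4 * R) * 2 ^ i * (i + 1) ≤ (134 + 4 * R) * 2 ^ (i + b) * (i + b + 1) := by
        gcongr; omega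
      have h4 : 32 * 2 ^ (i + b) + 3 * 2 ^ i + 2 ^ (i + b) * R ≤ (35 + R) * 2 ^ (i + b) := by
        linarith
      have h5 := Nat.mul_le_mul_left (i + b + 1) h4
      nlinarith [Nat.zero_le (2 ^ (i + b) * (i + b + 1)), Nat.zero_le (R * (2 ^ (i + b) * (i + b + 1)))]
    · exact Set.union_subset_union_left _ Set.subset_union_left

end ExpanderCode

/-! ### Codes for short blocks -/

namespace TraceCode

open Finset

/-- A greedy choice of pairwise unrelated elements. -/
theorem exists_pairwise_not {X : Type*} [Fintype X] [DecidableEq X] (r : X → X → Prop)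
    [DecidableRel r] (hr : ∀ x y, r x y → r y x) (B M : ℕ) (hB : 0 < B)
    (hcard : ∀ x, (univ.filter fun y => r x y).card ≤ B) (h : M * B ≤ Fintype.card X) :
    ∃ c : Fin M → X, ∀ i j, i ≠ j → ¬ r (c i) (c j) := by
  induction M with
  | zero => exact ⟨fun i => i.elim0, fun i => i.elim0⟩
  | succ M ih =>
    obtain ⟨c, hc⟩ := ih (by nlinarith)
    have hlt : ((univ : Finset (Fin M)).biUnion fun i => univ.filter fun y => r (c i) y).card <
        (univ : Finset X).card := by
      refine lt_of_le_of_lt card_biUnion_le ?_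
      refine lt_of_le_of_lt (Finset.sum_le_sum fun i _ => hcard (c i)) ?_
      rw [sum_const, card_univ, Fintype.card_fin, smul_eq_mul, card_univ]
      nlinarith
    obtain ⟨x, -, hx⟩ := Finset.exists_mem_notMem_of_card_lt_card hlt
    simp only [mem_biUnion, mem_filter, mem_univ, true_and, not_exists] at hx
    refine ⟨Fin.snoc c x, fun i j => ?_⟩
    refine Fin.lastCases ?_ (fun i => ?_) i <;> refine Fin.lastCases ?_ (fun j => ?_) j
    · intro h; exact absurd rfl h
    · intro _; simp only [Fin.snoc_last, Fin.snoc_castSucc]; exact fun h => hx j (hr _ _ h)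
    · intro _; simp only [Fin.snoc_last, Fin.snoc_castSucc]; exact hx i
    · intro h
      simp only [Fin.snoc_castSucc]
      exact hc i j fun hij => h (by rw [hij])

/-- The number of positions that are deleted in all `T` traces. -/
def erased {T L : ℕ} (D : Fin T → Fin L → Bool) : ℕ :=
  (univ.filter fun l => ∀ t, D t l = true).card

theorem eq_of_trace_eq {L H : ℕ} {x y : Fin L → Fin H} {D : Fin L → Bool}
    (h : trace x D = trace y D) {l : Fin L} (hl : D l = false) : x l = y l := by
  unfold trace at h
  exact List.map_inj_left.1 h l (by simp [hl])

/-- A string is determined by its traces, if the deletion patterns are given, up to the positions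
that are deleted in all traces. -/
theorem card_trace_eq_le {T L H e : ℕ} (hH : 0 < H) (D : Fin T → Fin L → Bool) (hD : erased D ≤ e)
    (z : Fin T → List (Fin H)) :
    (univ.filter fun y : Fin L → Fin H => ∀ t, trace y (D t) = z t).card ≤ H ^ e := by
  classical
  refine le_trans ?_ (Nat.pow_le_pow_right hH hD)
  let R := {l : Fin L // ∀ t, D t l = true}
  have hR : Fintype.card (R → Fin H) = H ^ erased D := by
    rw [Fintype.card_fun, Fintype.card_fin, erased, Fintype.card_subtype]
  rw [← hR, ← card_univ]
  refine Finset.card_le_card_of_injOn (fun y (l : R) => y l) (fun _ _ => by simp) ?_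
  intro x hx y hy hxy
  simp only [coe_filter, mem_univ, true_and, Set.mem_ofPred_eq] at hx hy
  ext l
  by_cases hl : ∀ t, D t l = true
  · exact congrArg Fin.val (congrFun hxy ⟨l, hl⟩)
  · push Not at hl
    obtain ⟨t, ht⟩ := hl
    rw [eq_of_trace_eq ((hx t).trans (hy t).symm) (by simpa using ht)]

/-- A code that can be decoded whenever at most `e` positions are deleted in all the `T` traces. Two
strings are confusable if they have a tuple of traces in common under such deletions. The two tuples
of deletion patterns can be chosen in `4 ^ (L * T)` ways, and when they are given, a string confusable
with a given one is determined up to `e` symbols; so a greedy choice finds many strings no two of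
which are confusable. -/
theorem exists_block_code {T L H e M : ℕ} (hM : 0 < M) (hH : 0 < H)
    (h : M * (4 ^ (L * T) * H ^ e) ≤ H ^ L) :
    ∃ (code : Fin M → Fin L → Fin H) (dec : (Fin T → List (Fin H)) → Fin M),
      ∀ y D, erased D ≤ e → dec (fun t => trace (code y) (D t)) = y := by
  classical
  let r : (Fin L → Fin H) → (Fin L → Fin H) → Prop := fun x y =>
    ∃ D D' : Fin T → Fin L → Bool, erased D ≤ e ∧ erased D' ≤ e ∧
      ∀ t, trace y (D' t) = trace x (D t)
  have hr : ∀ x y, r x y → r y x := fun x y ⟨D, D', h1, h2, h3⟩ =>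
    ⟨D', D, h2, h1, fun t => (h3 t).symm⟩
  have hcard : ∀ x, (univ.filter fun y => r x y).card ≤ 4 ^ (L * T) * H ^ e := by
    intro x
    have hsub : (univ.filter fun y => r x y) ⊆
        (univ : Finset ((Fin T → Fin L → Bool) × (Fin T → Fin L → Bool))).biUnion fun p =>
          if erased p.2 ≤ e then univ.filter fun y => ∀ t, trace y (p.2 t) = trace x (p.1 t)
          else ∅ := by
      intro y hy
      obtain ⟨D, D', h1, h2, h3⟩ := (mem_filter.1 hy).2
      refine mem_biUnion.2 ⟨(D, D'), mem_univ _, ?_⟩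
      rw [if_pos h2]
      exact mem_filter.2 ⟨mem_univ _, h3⟩
    refine (Finset.card_le_card hsub).trans (card_biUnion_le.trans ?_)
    calc _ ≤ ∑ p : (Fin T → Fin L → Bool) × (Fin T → Fin L → Bool), H ^ e := by
          refine Finset.sum_le_sum fun p _ => ?_
          split_ifs with hp
          · exact card_trace_eq_le hH p.2 hp _
          · simp
      _ = _ := by
          rw [sum_const, card_univ, smul_eq_mul, Fintype.card_prod, Fintype.card_fun,
            Fintype.card_fun, Fintype.card_bool, Fintype.card_fin, Fintype.card_fin, ← pow_mul,
            ← mul_pow]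
          norm_num
  obtain ⟨code, hcode⟩ := exists_pairwise_not r hr (4 ^ (L * T) * H ^ e) M (by positivity) hcard
    (by simpa using h)
  refine ⟨code, fun z => if hz : ∃ y, ∃ D, erased D ≤ e ∧ z = fun t => trace (code y) (D t)
    then hz.choose else ⟨0, hM⟩, fun y D hD => ?_⟩
  have hex : ∃ y', ∃ D', erased D' ≤ e ∧ (fun t => trace (code y) (D t)) =
      fun t => trace (code y') (D' t) := ⟨y, D, hD, rfl⟩
  beta_reduce
  rw [dif_pos hex]
  by_contra hne
  obtain ⟨D', h1, h2⟩ := hex.choose_spec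
  exact hcode _ _ hne ⟨D', D, h1, hD, fun t => congrFun h2 t⟩

/-! ### Tail bounds -/

/-- The exponential Markov inequality for the number of the independent trials in which the event
`A` occurs. -/
theorem sum_prod_le {ι X : Type*} [Fintype ι] [DecidableEq ι] [Fintype X] (μ : X → ℝ)
    (hμ : ∀ x, 0 ≤ μ x) (hsum : ∑ x, μ x = 1) (A : X → Prop) [DecidablePred A] {p y : ℝ}
    (hp : ∑ x, (if A x then μ x else 0) ≤ p) (hy : 1 ≤ y) (s : ℕ) :
    ∑ f : ι → X, (if s ≤ (univ.filter fun i => A (f i)).card then ∏ i, μ (f i) else 0) ≤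
      (1 + p * (y - 1)) ^ Fintype.card ι / y ^ s := by
  have hy0 : 0 < y := by linarith
  have h1 : ∀ f : ι → X, (if s ≤ (univ.filter fun i => A (f i)).card then ∏ i, μ (f i) else 0) ≤
      (∏ i, (if A (f i) then y else 1) * μ (f i)) / y ^ s := by
    intro f
    have hprod : 0 ≤ ∏ i, μ (f i) := Finset.prod_nonneg fun i _ => hμ _
    rw [Finset.prod_mul_distrib, Finset.prod_ite, prod_const, prod_const, one_pow, mul_one]
    split_ifs with hs
    · rw [le_div_iff₀ (by positivity), mul_comm]
      gcongr
    · positivity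
  refine (Finset.sum_le_sum fun f _ => h1 f).trans ?_
  rw [← Finset.sum_div]
  gcongr
  have h2 := Finset.prod_univ_sum (fun _ : ι => (univ : Finset X))
    fun _ x => (if A x then y else 1) * μ x
  rw [Fintype.piFinset_univ] at h2
  rw [← h2, prod_const, card_univ]
  have h3 : ∑ x, (if A x then y else 1) * μ x = 1 + (∑ x, if A x then μ x else 0) * (y - 1) := by
    have : ∀ x, (if A x then y else 1) * μ x = μ x + (if A x then μ x else 0) * (y - 1) :=
      fun x => by split_ifs <;> ring
    rw [Finset.sum_congr rfl fun x _ => this x, Finset.sum_add_distrib, hsum, Finset.sum_mul]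
  rw [h3]
  have h4 : 0 ≤ ∑ x, if A x then μ x else 0 := Finset.sum_nonneg fun x _ => by
    split_ifs
    · exact hμ x
    · exact le_rfl
  have : 0 ≤ y - 1 := by linarith
  gcongr

/-- The number of occurrences of an event of probability `p` exceeds `τ L`, for a constant `τ > p`,
only with exponentially small probability. -/
theorem exists_tail_rate {p τ : ℝ} (hp : 0 ≤ p) (hτ : p < τ) :
    ∃ y ρ : ℝ, 1 ≤ y ∧ 0 < ρ ∧ ρ < 1 ∧ ∀ L s : ℕ, τ * L ≤ s →
      (1 + p * (y - 1)) ^ L / y ^ s ≤ ρ ^ L := by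
  set y : ℝ := 1 + (τ - p) / (2 * (p + 1)) with hy
  have hy1 : 1 < y := by
    have : 0 < (τ - p) / (2 * (p + 1)) := div_pos (by linarith) (by linarith)
    linarith
  have hy0 : 0 < y := by linarith
  have hpy : p * y < τ := by
    have : p * ((τ - p) / (2 * (p + 1))) ≤ (τ - p) / 2 := by
      rw [mul_div_assoc', div_le_div_iff₀ (by linarith) (by norm_num)]
      nlinarith
    rw [hy]; nlinarith
  have hlog : 1 - y⁻¹ ≤ Real.log y := Real.one_sub_inv_le_log_of_pos hy0
  have hlog0 : 0 < Real.log y := Real.log_pos hy1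
  refine ⟨y, Real.exp (p * (y - 1) - τ * Real.log y), hy1.le, Real.exp_pos _, ?_, fun L s hs => ?_⟩
  · rw [Real.exp_lt_one_iff, sub_neg]
    have h1 : p * (y - 1) < τ * (1 - y⁻¹) := by
      have : 1 - y⁻¹ = (y - 1) / y := by field_simp
      rw [this, mul_div_assoc', lt_div_iff₀ hy0]
      nlinarith
    have : τ * (1 - y⁻¹) ≤ τ * Real.log y := by
      have : 0 ≤ τ := by linarith
      gcongr
    linarith
  · rw [div_le_iff₀ (by positivity), ← Real.exp_nat_mul]
    have h1 : (1 + p * (y - 1)) ^ L ≤ Real.exp (L * (p * (y - 1))) := by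
      rw [Real.exp_nat_mul]
      have : 0 ≤ p * (y - 1) := mul_nonneg hp (by linarith)
      gcongr
      linarith [Real.add_one_le_exp (p * (y - 1))]
    have h2 : y ^ s = Real.exp (s * Real.log y) := by
      rw [Real.exp_nat_mul, Real.exp_log hy0]
    rw [h2, ← Real.exp_add]
    refine h1.trans (Real.exp_le_exp.2 ?_)
    nlinarith

/-! ### The probability of bad blocks -/

section Prob

variable {q : ℝ}

/-- The probability of a Boolean value that is `true` with probability `q`. -/
noncomputable def bern (q : ℝ) (b : Bool) : ℝ := if b then q else 1 - q

theorem bern_nonneg (hq : q ∈ Set.Ioo (0 : ℝ) 1) (b : Bool) : 0 ≤ bern q b := by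
  obtain ⟨h0, h1⟩ := hq
  unfold bern; split_ifs <;> linarith

theorem sum_bern (q : ℝ) : ∑ b, bern q b = 1 := by simp [bern]

theorem sum_prod_bern (q : ℝ) (ι : Type*) [Fintype ι] [DecidableEq ι] :
    ∑ d : ι → Bool, ∏ i, bern q (d i) = 1 := by
  have h := Finset.prod_univ_sum (fun _ : ι => (univ : Finset Bool)) fun _ b => bern q b
  rw [Fintype.piFinset_univ] at h
  rw [← h]
  simp [bern]

/-- The probability of the deletion patterns of `T` traces. -/
noncomputable def patternsProb {T n : ℕ} (q : ℝ) (D : Fin T → Fin n → Bool) : ℝ :=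
  ∏ t, patternProb q (D t)

theorem patternsProb_eq {T n : ℕ} (D : Fin T → Fin n → Bool) :
    patternsProb q D = ∏ i, ∏ t, bern q (D t i) := by
  unfold patternsProb patternProb bern
  rw [Finset.prod_comm]

theorem patternsProb_nonneg {T n : ℕ} (hq : q ∈ Set.Ioo (0 : ℝ) 1) (D : Fin T → Fin n → Bool) :
    0 ≤ patternsProb q D := by
  rw [patternsProb_eq]
  exact Finset.prod_nonneg fun i _ => Finset.prod_nonneg fun t _ => bern_nonneg hq _

theorem sum_patternsProb (q : ℝ) (T n : ℕ) : ∑ D : Fin T → Fin n → Bool, patternsProb q D = 1 := by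
  rw [← sum_prod_bern q (Fin n × Fin T)]
  refine Fintype.sum_equiv ((Equiv.piComm _).trans (Equiv.curry _ _ _).symm) _ _ fun D => ?_
  rw [patternsProb_eq, Fintype.prod_prod_type]
  rfl

/-- A tail bound for the number of positions at which the deletions in the `T` traces satisfy a
condition `A` of probability at most `p`. -/
theorem sum_patternsProb_le {T L : ℕ} (hq : q ∈ Set.Ioo (0 : ℝ) 1) (A : (Fin T → Bool) → Prop)
    [DecidablePred A] {p y : ℝ} (hp : ∑ d : Fin T → Bool, (if A d then ∏ t, bern q (d t) else 0) ≤ p) (hy : 1 ≤ y)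
    (s : ℕ) :
    ∑ D : Fin T → Fin L → Bool, (if s ≤ (univ.filter fun l => A fun t => D t l).card
      then patternsProb q D else 0) ≤ (1 + p * (y - 1)) ^ L / y ^ s := by
  have h := sum_prod_le (ι := Fin L) (fun d : Fin T → Bool => ∏ t, bern q (d t))
    (fun d => Finset.prod_nonneg fun t _ => bern_nonneg hq _) (sum_prod_bern q _) A hp hy s
  rw [Fintype.card_fin] at h
  refine le_trans (le_of_eq ?_) h
  refine Fintype.sum_equiv (Equiv.piComm _) _ _ fun D => ?_
  rw [patternsProb_eq]
  rfl

/-- A block is bad if more than `e` positions are deleted in all the traces, or more than `e'`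
positions in one of them. -/
def Bad {T L : ℕ} (e e' : ℕ) (D : Fin T → Fin L → Bool) : Prop :=
  e < erased D ∨ ∃ t, e' < (univ.filter fun l => D t l = true).card

instance {T L : ℕ} (e e' : ℕ) : DecidablePred (Bad (T := T) (L := L) e e') := fun D => by
  unfold Bad; infer_instance

/-- A block of length `L` is bad with a probability that is exponentially small in `L`, if the
thresholds `τ L` and `τ' L` exceed the expected numbers of deletions. -/
theorem exists_prob_bad_le (hq : q ∈ Set.Ioo (0 : ℝ) 1) {T : ℕ} {τ τ' : ℝ} (hτ : q ^ T < τ)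
    (hτ' : q < τ') : ∃ ρ : ℝ, 0 < ρ ∧ ρ < 1 ∧ ∀ L : ℕ,
      ∑ D : Fin T → Fin L → Bool, (if Bad ⌊τ * L⌋₊ ⌊τ' * L⌋₊ D then patternsProb q D else 0) ≤
        (T + 1) * ρ ^ L := by
  obtain ⟨h0, h1⟩ := hq
  obtain ⟨y, ρ, hy, hρ0, hρ1, hb⟩ := exists_tail_rate (by positivity) hτ
  obtain ⟨y', ρ', hy', hρ0', hρ1', hb'⟩ := exists_tail_rate h0.le hτ'
  refine ⟨max ρ ρ', lt_max_of_lt_left hρ0, max_lt hρ1 hρ1', fun L => ?_⟩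
  have hall : ∑ d : Fin T → Bool, (if ∀ t, d t = true then ∏ t, bern q (d t) else 0) ≤ q ^ T := by
    rw [Finset.sum_eq_single (fun _ => true)]
    · simp [bern]
    · intro d _ hd
      rw [if_neg]
      exact fun h => hd (funext h)
    · simp
  have hone : ∀ t₀, ∑ d : Fin T → Bool, (if d t₀ = true then ∏ t, bern q (d t) else 0) ≤ q := by
    intro t₀
    have h := Finset.prod_univ_sum (fun _ : Fin T => (univ : Finset Bool))
      fun t b => if t = t₀ then (if b = true then bern q b else 0) else bern q b
    rw [Fintype.piFinset_univ] at h
    have h2 : ∀ d : Fin T → Bool, (if d t₀ = true then ∏ t, bern q (d t) else 0) =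
        ∏ t, if t = t₀ then (if d t = true then bern q (d t) else 0) else bern q (d t) := by
      intro d
      split_ifs with hd
      · refine Finset.prod_congr rfl fun t _ => ?_
        split_ifs with ht h'
        · rfl
        · rw [ht] at h'; exact absurd hd h'
        · rfl
      · exact (Finset.prod_eq_zero (mem_univ t₀) (by simp [hd])).symm
    rw [Finset.sum_congr rfl fun d _ => h2 d, ← h]
    rw [Finset.prod_eq_single t₀]
    · simp [bern]
    · intro t _ ht
      simp only [if_neg ht]
      exact sum_bern q
    · simp
  have hfloor : ∀ x : ℝ, x ≤ (⌊x⌋₊ + 1 : ℕ) := fun x => by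
    push_cast; exact (Nat.lt_floor_add_one x).le
  have b1 := (sum_patternsProb_le (L := L) ⟨h0, h1⟩ (fun d => ∀ t, d t = true) hall hy
    (⌊τ * L⌋₊ + 1)).trans (hb L _ (hfloor _))
  have b2 := fun t₀ => (sum_patternsProb_le (L := L) ⟨h0, h1⟩ (fun d => d t₀ = true) (hone t₀) hy'
    (⌊τ' * L⌋₊ + 1)).trans (hb' L _ (hfloor _))
  calc _ ≤ ∑ D : Fin T → Fin L → Bool,
        ((if ⌊τ * L⌋₊ + 1 ≤ (univ.filter fun l => ∀ t, D t l = true).card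
          then patternsProb q D else 0) +
        ∑ t₀, if ⌊τ' * L⌋₊ + 1 ≤ (univ.filter fun l => D t₀ l = true).card
          then patternsProb q D else 0) := by
        refine Finset.sum_le_sum fun D _ => ?_
        have hP := patternsProb_nonneg (q := q) ⟨h0, h1⟩ D
        have hnn : ∀ t₀ ∈ (univ : Finset (Fin T)), (0 : ℝ) ≤
            if ⌊τ' * L⌋₊ + 1 ≤ (univ.filter fun l => D t₀ l = true).card
            then patternsProb q D else 0 := fun t₀ _ => by split_ifs <;> simp [hP]
        split_ifs with hbad hgood hgood
        · have := Finset.sum_nonneg hnn; linarith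
        · rcases hbad with hbad | ⟨t, ht⟩
          · exact absurd hbad hgood
          · have := Finset.single_le_sum hnn (mem_univ t)
            rw [if_pos (show ⌊τ' * L⌋₊ + 1 ≤ _ from ht)] at this
            linarith
        · have := Finset.sum_nonneg hnn; linarith
        · have := Finset.sum_nonneg hnn; linarith
    _ ≤ ρ ^ L + ∑ t₀ : Fin T, ρ' ^ L := by
        rw [Finset.sum_add_distrib, Finset.sum_comm]
        exact add_le_add b1 (Finset.sum_le_sum fun t₀ _ => b2 t₀)
    _ ≤ (T + 1) * max ρ ρ' ^ L := by
        rw [sum_const, card_univ, Fintype.card_fin, nsmul_eq_mul]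
        have h3 : ρ ^ L ≤ max ρ ρ' ^ L := by gcongr; exact le_max_left _ _
        have h4 : ρ' ^ L ≤ max ρ ρ' ^ L := by gcongr; exact le_max_right _ _
        nlinarith [mul_le_mul_of_nonneg_left h4 (Nat.cast_nonneg (α := ℝ) T)]

/-- The part of the deletion patterns that concerns the `j`-th of `N` blocks of length `L`. -/
def blockPattern {T N L : ℕ} (D : Fin T → Fin (N * L) → Bool) (j : Fin N) : Fin T → Fin L → Bool :=
  fun t l => D t (finProdFinEquiv (j, l))

/-- A tail bound for the number of blocks whose deletion patterns satisfy a condition `A` of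
probability at most `p`; the blocks are independent. -/
theorem sum_bad_blocks_le {T N L : ℕ} (hq : q ∈ Set.Ioo (0 : ℝ) 1)
    (A : (Fin T → Fin L → Bool) → Prop) [DecidablePred A] {p y : ℝ}
    (hp : ∑ D : Fin T → Fin L → Bool, (if A D then patternsProb q D else 0) ≤ p) (hy : 1 ≤ y)
    (s : ℕ) :
    ∑ D : Fin T → Fin (N * L) → Bool, (if s ≤ (univ.filter fun j => A (blockPattern D j)).card
      then patternsProb q D else 0) ≤ (1 + p * (y - 1)) ^ N / y ^ s := by
  have h := sum_prod_le (ι := Fin N) (fun D : Fin T → Fin L → Bool => patternsProb q D)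
    (fun D => patternsProb_nonneg hq D) (sum_patternsProb q T L) A hp hy s
  rw [Fintype.card_fin] at h
  refine le_trans (le_of_eq ?_) h
  let φ : (Fin T → Fin (N * L) → Bool) ≃ (Fin N → Fin T → Fin L → Bool) :=
    { toFun := fun D j => blockPattern D j
      invFun := fun F t i => F (finProdFinEquiv.symm i).1 t (finProdFinEquiv.symm i).2
      left_inv := fun D => by
        funext t i; exact congrArg (D t) (finProdFinEquiv.apply_symm_apply i)
      right_inv := fun F => by ext j t l; simp [blockPattern] }
  refine Fintype.sum_equiv φ _ _ fun D => ?_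
  have : patternsProb q D = ∏ j, patternsProb q (blockPattern D j) := by
    simp_rw [patternsProb_eq]
    rw [← Fintype.prod_equiv finProdFinEquiv (fun p : Fin N × Fin L =>
      ∏ t, bern q (D t (finProdFinEquiv p))) _ fun _ => rfl, Fintype.prod_prod_type]
    rfl
  rw [this]
  rfl

end Prob

end TraceCode

/-! ### Recovering the frames from a trace -/

namespace TraceCode

open Finset

section Scan

variable {α : Type*} (par : α → ℕ) (idx pk : List α → ℕ)

/-- The state of a scan over a trace: the parity of the current run of symbols, the current run,
and the table of the runs stored so far. -/
structure Scan (α : Type*) where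
  prev : ℕ
  pend : List α
  row : ℕ → ℕ

/-- The initial state of a scan. -/
def Scan.start : Scan α := ⟨0, [], fun _ => 0⟩

/-- The table after the current run has been stored under the index that it announces. -/
def Scan.flush (s : Scan α) : ℕ → ℕ := Function.update s.row (idx s.pend) (pk s.pend)

/-- A symbol of the same parity extends the current run, and a symbol of the other parity starts a
new run. -/
def Scan.step (s : Scan α) (a : α) : Scan α :=
  if par a = s.prev then ⟨s.prev, s.pend ++ [a], s.row⟩ else ⟨par a, [a], s.flush idx pk⟩

/-- The table after a scan over the whole string. -/
def scanRows (z : List α) : ℕ → ℕ :=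
  (z.foldl (Scan.step par idx pk) Scan.start).flush idx pk

variable {par idx pk}

theorem foldl_step_of_eq {p : ℕ} {w : List α} (hw : ∀ a ∈ w, par a = p) {s : Scan α}
    (hs : s.prev = p) : w.foldl (Scan.step par idx pk) s = ⟨p, s.pend ++ w, s.row⟩ := by
  induction w generalizing s with
  | nil => rw [← hs]; simp
  | cons a w ih =>
    have ha : par a = s.prev := (hw a (by simp)).trans hs.symm
    rw [List.foldl_cons, Scan.step, if_pos ha,
      ih (fun b hb => hw b (by simp [hb])) (s := ⟨s.prev, s.pend ++ [a], s.row⟩) hs]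
    simp

theorem foldl_step_of_ne {p : ℕ} {w : List α} (hw : ∀ a ∈ w, par a = p) (hne : w ≠ [])
    {s : Scan α} (hs : s.prev ≠ p) :
    w.foldl (Scan.step par idx pk) s = ⟨p, w, s.flush idx pk⟩ := by
  obtain ⟨a, w, rfl⟩ := List.exists_cons_of_ne_nil hne
  have ha : par a = p := hw a (by simp)
  rw [List.foldl_cons, Scan.step, if_neg (by rw [ha]; exact Ne.symm hs),
    foldl_step_of_eq (fun b hb => hw b (by simp [hb])) (s := ⟨par a, [a], s.flush idx pk⟩) ha]
  simp

/-- The number of indices below `f` under which the wrong value is stored. -/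
def wrongRows (v : ℕ → ℕ) (row : ℕ → ℕ) (f : ℕ) : ℕ := ((range f).filter fun g => row g ≠ v g).card

theorem wrongRows_succ_le (v row : ℕ → ℕ) (f : ℕ) :
    wrongRows v row (f + 1) ≤ wrongRows v row f + 1 := by
  unfold wrongRows
  rw [Finset.range_add_one, Finset.filter_insert]
  split_ifs
  · exact Finset.card_insert_le _ _
  · omega

theorem wrongRows_succ_of_eq {v row : ℕ → ℕ} {f : ℕ} (h : row f = v f) :
    wrongRows v row (f + 1) = wrongRows v row f := by
  unfold wrongRows
  rw [Finset.range_add_one, Finset.filter_insert, if_neg (by simpa using h)]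

theorem wrongRows_update_le (v row : ℕ → ℕ) (f a b : ℕ) :
    wrongRows v (Function.update row a b) f ≤ wrongRows v row f + 1 := by
  unfold wrongRows
  refine (Finset.card_le_card (t := insert a ((range f).filter fun g => row g ≠ v g)) ?_).trans
    (Finset.card_insert_le _ _)
  intro g hg
  by_cases h : g = a
  · simp [h]
  · simpa [Function.update_of_ne h, h] using hg

theorem wrongRows_update_of_le (v row : ℕ → ℕ) {f a : ℕ} (b : ℕ) (h : f ≤ a) :
    wrongRows v (Function.update row a b) f = wrongRows v row f := by
  unfold wrongRows
  congr 1
  refine Finset.filter_congr fun g hg => ?_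
  rw [Function.update_of_ne (by have := mem_range.1 hg; omega)]

/-- If the run of frame `g` is a nonempty string of parity `g % 2` that announces the index `g`,
except for some bad frames, then the number of wrong rows is at most four times the number of bad
frames. This is proved by an invariant of the scan: either the current run is a good frame, or the
number of wrong rows is smaller than the bound by a margin that pays for storing the current run
and, if need be, for merging the current run with the next frame. -/
theorem wrongRows_scanRows_le (w : ℕ → List α) (hw : ∀ g, ∀ a ∈ w g, par a = g % 2) (F : ℕ) :
    wrongRows (fun g => pk (w g)) (scanRows par idx pk ((List.range F).flatMap w)) F ≤
      4 * ((range F).filter fun g => ¬ (w g ≠ [] ∧ idx (w g) = g)).card := by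
  set v : ℕ → ℕ := fun g => pk (w g) with hv
  set B : ℕ → ℕ := fun f => ((range f).filter fun g => ¬ (w g ≠ [] ∧ idx (w g) = g)).card with hB
  have hBgood : ∀ f, w f ≠ [] ∧ idx (w f) = f → B (f + 1) = B f := fun f hf => by
    simp only [hB]; rw [Finset.range_add_one, Finset.filter_insert, if_neg (by simpa using hf)]
  have hBbad : ∀ f, ¬ (w f ≠ [] ∧ idx (w f) = f) → B (f + 1) = B f + 1 := fun f hf => by
    simp only [hB]
    rw [Finset.range_add_one, Finset.filter_insert, if_pos hf, Finset.card_insert_of_notMem]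
    simp
  set st : ℕ → Scan α := fun f =>
    ((List.range f).flatMap w).foldl (Scan.step par idx pk) Scan.start with hst
  have hsucc : ∀ f, st (f + 1) = (w f).foldl (Scan.step par idx pk) (st f) := fun f => by
    simp only [hst]
    rw [List.range_succ, List.flatMap_append, List.foldl_append]
    simp
  have key : ∀ f, (f = 0 ∧ st f = Scan.start) ∨
      (∃ g, f = g + 1 ∧ (w g ≠ [] ∧ idx (w g) = g) ∧ (st f).pend = w g ∧ (st f).prev = g % 2 ∧
        wrongRows v (st f).row g ≤ 4 * B g) ∨
      (wrongRows v (st f).row f + (if (st f).prev = f % 2 then 1 else 0) + 1 ≤ 4 * B f) := by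
    intro f
    induction f with
    | zero => left; exact ⟨rfl, rfl⟩
    | succ f ih =>
      right
      by_cases hf : w f ≠ [] ∧ idx (w f) = f
      · rcases ih with ⟨rfl, h0⟩ | ⟨g, rfl, hg, hpend, hprev, hwr⟩ | hN
        · left
          have := foldl_step_of_eq (idx := idx) (pk := pk) (hw 0) (s := st 0)
            (by rw [h0]; rfl)
          refine ⟨0, rfl, hf, ?_, ?_, ?_⟩
          · rw [hsucc, this, h0]; rfl
          · rw [hsucc, this]
          · simp [wrongRows]
        · left
          have := foldl_step_of_ne (idx := idx) (pk := pk) (hw (g + 1)) hf.1 (s := st (g + 1))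
            (by rw [hprev]; omega)
          refine ⟨g + 1, rfl, hf, ?_, ?_, ?_⟩
          · rw [hsucc, this]
          · rw [hsucc, this]
          · rw [hsucc, this, hBgood g hg, Scan.flush, hpend, hg.2, wrongRows_succ_of_eq (by simp [hv]),
              wrongRows_update_of_le _ _ _ le_rfl]
            exact hwr
        · by_cases hp : (st f).prev = f % 2
          · right
            have := foldl_step_of_eq (idx := idx) (pk := pk) (hw f) hp
            rw [hsucc, this, hBgood f hf, if_neg (by simp only; omega)]
            rw [if_pos hp] at hN
            have := wrongRows_succ_le v (st f).row f
            simp only; omega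
          · left
            have := foldl_step_of_ne (idx := idx) (pk := pk) (hw f) hf.1 hp
            refine ⟨f, rfl, hf, ?_, ?_, ?_⟩
            · rw [hsucc, this]
            · rw [hsucc, this]
            · rw [hsucc, this]
              rw [if_neg hp] at hN
              refine (wrongRows_update_le _ _ _ _ _).trans ?_
              omega
      · right
        have hB' := hBbad f hf
        by_cases hp : (st f).prev = f % 2
        · have := foldl_step_of_eq (idx := idx) (pk := pk) (hw f) hp
          rw [hsucc, this, hB', if_neg (by simp only; omega)]
          have h1 := wrongRows_succ_le v (st f).row f
          rcases ih with ⟨rfl, h0⟩ | ⟨g, rfl, hg, hpend, hprev, hwr⟩ | hN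
          · have : wrongRows v (st 0).row 0 = 0 := by simp [wrongRows]
            simp only; omega
          · omega
          · rw [if_pos hp] at hN
            simp only; omega
        · by_cases hnil : w f = []
          · rw [hsucc, hnil, List.foldl_nil, hB']
            have h1 := wrongRows_succ_le v (st f).row f
            rcases ih with ⟨rfl, h0⟩ | ⟨g, rfl, hg, hpend, hprev, hwr⟩ | hN
            · exact absurd (by rw [h0]; rfl) hp
            · have := wrongRows_succ_le v (st (g + 1)).row g
              have := hBgood g hg
              split_ifs <;> omega
            · rw [if_neg hp] at hN
              split_ifs <;> omega
          · have := foldl_step_of_ne (idx := idx) (pk := pk) (hw f) hnil hp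
            rw [hsucc, this, hB', if_neg (by simp only; omega)]
            have h1 := wrongRows_succ_le v ((st f).flush idx pk) f
            have h2 := wrongRows_update_le v (st f).row f (idx (st f).pend) (pk (st f).pend)
            rw [← Scan.flush] at h2
            rcases ih with ⟨rfl, h0⟩ | ⟨g, rfl, hg, hpend, hprev, hwr⟩ | hN
            · exact absurd (by rw [h0]; rfl) hp
            · have h3 : wrongRows v ((st (g + 1)).flush idx pk) (g + 1) =
                  wrongRows v (st (g + 1)).row g := by
                rw [Scan.flush, hpend, hg.2, wrongRows_succ_of_eq (by simp [hv]),
                  wrongRows_update_of_le _ _ _ le_rfl]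
              have := hBgood g hg
              simp only; omega
            · rw [if_neg hp] at hN
              simp only; omega
  have hfin : scanRows par idx pk ((List.range F).flatMap w) = (st F).flush idx pk := rfl
  rw [hfin]
  rcases key F with ⟨rfl, -⟩ | ⟨g, rfl, hg, hpend, hprev, hwr⟩ | hN
  · simp [wrongRows]
  · rw [Scan.flush, hpend, hg.2, wrongRows_succ_of_eq (by simp [hv]),
      wrongRows_update_of_le _ _ _ le_rfl]
    exact hwr.trans (by rw [← hBgood g hg])
  · exact (wrongRows_update_le _ _ _ _ _).trans (by simp only [hB] at hN ⊢; omega)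

end Scan

/-! ### Strings as numbers -/

theorem sum_digits_div_mod {b : ℕ} (hb : 0 < b) : ∀ (m : ℕ) (v : ℕ → ℕ), (∀ r, v r < b) →
    ∀ r < m, (∑ i ∈ range m, v i * b ^ i) / b ^ r % b = v r := by
  intro m
  induction m with
  | zero => intro v _ r hr; omega
  | succ m ih =>
    intro v hv r hr
    have h : ∑ i ∈ range (m + 1), v i * b ^ i = v 0 + b * ∑ i ∈ range m, v (i + 1) * b ^ i := by
      rw [Finset.sum_range_succ', Finset.mul_sum, add_comm]
      simp only [pow_zero, mul_one]
      congr 1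
      exact Finset.sum_congr rfl fun i _ => by ring
    rw [h]
    cases r with
    | zero => simp [Nat.add_mul_mod_self_left, Nat.mod_eq_of_lt (hv 0)]
    | succ r =>
      rw [pow_succ', ← Nat.div_div_eq_div_mul, Nat.add_mul_div_left _ _ hb,
        Nat.div_eq_of_lt (hv 0), zero_add]
      exact ih (fun i => v (i + 1)) (fun i => hv _) r (by omega)

theorem sum_div_mod_mul (b : ℕ) : ∀ m f : ℕ, f < b ^ m → ∑ i ∈ range m, f / b ^ i % b * b ^ i = f := by
  intro m
  induction m with
  | zero => intro f hf; simp at hf; simp [hf]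
  | succ m ih =>
    intro f hf
    rw [Finset.sum_range_succ']
    have := ih (f / b) (Nat.div_lt_of_lt_mul (by rwa [pow_succ'] at hf))
    have h2 : ∑ i ∈ range m, f / b ^ (i + 1) % b * b ^ (i + 1) =
        b * ∑ i ∈ range m, f / b / b ^ i % b * b ^ i := by
      rw [Finset.mul_sum]
      refine Finset.sum_congr rfl fun i _ => ?_
      rw [Nat.div_div_eq_div_mul, ← pow_succ']; ring
    rw [h2, this]
    simp only [pow_zero, Nat.div_one, mul_one]
    exact Nat.div_add_mod f b

theorem sum_mul_pow_lt {b : ℕ} (m : ℕ) {v : ℕ → ℕ} (hv : ∀ r, v r < b) :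
    ∑ i ∈ range m, v i * b ^ i < b ^ m := by
  induction m with
  | zero => simp
  | succ m ih =>
    rw [Finset.sum_range_succ, pow_succ']
    have := hv m
    nlinarith [Nat.mul_le_mul_right (b ^ m) (Nat.succ_le_of_lt this)]

/-- A string over `Fin Q` as a number with the digits `1, …, Q` in the base `Q + 1`, so that
strings of different lengths are distinguished. -/
def strVal (Q : ℕ) (l : List ℕ) : ℕ := Nat.ofDigits (Q + 1) (l.map (· + 1)).reverse

/-- The string with a given number. -/
def strOf (Q v : ℕ) : List ℕ := ((Nat.digits (Q + 1) v).map (· - 1)).reverse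

theorem strVal_concat (Q : ℕ) (l : List ℕ) (a : ℕ) :
    strVal Q (l ++ [a]) = strVal Q l * (Q + 1) + (a + 1) := by
  simp [strVal, Nat.ofDigits_cons]; ring

theorem strVal_lt {Q : ℕ} {l : List ℕ} (hl : ∀ a ∈ l, a < Q) {L : ℕ} (hL : l.length ≤ L) :
    strVal Q l < (Q + 1) ^ L := by
  by_cases hQ : Q = 0
  · have : l = [] := List.eq_nil_iff_forall_not_mem.2 fun a ha => by have := hl a ha; omega
    simp [this, strVal]
  refine lt_of_lt_of_le (Nat.ofDigits_lt_base_pow_length (b := Q + 1) (by omega) ?_)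
    (Nat.pow_le_pow_right (by omega) (by simpa using hL))
  intro x hx
  simp only [List.mem_reverse, List.mem_map] at hx
  obtain ⟨a, ha, rfl⟩ := hx
  have := hl a ha; omega

theorem strOf_strVal {Q : ℕ} {l : List ℕ} (hl : ∀ a ∈ l, a < Q) : strOf Q (strVal Q l) = l := by
  by_cases hQ : Q = 0
  · have : l = [] := List.eq_nil_iff_forall_not_mem.2 fun a ha => by have := hl a ha; omega
    simp [this, strVal, strOf]
  unfold strOf strVal
  rw [Nat.digits_ofDigits _ (by omega)]
  · simp [List.map_reverse, Function.comp_def]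
  · intro x hx
    simp only [List.mem_reverse, List.mem_map] at hx
    obtain ⟨a, ha, rfl⟩ := hx
    have := hl a ha; omega
  · intro h
    have := List.getLast_mem h
    simp only [List.mem_reverse, List.mem_map] at this
    obtain ⟨a, ha, h2⟩ := this
    omega

/-! ### Frames and blocks -/

/-- The subsequence of `c 0, …, c (L - 1)` that survives the deletions. -/
def natTrace {L : ℕ} (D : Fin L → Bool) (c : ℕ → ℕ) : List ℕ :=
  ((List.finRange L).filter fun l => !D l).map fun l : Fin L => c l

theorem map_natTrace {L : ℕ} (D : Fin L → Bool) (c : ℕ → ℕ) (f : ℕ → ℕ) :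
    (natTrace D c).map f = natTrace D fun l => f (c l) := by
  simp [natTrace, Function.comp_def]

theorem length_natTrace_le {L : ℕ} (D : Fin L → Bool) (c : ℕ → ℕ) : (natTrace D c).length ≤ L := by
  unfold natTrace
  rw [List.length_map]
  exact (List.length_filter_le _ _).trans (by simp)

theorem mem_natTrace {L : ℕ} {D : Fin L → Bool} {c : ℕ → ℕ} {a : ℕ} (h : a ∈ natTrace D c) :
    ∃ l : Fin L, c l = a := by
  simp only [natTrace, List.mem_map] at h
  obtain ⟨l, -, h⟩ := h
  exact ⟨l, h⟩

theorem natTrace_ne_nil {L : ℕ} {D : Fin L → Bool} (c : ℕ → ℕ)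
    (h : (univ.filter fun l => D l = true).card < L) : natTrace D c ≠ [] := by
  intro h0
  rw [natTrace, List.map_eq_nil_iff, List.filter_eq_nil_iff] at h0
  have : (univ.filter fun l => D l = true) = univ := by
    refine Finset.filter_true_of_mem fun l _ => ?_
    simpa using h0 l (by simp)
  rw [this] at h
  simp at h

/-- The code of `exists_block_code`, with natural numbers for messages, positions and letters. -/
theorem exists_nat_block_code {T L H e M : ℕ} (hM : 0 < M) (hH : 0 < H)
    (h : M * (4 ^ (L * T) * H ^ e) ≤ H ^ L) :
    ∃ (code : ℕ → ℕ → ℕ) (dec : (Fin T → List ℕ) → ℕ), (∀ y l, code y l < H) ∧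
      (∀ z, dec z < M) ∧ ∀ y < M, ∀ D : Fin T → Fin L → Bool, erased D ≤ e →
        dec (fun t => natTrace (D t) (code y)) = y := by
  obtain ⟨code, dec, hdec⟩ := exists_block_code hM hH h
  refine ⟨fun y l => if h : y < M ∧ l < L then code ⟨y, h.1⟩ ⟨l, h.2⟩ else 0,
    fun z => dec fun t => (z t).map fun a => ⟨a % H, Nat.mod_lt _ hH⟩, fun y l => ?_,
    fun z => (dec _).2, fun y hy D hD => ?_⟩
  · dsimp only; split_ifs
    · exact (code _ _).2
    · exact hH
  · refine Eq.trans (congrArg Fin.val ?_) (congrArg Fin.val (hdec ⟨y, hy⟩ D hD))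
    congr 1
    funext t
    simp only [natTrace, List.map_map, trace]
    refine List.map_congr_left fun l _ => Fin.ext ?_
    simp [hy, Nat.mod_eq_of_lt]

/-- The data of the inner coding. A codeword of the outer code, a string of `F * m` numbers below
`M`, is cut into `F` frames of `m` symbols. Each symbol becomes a block of `L` letters. A letter
consists of the parity of the frame, the place of the block in the frame, a letter of the `codeI`
word for one of `m` digits, in the base `V`, of the number of the frame, and a letter of the `codeD`
word for the outer symbol. Any trace of a `codeI` word determines it if at most `e'` letters are
missing, and `T` traces of a `codeD` word determine it if at most `e` letters are missing in all of
them. The functions are defined on all natural numbers; only values `v < V` and `y < M` and positions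
below `L` matter. -/
structure Scheme where
  (T L m F G H V M e e' : ℕ)
  codeI : ℕ → ℕ → ℕ
  decI : List ℕ → ℕ
  codeD : ℕ → ℕ → ℕ
  decD : (Fin T → List ℕ) → ℕ
  hm : 0 < m
  hG : 0 < G
  hH : 0 < H
  hF : F ≤ V ^ m
  he' : e' < L
  codeI_lt : ∀ v l, codeI v l < G
  decI_lt : ∀ z, decI z < V
  codeD_lt : ∀ y l, codeD y l < H
  decD_lt : ∀ z, decD z < M
  decI_trace : ∀ v < V, ∀ D : Fin L → Bool, (univ.filter fun l => D l = true).card ≤ e' →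
    decI (natTrace D (codeI v)) = v
  decD_trace : ∀ y < M, ∀ D : Fin T → Fin L → Bool, erased D ≤ e →
    decD (fun t => natTrace (D t) (codeD y)) = y

namespace Scheme

variable (S : Scheme)

/-- The size of the alphabet. -/
def Q : ℕ := 2 * S.m * S.G * S.H

/-- An upper bound for the numbers of strings of length at most `L`. -/
def P : ℕ := (S.Q + 1) ^ S.L

/-- The `l`-th letter of the `j`-th block of the codeword for the outer codeword `y`. -/
def letter (y : ℕ → ℕ) (j l : ℕ) : ℕ :=
  ((j / S.m % 2 * S.m + j % S.m) * S.G + S.codeI (j / S.m / S.V ^ (j % S.m) % S.V) l) * S.H +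
    S.codeD (y j) l

/-- The parity of the frame, as recorded in a letter. -/
def par (a : ℕ) : ℕ := a / S.H / S.G / S.m

/-- The place of the block in its frame, as recorded in a letter. -/
def place (a : ℕ) : ℕ := a / S.H / S.G % S.m

/-- The number of the string of the letters in `pend` that belong to the place `r`. The remainder
modulo `P` changes nothing unless there are more than `L` such letters, and it keeps the numbers
within the range of the tables. -/
def slot (pend : List ℕ) (r : ℕ) : ℕ := strVal S.Q (pend.filter fun a => S.place a = r) % S.P

/-- The digit of the frame number that is read off from the string with number `v`. -/
def digit (v : ℕ) : ℕ := S.decI ((strOf S.Q v).map fun a => a / S.H % S.G)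

/-- The frame number that is read off from a run of letters. -/
def idx (pend : List ℕ) : ℕ := ∑ r ∈ range S.m, S.digit (S.slot pend r) * S.V ^ r

/-- The contents of a run of letters: the strings of all places, packed into one number. -/
def pack (pend : List ℕ) : ℕ := ∑ r ∈ range S.m, S.slot pend r * S.P ^ r

/-- The outer symbol that is read off from `T` strings, given by their numbers. -/
def outer (u : ℕ) : ℕ :=
  S.decD fun t => (strOf S.Q (u / S.P ^ (t : ℕ) % S.P)).map fun a => a % S.H

/-- The rows found in one trace. -/
def rows (z : List ℕ) : ℕ → ℕ := scanRows S.par S.idx S.pack z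

/-- The word found from `T` traces. -/
def word (z : ℕ → List ℕ) (j : ℕ) : ℕ :=
  S.outer (∑ t ∈ range S.T, (S.rows (z t) (j / S.m) / S.P ^ (j % S.m) % S.P) * S.P ^ t)

theorem place_letter (y : ℕ → ℕ) (j l : ℕ) : S.place (S.letter y j l) = j % S.m := by
  unfold place letter
  rw [add_comm, Nat.add_mul_div_right _ _ S.hH, Nat.div_eq_of_lt (S.codeD_lt _ _), zero_add,
    add_comm, Nat.add_mul_div_right _ _ S.hG, Nat.div_eq_of_lt (S.codeI_lt _ _), zero_add, add_comm,
    Nat.add_mul_mod_self_right, Nat.mod_mod]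

theorem par_letter (y : ℕ → ℕ) (j l : ℕ) : S.par (S.letter y j l) = j / S.m % 2 := by
  unfold par letter
  rw [add_comm, Nat.add_mul_div_right _ _ S.hH, Nat.div_eq_of_lt (S.codeD_lt _ _), zero_add,
    add_comm, Nat.add_mul_div_right _ _ S.hG, Nat.div_eq_of_lt (S.codeI_lt _ _), zero_add, add_comm,
    Nat.add_mul_div_right _ _ S.hm, Nat.div_eq_of_lt (Nat.mod_lt _ S.hm), zero_add]

theorem letter_div_mod (y : ℕ → ℕ) (j l : ℕ) :
    S.letter y j l / S.H % S.G = S.codeI (j / S.m / S.V ^ (j % S.m) % S.V) l := by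
  unfold letter
  rw [add_comm, Nat.add_mul_div_right _ _ S.hH, Nat.div_eq_of_lt (S.codeD_lt _ _), zero_add,
    add_comm, Nat.add_mul_mod_self_right, Nat.mod_eq_of_lt (S.codeI_lt _ _)]

theorem letter_mod (y : ℕ → ℕ) (j l : ℕ) : S.letter y j l % S.H = S.codeD (y j) l := by
  unfold letter
  rw [add_comm, Nat.add_mul_mod_self_right, Nat.mod_eq_of_lt (S.codeD_lt _ _)]

theorem letter_lt (y : ℕ → ℕ) (j l : ℕ) : S.letter y j l < S.Q := by
  have h1 := S.codeI_lt (j / S.m / S.V ^ (j % S.m) % S.V) l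
  have h2 := S.codeD_lt (y j) l
  have h3 : j / S.m % 2 * S.m + j % S.m + 1 ≤ 2 * S.m := by
    have := Nat.mod_lt j S.hm
    have : j / S.m % 2 < 2 := Nat.mod_lt _ (by norm_num)
    nlinarith
  unfold letter Q
  set A := j / S.m % 2 * S.m + j % S.m
  set B := S.codeI (j / S.m / S.V ^ (j % S.m) % S.V) l
  have h4 : A * S.G + B + 1 ≤ 2 * S.m * S.G := by nlinarith [Nat.mul_le_mul_right S.G h3]
  nlinarith [Nat.mul_le_mul_right S.H h4]

theorem P_pos : 0 < S.P := by unfold P; positivity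

/-- The letters of a trace that come from the frame `f`. -/
def frame (y : ℕ → ℕ) (D : ℕ → Fin S.L → Bool) (f : ℕ) : List ℕ :=
  (List.range S.m).flatMap fun r => natTrace (D (f * S.m + r)) (S.letter y (f * S.m + r))

theorem flatMap_range_mul {α : Type*} (F m : ℕ) (B : ℕ → List α) :
    (List.range (F * m)).flatMap B =
      (List.range F).flatMap fun f => (List.range m).flatMap fun r => B (f * m + r) := by
  induction F with
  | zero => simp
  | succ F ih =>
    rw [Nat.succ_mul, List.range_add, List.flatMap_append, ih, List.range_succ,
      List.flatMap_append]
    simp [List.flatMap_map]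

theorem flatMap_range_ite {α : Type*} {m r : ℕ} (hr : r < m) (l : List α) :
    ((List.range m).flatMap fun r' => if r' = r then l else []) = l := by
  obtain ⟨k, rfl⟩ : ∃ k, m = r + (1 + k) := ⟨m - r - 1, by omega⟩
  rw [List.range_add, List.range_add]
  simp only [List.map_append, List.flatMap_append, List.flatMap_map]
  have h1 : ((List.range r).flatMap fun r' => if r' = r then l else []) = [] :=
    List.flatMap_eq_nil_iff.2 fun x hx => if_neg (List.mem_range.1 hx).ne
  simp [h1]

theorem filter_frame (y : ℕ → ℕ) (D : ℕ → Fin S.L → Bool) (f : ℕ) {r : ℕ} (hr : r < S.m) :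
    ((S.frame y D f).filter fun a => S.place a = r) =
      natTrace (D (f * S.m + r)) (S.letter y (f * S.m + r)) := by
  rw [frame, List.filter_flatMap]
  rw [← flatMap_range_ite hr (natTrace (D (f * S.m + r)) (S.letter y (f * S.m + r)))]
  refine List.flatMap_congr fun r' hr' => ?_
  have hp : ∀ a ∈ natTrace (D (f * S.m + r')) (S.letter y (f * S.m + r')), S.place a = r' := by
    intro a ha
    obtain ⟨l, rfl⟩ := mem_natTrace ha
    rw [place_letter, add_comm, Nat.add_mul_mod_self_right,
      Nat.mod_eq_of_lt (List.mem_range.1 hr')]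
  split_ifs with h
  · subst h
    exact List.filter_eq_self.2 fun a ha => by simpa using hp a ha
  · exact List.filter_eq_nil_iff.2 fun a ha => by simpa [hp a ha] using h

theorem slot_frame (y : ℕ → ℕ) (D : ℕ → Fin S.L → Bool) (f : ℕ) {r : ℕ} (hr : r < S.m) :
    S.slot (S.frame y D f) r =
      strVal S.Q (natTrace (D (f * S.m + r)) (S.letter y (f * S.m + r))) := by
  rw [slot, S.filter_frame y D f hr, Nat.mod_eq_of_lt]
  refine strVal_lt (fun a ha => ?_) (length_natTrace_le _ _)
  obtain ⟨l, rfl⟩ := mem_natTrace ha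
  exact S.letter_lt _ _ _

theorem slot_lt (pend : List ℕ) (r : ℕ) : S.slot pend r < S.P := Nat.mod_lt _ S.P_pos

theorem digit_frame (y : ℕ → ℕ) (D : ℕ → Fin S.L → Bool) {f r : ℕ} (hr : r < S.m)
    (hD : (univ.filter fun l => D (f * S.m + r) l = true).card ≤ S.e') :
    S.digit (S.slot (S.frame y D f) r) = f / S.V ^ r % S.V := by
  have h1 : (f * S.m + r) / S.m = f := by
    rw [add_comm, Nat.add_mul_div_right _ _ S.hm, Nat.div_eq_of_lt hr, zero_add]
  have h2 : (f * S.m + r) % S.m = r := by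
    rw [add_comm, Nat.add_mul_mod_self_right, Nat.mod_eq_of_lt hr]
  have hV : 0 < S.V := (Nat.zero_le _).trans_lt (S.decI_lt [])
  rw [S.slot_frame y D f hr, digit, strOf_strVal (fun a ha => ?_), map_natTrace]
  · simp only [letter_div_mod, h1, h2]
    exact S.decI_trace _ (Nat.mod_lt _ hV) _ hD
  · obtain ⟨l, rfl⟩ := mem_natTrace ha
    exact S.letter_lt _ _ _

/-- A frame is recognized unless one of its blocks is bad. -/
theorem idx_frame (y : ℕ → ℕ) (D : ℕ → Fin S.L → Bool) {f : ℕ} (hf : f < S.F)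
    (hD : ∀ r < S.m, (univ.filter fun l => D (f * S.m + r) l = true).card ≤ S.e') :
    S.frame y D f ≠ [] ∧ S.idx (S.frame y D f) = f := by
  constructor
  · intro h
    have h1 := S.filter_frame y D f S.hm
    rw [h] at h1
    exact natTrace_ne_nil _ ((hD 0 S.hm).trans_lt S.he') h1.symm
  · rw [idx, Finset.sum_congr rfl fun r hr =>
      by rw [S.digit_frame y D (mem_range.1 hr) (hD r (mem_range.1 hr))]]
    exact sum_div_mod_mul _ _ _ (hf.trans_le S.hF)

/-- The frame number that is read off from a run of letters is bounded. -/
theorem idx_lt (pend : List ℕ) : S.idx pend < S.V ^ S.m :=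
  sum_mul_pow_lt _ fun _ => S.decI_lt _

/-- The word found from the traces differs from the encoded word in at most `4 m T + 1` places for
each bad block: in each trace a bad block spoils at most four frames of `m` places, and besides the
symbol of the bad block itself may be decoded wrongly. -/
theorem card_word_ne_le (y : ℕ → ℕ) (hy : ∀ j, y j < S.M) (D : ℕ → ℕ → Fin S.L → Bool)
    (z : ℕ → List ℕ) (hz : ∀ t < S.T, z t = (List.range (S.F * S.m)).flatMap fun j =>
      natTrace (D t j) (S.letter y j)) :
    ((range (S.F * S.m)).filter fun j => S.word z j ≠ y j).card ≤
      (4 * S.m * S.T + 1) * ((range (S.F * S.m)).filter fun j =>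
        Bad S.e S.e' fun (t : Fin S.T) => D t j).card := by
  classical
  set bad : Finset ℕ := (range (S.F * S.m)).filter fun j =>
    Bad S.e S.e' fun (t : Fin S.T) => D t j with hbad
  set R : ℕ → Finset ℕ := fun t => (range S.F).filter fun f =>
    S.rows (z t) f ≠ S.pack (S.frame y (D t) f) with hR
  have hRcard : ∀ t < S.T, (R t).card ≤ 4 * bad.card := by
    intro t ht
    have h1 := wrongRows_scanRows_le (par := S.par) (idx := S.idx) (pk := S.pack)
      (S.frame y (D t)) (fun f a ha => by
        rw [frame, List.mem_flatMap] at ha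
        obtain ⟨r, hr, ha⟩ := ha
        obtain ⟨l, rfl⟩ := mem_natTrace ha
        rw [par_letter, add_comm, Nat.add_mul_div_right _ _ S.hm,
          Nat.div_eq_of_lt (List.mem_range.1 hr), zero_add]) S.F
    have h2 : (List.range S.F).flatMap (S.frame y (D t)) = z t := by
      rw [hz t ht, flatMap_range_mul]; rfl
    rw [h2] at h1
    refine h1.trans (Nat.mul_le_mul_left 4 ?_)
    refine (Finset.card_le_card (t := bad.image fun j => j / S.m) fun f hf => ?_).trans
      Finset.card_image_le
    obtain ⟨hf1, hf2⟩ := mem_filter.1 hf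
    rw [mem_range] at hf1
    by_contra hno
    refine hf2 (S.idx_frame y (D t) hf1 fun r hr => ?_)
    by_contra hlt
    refine hno (mem_image.2 ⟨f * S.m + r, mem_filter.2 ⟨?_, Or.inr ⟨⟨t, ht⟩, not_le.1 hlt⟩⟩, ?_⟩)
    · rw [mem_range]; nlinarith
    · rw [add_comm, Nat.add_mul_div_right _ _ S.hm, Nat.div_eq_of_lt hr, zero_add]
  have hsub : ((range (S.F * S.m)).filter fun j => S.word z j ≠ y j) ⊆
      bad ∪ (range S.T).biUnion fun t =>
        (R t ×ˢ range S.m).image fun p => p.1 * S.m + p.2 := by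
    intro j hj
    obtain ⟨hj1, hj2⟩ := mem_filter.1 hj
    rw [mem_range] at hj1
    by_contra hno
    simp only [mem_union, mem_biUnion, mem_range, mem_image, mem_product, not_or, not_exists,
      not_and] at hno
    obtain ⟨hnb, hnR⟩ := hno
    refine hj2 ?_
    have hf : j / S.m < S.F := Nat.div_lt_of_lt_mul (by rwa [mul_comm] at hj1)
    have hr : j % S.m < S.m := Nat.mod_lt _ S.hm
    have hj' : j / S.m * S.m + j % S.m = j := Nat.div_add_mod' j S.m
    have hrow : ∀ t < S.T, S.rows (z t) (j / S.m) / S.P ^ (j % S.m) % S.P =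
        strVal S.Q (natTrace (D t j) (S.letter y j)) := by
      intro t ht
      have : S.rows (z t) (j / S.m) = S.pack (S.frame y (D t) (j / S.m)) := by
        by_contra hne
        exact hnR t ht (j / S.m, j % S.m) ⟨mem_filter.2 ⟨mem_range.2 hf, hne⟩, hr⟩ hj'
      rw [this, pack, sum_digits_div_mod S.P_pos _ _ (fun r => S.slot_lt _ _) _ hr,
        S.slot_frame y (D t) _ hr, hj']
    have hlet : ∀ t, ∀ a ∈ natTrace (D t j) (S.letter y j), a < S.Q := fun t a ha => by
      obtain ⟨l, rfl⟩ := mem_natTrace ha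
      exact S.letter_lt _ _ _
    have hsum : ∑ t ∈ range S.T, (S.rows (z t) (j / S.m) / S.P ^ (j % S.m) % S.P) * S.P ^ t =
        ∑ t ∈ range S.T, strVal S.Q (natTrace (D t j) (S.letter y j)) * S.P ^ t :=
      Finset.sum_congr rfl fun t ht => by rw [hrow t (mem_range.1 ht)]
    rw [word, hsum, outer]
    have : (fun t : Fin S.T => (strOf S.Q ((∑ t ∈ range S.T,
        strVal S.Q (natTrace (D t j) (S.letter y j)) * S.P ^ t) / S.P ^ (t : ℕ) % S.P)).map
          fun a => a % S.H) = fun t : Fin S.T => natTrace (D t j) (S.codeD (y j)) := by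
      funext t
      rw [sum_digits_div_mod S.P_pos _ _
        (fun t => strVal_lt (hlet t) (length_natTrace_le _ _)) _ t.2, strOf_strVal (hlet t),
        map_natTrace]
      simp only [letter_mod]
    rw [this]
    refine S.decD_trace _ (hy j) (fun t => D t j) ?_
    by_contra hlt
    exact hnb (mem_filter.2 ⟨mem_range.2 hj1, Or.inl (by omega)⟩)
  refine (Finset.card_le_card hsub).trans ((Finset.card_union_le _ _).trans ?_)
  have h2 : ((range S.T).biUnion fun t =>
      (R t ×ˢ range S.m).image fun p => p.1 * S.m + p.2).card ≤ S.T * (4 * bad.card * S.m) := by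
    refine Finset.card_biUnion_le.trans ?_
    rw [← smul_eq_mul, ← card_range S.T, ← sum_const, card_range]
    refine Finset.sum_le_sum fun t ht => Finset.card_image_le.trans ?_
    rw [card_product, card_range]
    exact Nat.mul_le_mul_right _ (hRcard t (mem_range.1 ht))
  calc _ ≤ bad.card + S.T * (4 * bad.card * S.m) := by omega
    _ = _ := by ring

end Scheme

end TraceCode

/-! ### Programs for the inner code -/

namespace TraceCode

open Finset WordRAM

namespace Scheme

variable (S : Scheme)

/-- The number of entries of the tables that the programs use. -/
def size : ℕ := S.P + S.P ^ S.T + S.M * S.L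

/-- The tables that the programs use, one after the other: `digit`, `outer`, and the words of the
code `codeD`. -/
def tab (i : ℕ) : ℕ :=
  if i < S.P then S.digit i else if i < S.P + S.P ^ S.T then S.outer (i - S.P)
  else S.codeD ((i - (S.P + S.P ^ S.T)) / S.L) ((i - (S.P + S.P ^ S.T)) % S.L)

/-- All numbers that the programs handle fit into words of `w` bits. -/
structure Fits (w : ℕ) : Prop where
  letter : (S.P + 1) * (S.Q + 2) ≤ 2 ^ w
  pack : S.P ^ S.m < 2 ^ w
  idx : (S.T + 1) * (S.V ^ S.m + 1) < 2 ^ w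
  size : S.size < 2 ^ w
  length : S.F * S.m * S.L < 2 ^ w

theorem L_pos : 0 < S.L := (Nat.zero_le _).trans_lt S.he'

theorem V_pos : 0 < S.V := (Nat.zero_le _).trans_lt (S.decI_lt [])

theorem Q_pos : 0 < S.Q := by
  have := S.hm; have := S.hG; have := S.hH
  unfold Q; positivity

theorem m_le_Q : S.m ≤ S.Q := by
  unfold Q
  calc S.m ≤ S.m * (2 * S.G * S.H) := Nat.le_mul_of_pos_right _ (by
        have := S.hG; have := S.hH; positivity)
    _ = _ := by ring

theorem G_le_Q : S.G ≤ S.Q := by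
  unfold Q
  calc S.G ≤ S.G * (2 * S.m * S.H) := Nat.le_mul_of_pos_right _ (by
        have := S.hm; have := S.hH; positivity)
    _ = _ := by ring

theorem H_le_Q : S.H ≤ S.Q := by
  unfold Q
  exact Nat.le_mul_of_pos_left _ (by have := S.hm; have := S.hG; positivity)

theorem tab_digit {v : ℕ} (h : v < S.P) : S.tab v = S.digit v := by rw [tab, if_pos h]

theorem tab_outer {u : ℕ} (h : u < S.P ^ S.T) : S.tab (S.P + u) = S.outer u := by
  rw [tab, if_neg (by omega), if_pos (by omega), Nat.add_sub_cancel_left]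

theorem tab_codeD (y : ℕ) {l : ℕ} (h : l < S.L) :
    S.tab (y * S.L + (S.P + S.P ^ S.T + l)) = S.codeD y l := by
  have : y * S.L + (S.P + S.P ^ S.T + l) - (S.P + S.P ^ S.T) = l + y * S.L := by omega
  rw [tab, if_neg (by omega), if_neg (by omega), this, Nat.add_mul_div_right _ _ S.L_pos,
    Nat.div_eq_of_lt h, zero_add, Nat.add_mul_mod_self_right, Nat.mod_eq_of_lt h]

/-- The outer word as a function on all natural numbers. -/
def extend {N : ℕ} (y : Fin N → ZMod S.M) (j : ℕ) : ℕ := if h : j < N then (y ⟨j, h⟩).val else 0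

theorem extend_lt {N : ℕ} [NeZero S.M] (y : Fin N → ZMod S.M) (j : ℕ) : S.extend y j < S.M := by
  unfold extend
  split_ifs
  · exact ZMod.val_lt _
  · exact NeZero.pos _

variable {S} {I : Type} {E : Env I} {Φ : Set (I → ℕ)} {σ : I → ℕ → ℕ} {s : ℕ}

theorem Fits.Q_lt {w : ℕ} (h : S.Fits w) : S.Q + 1 < 2 ^ w :=
  lt_of_lt_of_le (by nlinarith [S.P_pos]) h.letter

theorem Fits.P_lt {w : ℕ} (h : S.Fits w) : S.P < 2 ^ w :=
  lt_of_lt_of_le (by nlinarith [S.P_pos]) h.letter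

theorem Fits.one_le {w : ℕ} (h : S.Fits w) : 1 ≤ w := by
  by_contra h0
  have := h.Q_lt
  have hw : w = 0 := by omega
  rw [hw] at this
  omega

/-- A letter of a codeword: everything but the letter of the `codeD` word, which is looked up, is a
constant that depends on the position only. -/
theorem frm_letter (hfit : S.Fits E.w) (htab : E.tab = S.tab) (hsize : E.size = S.size)
    {Y : I → ℕ → ℕ} {j l : ℕ} (hY : ∀ x, Y x j < S.M) (hl : l < S.L) (hΦ : (fun x => Y x j) ∈ Φ) :
    Frm E Φ σ 7 fun x => S.letter (Y x) j l := by
  have hb : ∀ x, Y x j * S.L + (S.P + S.P ^ S.T + l) < S.size := fun x => by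
    have := Nat.mul_le_mul_right S.L (Nat.succ_le_of_lt (hY x))
    unfold size; rw [Nat.succ_mul] at this; omega
  have hM : 0 < S.M := (Nat.zero_le _).trans_lt (S.decD_lt fun _ => [])
  have hML : S.L ≤ S.M * S.L := Nat.le_mul_of_pos_left _ hM
  have hs := hfit.size
  have hL : S.L < 2 ^ E.w := by unfold size at hs; omega
  have hc : S.P + S.P ^ S.T + l < 2 ^ E.w := by unfold size at hs; omega
  have h1 := ((Frm.wire (σ := σ) hΦ).mul (Frm.const hL) fun x =>
    ((Nat.le_add_right _ _).trans_lt (hb x)).trans hs).add (Frm.const hc) fun x => (hb x).trans hs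
  have h2 := h1.look fun x => hsize ▸ hb x
  refine ((Frm.add (Frm.const (a := ((j / S.m % 2 * S.m + j % S.m) * S.G +
    S.codeI (j / S.m / S.V ^ (j % S.m) % S.V) l) * S.H) ?_) h2 fun x => ?_).congr
      fun x => ?_).mono (by norm_num)
  · exact ((Nat.le_add_right _ _).trans_lt (S.letter_lt (fun _ => 0) j l)).trans
      (by have := hfit.Q_lt; omega)
  · rw [htab, tab_codeD _ _ hl]
    exact (S.letter_lt (Y x) j l).trans (by have := hfit.Q_lt; omega)
  · rw [htab, tab_codeD _ _ hl]; rfl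

/-- The inner encoding can be carried out when the symbols of the outer codeword are available. -/
theorem evaluates_letters [NeZero S.M] (hfit : S.Fits E.w) (htab : E.tab = S.tab)
    (hsize : E.size = S.size) {N : ℕ} {y : I → Fin N → ZMod S.M}
    (hy : ∀ j, (fun x => (y x j).val) ∈ Φ) (hA : Avail E s Φ σ) :
    Evaluates E (s + 8 * (N * S.L)) (N * S.L) fun x i =>
      S.letter (S.extend (y x)) (i / S.L) (i % S.L) := by
  have h := hA.family (univ : Finset (Fin (N * S.L))) (c := fun _ => 7)
    (f := fun i x => S.letter (S.extend (y x)) (i / S.L) (i % S.L)) fun i _ => by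
      have hi : (i : ℕ) / S.L < N := Nat.div_lt_of_lt_mul (lt_of_lt_of_eq i.2 (mul_comm _ _))
      refine frm_letter hfit htab hsize (Y := fun x => S.extend (y x))
        (fun x => S.extend_lt _ _) (Nat.mod_lt _ S.L_pos) ?_
      have := hy ⟨i / S.L, hi⟩
      simpa [extend, hi] using this
  have h2 := h.evaluates (out := fun x i => S.letter (S.extend (y x)) (i / S.L) (i % S.L))
    fun k => Or.inr ⟨k, by simp, rfl⟩
  simp only [sum_const, card_univ, Fintype.card_fin, smul_eq_mul] at h2
  obtain ⟨l, h3, h4⟩ := h2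
  exact ⟨l, by omega, h4⟩

/-! ### The program for scanning a trace -/

/-- The state of the scan after `k` letters. -/
def state (S : Scheme) (z : List ℕ) (k : ℕ) : Scan ℕ :=
  (z.take k).foldl (Scan.step S.par S.idx S.pack) Scan.start

/-- The `k`-th letter of a string increased by `1`, or `0` beyond the end of the string. -/
def sym (z : List ℕ) (k : ℕ) : ℕ := if k < z.length then z.getD k 0 + 1 else 0

/-- The `k`-th letter starts a new run. -/
def Turn (S : Scheme) (z : List ℕ) (k : ℕ) : Prop :=
  0 < sym z k ∧ ¬ S.par (sym z k - 1) = (S.state z k).prev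

instance (S : Scheme) (z : List ℕ) (k : ℕ) : Decidable (S.Turn z k) := by
  unfold Turn; infer_instance

theorem state_succ (z : List ℕ) (k : ℕ) : S.state z (k + 1) =
    if 0 < sym z k then (S.state z k).step S.par S.idx S.pack (sym z k - 1) else S.state z k := by
  unfold sym
  by_cases h : k < z.length
  · simp only [h, if_true, Nat.add_sub_cancel, Nat.succ_pos]
    rw [state, List.take_add_one, List.foldl_append]
    simp [h, state]
  · simp only [h, if_false, lt_irrefl]
    rw [state, state, List.take_of_length_le (by omega), List.take_of_length_le (by omega)]

theorem state_succ_prev (z : List ℕ) (k : ℕ) : (S.state z (k + 1)).prev =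
    if S.Turn z k then S.par (sym z k - 1) else (S.state z k).prev := by
  rw [state_succ]
  by_cases h : 0 < sym z k
  · rw [if_pos h, Scan.step]
    by_cases h2 : S.par (sym z k - 1) = (S.state z k).prev
    · rw [if_pos h2, if_neg fun hT : S.Turn z k => hT.2 h2]
    · rw [if_neg h2, if_pos (show S.Turn z k from ⟨h, h2⟩)]
  · rw [if_neg h, if_neg fun hT : S.Turn z k => h hT.1]

theorem state_succ_row (z : List ℕ) (k : ℕ) : (S.state z (k + 1)).row =
    if S.Turn z k then (S.state z k).flush S.idx S.pack else (S.state z k).row := by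
  rw [state_succ]
  by_cases h : 0 < sym z k
  · rw [if_pos h, Scan.step]
    by_cases h2 : S.par (sym z k - 1) = (S.state z k).prev
    · rw [if_pos h2, if_neg fun hT : S.Turn z k => hT.2 h2]
    · rw [if_neg h2, if_pos (show S.Turn z k from ⟨h, h2⟩)]
  · rw [if_neg h, if_neg fun hT : S.Turn z k => h hT.1]

theorem slot_concat (l : List ℕ) (a r : ℕ) : S.slot (l ++ [a]) r =
    if S.place a = r then (S.slot l r * (S.Q + 1) + (a + 1)) % S.P else S.slot l r := by
  unfold slot
  rw [List.filter_append]
  split_ifs with h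
  · rw [List.filter_singleton, decide_eq_true h, cond_true, strVal_concat]
    simp [Nat.add_mod, Nat.mul_mod]
  · rw [List.filter_singleton, decide_eq_false h, cond_false, List.append_nil]

theorem state_succ_slot (z : List ℕ) (k r : ℕ) : S.slot (S.state z (k + 1)).pend r =
    if 0 < sym z k ∧ S.place (sym z k - 1) = r then
      ((if S.Turn z k then 0 else S.slot (S.state z k).pend r) * (S.Q + 1) + sym z k) % S.P
    else if S.Turn z k then 0 else S.slot (S.state z k).pend r := by
  rw [state_succ]
  by_cases h : 0 < sym z k
  · have h1 : sym z k - 1 + 1 = sym z k := by omega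
    have hT : S.Turn z k ↔ ¬ S.par (sym z k - 1) = (S.state z k).prev :=
      ⟨fun hT => hT.2, fun hT => ⟨h, hT⟩⟩
    simp only [h, if_true, true_and, hT]
    rw [Scan.step]
    by_cases h2 : S.par (sym z k - 1) = (S.state z k).prev
    · simp only [h2, if_true, not_true, if_false]
      rw [slot_concat, h1]
    · simp only [h2, if_false, not_false_eq_true, if_true]
      have h3 := S.slot_concat [] (sym z k - 1) r
      have h4 : S.slot [] r = 0 := by simp [slot, strVal]
      rw [List.nil_append, h1, h4] at h3
      exact h3
  · simp [h, show ¬ S.Turn z k from fun hT => h hT.1]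

theorem state_prev_lt {z : List ℕ} (hz : ∀ a ∈ z, a < S.Q) (k : ℕ) : (S.state z k).prev < S.Q := by
  induction k with
  | zero => exact S.Q_pos
  | succ k ih =>
    rw [state_succ_prev]
    split_ifs with h
    · have h1 := h.1
      unfold sym at h1 ⊢
      split_ifs at h1 ⊢ with h2
      · rw [Nat.add_sub_cancel]
        refine lt_of_le_of_lt ?_ (hz (z.getD k 0) ?_)
        · unfold par
          exact (Nat.div_le_self _ _).trans ((Nat.div_le_self _ _).trans (Nat.div_le_self _ _))
        · rw [List.getD_eq_getElem _ _ h2]; exact List.getElem_mem h2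
      · omega
    · exact ih

theorem sym_le {z : List ℕ} (hz : ∀ a ∈ z, a < S.Q) (k : ℕ) : sym z k ≤ S.Q := by
  unfold sym
  split_ifs with h
  · rw [List.getD_eq_getElem _ _ h]; exact hz _ (List.getElem_mem h)
  · omega

/-- The mutable array holds the rows `ρ x t`, those of different `t` interleaved. The cell `0` is left
free as the target of store instructions that are meant to have no effect. -/
def Holds (T : ℕ) (σ : I → ℕ → ℕ) (ρ : I → ℕ → ℕ → ℕ) : Prop :=
  ∀ x, ∀ t < T, ∀ f, σ x (1 + t + T * f) = ρ x t f

theorem Holds.update {T : ℕ} {σ : I → ℕ → ℕ} {ρ : I → ℕ → ℕ → ℕ} (h : Holds T σ ρ) {t : ℕ}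
    (ht : t < T) (P : I → Prop) [DecidablePred P] (i v : I → ℕ) :
    Holds T (fun x => Function.update (σ x) (if P x then 1 + t + T * i x else 0) (v x))
      fun x => Function.update (ρ x) t
        (if P x then Function.update (ρ x t) (i x) (v x) else ρ x t) := by
  intro x t' ht' f
  have hinj : 1 + t' + T * f = 1 + t + T * i x ↔ t' = t ∧ f = i x := by
    constructor
    · intro he
      have h1 : (t' + T * f) % T = (t + T * i x) % T := by rw [show t' + T * f = t + T * i x by omega]
      have h2 : (t' + T * f) / T = (t + T * i x) / T := by rw [show t' + T * f = t + T * i x by omega]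
      rw [Nat.add_mul_mod_self_left, Nat.add_mul_mod_self_left, Nat.mod_eq_of_lt ht,
        Nat.mod_eq_of_lt ht'] at h1
      rw [Nat.add_mul_div_left _ _ (by omega), Nat.add_mul_div_left _ _ (by omega),
        Nat.div_eq_of_lt ht, Nat.div_eq_of_lt ht'] at h2
      omega
    · rintro ⟨rfl, rfl⟩; rfl
  by_cases hP : P x
  · simp only [hP, if_true]
    by_cases ht2 : t' = t
    · subst ht2
      rw [Function.update_self]
      by_cases hf : f = i x
      · subst hf; rw [Function.update_self, Function.update_self]
      · rw [Function.update_of_ne (by rw [Ne, hinj]; tauto), Function.update_of_ne hf, h x t' ht']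
    · rw [Function.update_of_ne (by rw [Ne, hinj]; tauto), Function.update_of_ne ht2, h x t' ht']
  · simp only [hP, if_false, Function.update_eq_self]
    rw [Function.update_of_ne (by omega), h x t' ht']

/-- A positional number whose digits are values of formulas. -/
theorem frm_positional {m b c : ℕ} {v : ℕ → I → ℕ} (hv : ∀ r < m, Frm E Φ σ c (v r))
    (hb : 0 < b) (hlt : ∀ x r, v r x < b) (hw : b ^ m < 2 ^ E.w) :
    Frm E Φ σ (m * (c + 3) + 1) fun x => ∑ r ∈ range m, v r x * b ^ r := by
  have hs : ∀ x, ∑ r ∈ range m, v r x * b ^ r < 2 ^ E.w := fun x =>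
    (sum_mul_pow_lt m fun r => hlt x r).trans hw
  refine (Frm.sum (range m) (c := fun _ => c + 1 + 1) (fun r hr => ?_) hs).mono ?_
  · refine (hv r (mem_range.1 hr)).mul (Frm.const ?_) fun x => ?_
    · exact (Nat.pow_le_pow_right hb (mem_range.1 hr).le).trans_lt hw
    · exact (Finset.single_le_sum (f := fun r => v r x * b ^ r) (fun _ _ => Nat.zero_le _) hr).trans_lt
        (hs x)
  · rw [sum_const, card_range, smul_eq_mul]

/-- The number of instructions for one letter. -/
def stepCost (m : ℕ) : ℕ := 140 * m + 100

section Step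

variable {Z : I → ℕ → List ℕ} {ρ : I → ℕ → ℕ → ℕ}

/-- The quantities kept while a trace is scanned. -/
def scanWires (S : Scheme) (Z : I → ℕ → List ℕ) (t k : ℕ) : Set (I → ℕ) :=
  {f | (f = fun x => (S.state (Z x t) k).prev) ∨
    ∃ r < S.m, f = fun x => S.slot (S.state (Z x t) k).pend r}

/-- The input of the programs for the traces `Z x 0`, …, `Z x (T - 1)`. -/
structure Input (S : Scheme) (E : Env I) (Z : I → ℕ → List ℕ) : Prop where
  fits : S.Fits E.w
  tab : E.tab = S.tab
  size : E.size = S.size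
  inp : ∀ x, ∀ t < S.T, E.inp x (t + 1) = fun i => (Z x t).getD i 0 % 2 ^ E.w
  len : ∀ x, ∀ t < S.T, E.len x (t + 1) = (Z x t).length % 2 ^ E.w
  lt : ∀ x t, ∀ a ∈ Z x t, a < S.Q
  length_le : ∀ x t, (Z x t).length ≤ S.F * S.m * S.L
  J : E.J = S.T

theorem Input.frm_sym (h : S.Input E Z) {t : ℕ} (ht : t < S.T) {k : ℕ}
    (hk : k < S.F * S.m * S.L) : Frm E Φ σ 12 fun x => sym (Z x t) k := by
  have hlt := h.fits.Q_lt
  have hlen : ∀ x, E.len x (t + 1) = (Z x t).length := fun x => by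
    rw [h.len x t ht, Nat.mod_eq_of_lt ((h.length_le x t).trans_lt h.fits.length)]
  have hget : ∀ x, (Z x t).getD k 0 < S.Q := fun x => by
    by_cases hk : k < (Z x t).length
    · rw [List.getD_eq_getElem _ _ hk]; exact h.lt x t _ (List.getElem_mem hk)
    · rw [List.getD_eq_default _ _ (by omega)]; exact S.Q_pos
  have hinp : ∀ x, E.inp x (t + 1) k = (Z x t).getD k 0 := fun x => by
    rw [h.inp x t ht]; exact Nat.mod_eq_of_lt ((hget x).trans (by omega))
  have hkc : Frm E Φ σ 1 fun _ => k := .const (hk.trans h.fits.length)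
  have h1 : Frm E Φ σ 1 fun _ => 1 := .const (by omega)
  have hJ : t + 1 ≤ E.J := by rw [h.J]; omega
  have a1 := Frm.lt hkc (Frm.len (E := E) (j := t + 1) (by omega) hJ) h.fits.one_le
  have a2 := (Frm.input (j := t + 1) (by omega) hJ hkc).add h1 fun x => by
    rw [hinp]; have := hget x; omega
  refine ((a1.mul a2 fun x => ?_).congr fun x => ?_).mono le_rfl
  · rw [hinp]; have := hget x; split_ifs <;> omega
  · rw [hinp, hlen, sym]; split_ifs <;> simp

theorem Input.frm_idx (h : S.Input E Z) {t k : ℕ} (hΦ : S.scanWires Z t k ⊆ Φ) :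
    Frm E Φ σ (S.m * 4 + 1) fun x => S.idx (S.state (Z x t) k).pend := by
  refine frm_positional (c := 1) (fun r hr => ?_) S.V_pos (fun _ _ => S.decI_lt _)
    (lt_of_le_of_lt (by nlinarith [Nat.zero_le (S.T * (S.V ^ S.m + 1))]) h.fits.idx)
  refine ((Frm.wire (E := E) (hΦ (Or.inr ⟨r, hr, rfl⟩))).look fun x => ?_).congr fun x => ?_
  · rw [h.size]; exact (S.slot_lt _ _).trans_le (by unfold Scheme.size; omega)
  · rw [h.tab, S.tab_digit (S.slot_lt _ _)]

theorem Input.frm_pack (h : S.Input E Z) {t k : ℕ} (hΦ : S.scanWires Z t k ⊆ Φ) :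
    Frm E Φ σ (S.m * 3 + 1) fun x => S.pack (S.state (Z x t) k).pend :=
  frm_positional (c := 0) (fun r hr => .wire (hΦ (Or.inr ⟨r, hr, rfl⟩))) S.P_pos
    (fun _ _ => S.slot_lt _ _) h.fits.pack

theorem Input.frm_address (h : S.Input E Z) {t k : ℕ} (ht : t < S.T)
    (hΦ : S.scanWires Z t k ⊆ Φ) :
    Frm E Φ σ (S.m * 4 + 5) fun x => 1 + t + S.T * S.idx (S.state (Z x t) k).pend := by
  have hidx := h.fits.idx
  have hlt : ∀ x, 1 + t + S.T * S.idx (S.state (Z x t) k).pend < 2 ^ E.w := fun x =>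
    lt_of_le_of_lt (by nlinarith [S.idx_lt (S.state (Z x t) k).pend]) hidx
  refine (Frm.add (Frm.const (a := 1 + t) ?_) (Frm.mul (Frm.const (a := S.T) ?_)
    (h.frm_idx hΦ) fun x => (Nat.le_add_left _ _).trans_lt (hlt x)) hlt).mono (by omega)
  · exact lt_of_le_of_lt (by nlinarith [Nat.zero_le (S.V ^ S.m)]) hidx
  · exact lt_of_le_of_lt (by nlinarith [Nat.zero_le (S.V ^ S.m)]) hidx

/-- One letter of a trace is processed. -/
theorem Input.step (h : S.Input E Z) {t k : ℕ} (ht : t < S.T) (hk : k < S.F * S.m * S.L)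
    (hA : Avail E s (S.scanWires Z t k) σ)
    (hσ : Holds S.T σ fun x => Function.update (ρ x) t (S.state (Z x t) k).row) :
    ∃ σ', Avail E (s + stepCost S.m) (S.scanWires Z t (k + 1)) σ' ∧
      Holds S.T σ' fun x => Function.update (ρ x) t (S.state (Z x t) (k + 1)).row := by
  have hw := h.fits.one_le
  have hQ := h.fits.Q_lt
  have hP := h.fits.P_lt
  have hsym : ∀ x, sym (Z x t) k < 2 ^ E.w := fun x =>
    (sym_le (h.lt x t) k).trans_lt (by omega)
  have h0 : ∀ {Φ : Set (I → ℕ)} {σ}, Frm E Φ σ 1 fun _ => 0 := .const (by omega)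
  have h1 : ∀ {Φ : Set (I → ℕ)} {σ}, Frm E Φ σ 1 fun _ => 1 := .const (by omega)
  have hcm : ∀ {Φ : Set (I → ℕ)} {σ}, Frm E Φ σ 1 fun _ => S.m :=
    .const (by have := S.m_le_Q; omega)
  have hcG : ∀ {Φ : Set (I → ℕ)} {σ}, Frm E Φ σ 1 fun _ => S.G :=
    .const (by have := S.G_le_Q; omega)
  have hcH : ∀ {Φ : Set (I → ℕ)} {σ}, Frm E Φ σ 1 fun _ => S.H :=
    .const (by have := S.H_le_Q; omega)
  -- the letter, its place and its parity, and whether it starts a new run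
  have A1 := hA.frm (h.frm_sym ht hk)
  set Φ₁ := insert (fun x => sym (Z x t) k) (S.scanWires Z t k) with hΦ₁
  have A2 := A1.frm ((((Frm.wire (E := E) (σ := σ) (Φ := Φ₁) (Or.inl rfl)).sub h1).div hcH).div hcG
    |>.mod hcm)
  set Φ₂ := insert (fun x => S.place (sym (Z x t) k - 1)) Φ₁ with hΦ₂
  have A3 := A2.frm ((((Frm.wire (E := E) (σ := σ) (Φ := Φ₂)
    (f := fun x => sym (Z x t) k) (Or.inr (Or.inl rfl))).sub h1).div hcH).div hcG |>.div hcm)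
  set Φ₃ := insert (fun x => S.par (sym (Z x t) k - 1)) Φ₂ with hΦ₃
  have hpar : ∀ x, S.par (sym (Z x t) k - 1) < 2 ^ E.w := fun x => by
    unfold Scheme.par
    exact ((Nat.div_le_self _ _).trans ((Nat.div_le_self _ _).trans ((Nat.div_le_self _ _).trans
      (Nat.sub_le _ _)))).trans_lt (hsym x)
  have hplace : ∀ x, S.place (sym (Z x t) k - 1) < 2 ^ E.w := fun x => by
    unfold Scheme.place
    exact ((Nat.mod_le _ _).trans ((Nat.div_le_self _ _).trans ((Nat.div_le_self _ _).trans
      (Nat.sub_le _ _)))).trans_lt (hsym x)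
  have hprev : ∀ x, (S.state (Z x t) k).prev < 2 ^ E.w := fun x =>
    (state_prev_lt (h.lt x t) k).trans (by omega)
  have wsym : ∀ {Φ' : Set (I → ℕ)} {σ}, Φ₃ ⊆ Φ' → Frm E Φ' σ 0 fun x => sym (Z x t) k := fun hs =>
    .wire (hs (Or.inr (Or.inr (Or.inl rfl))))
  have fpos : ∀ {Φ' : Set (I → ℕ)} {σ}, Φ₃ ⊆ Φ' →
      Frm E Φ' σ 6 fun x => if 0 < sym (Z x t) k then 1 else 0 := fun hs =>
    Frm.lt h0 (wsym hs) hw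
  have sub₃ : S.scanWires Z t k ⊆ Φ₃ :=
    (Set.subset_insert _ _).trans ((Set.subset_insert _ _).trans (Set.subset_insert _ _))
  have A4 := A3.frm (f := fun x => if S.Turn (Z x t) k then 1 else 0) (c := 14)
    (((fpos subset_rfl).and ((Frm.eq (E := E) (σ := σ) (Φ := Φ₃)
      (.wire (Or.inl rfl)) (.wire (sub₃ (Or.inl rfl))) hw hpar hprev).not hw) hw).congr
        fun x => rfl)
  set Φ₄ := insert (fun x => if S.Turn (Z x t) k then 1 else 0) Φ₃ with hΦ₄
  have sub₄ : S.scanWires Z t k ⊆ Φ₄ := sub₃.trans (Set.subset_insert _ _)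
  have wturn : ∀ {σ : I → ℕ → ℕ}, Frm E Φ₄ σ 0 fun x => if S.Turn (Z x t) k then 1 else 0 :=
    .wire (Or.inl rfl)
  -- the run is stored, in the unused cell `0` if it is not finished
  have haddr : ∀ x, 1 + t + S.T * S.idx (S.state (Z x t) k).pend < 2 ^ E.w := fun x =>
    lt_of_le_of_lt (by nlinarith [S.idx_lt (S.state (Z x t) k).pend]) h.fits.idx
  have A5 := A4.store (wturn.ite (h.frm_address ht sub₄) h0 hw haddr fun _ => by omega)
    (h.frm_pack sub₄)
  refine ⟨fun x => Function.update (σ x)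
    (if S.Turn (Z x t) k then 1 + t + S.T * S.idx (S.state (Z x t) k).pend else 0)
    (S.pack (S.state (Z x t) k).pend), ?_, ?_⟩
  rotate_left
  · have := hσ.update ht (fun x => S.Turn (Z x t) k)
      (fun x => S.idx (S.state (Z x t) k).pend) fun x => S.pack (S.state (Z x t) k).pend
    intro x t' ht' f
    rw [this x t' ht' f]
    simp only [Function.update_idem, Function.update_self]
    rw [state_succ_row]
    rfl
  -- the new run
  have hslot : ∀ x r, S.slot (S.state (Z x t) k).pend r < 2 ^ E.w := fun x r =>
    (S.slot_lt _ _).trans hP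
  have hbase : ∀ x r, (if S.Turn (Z x t) k then 0 else S.slot (S.state (Z x t) k).pend r) < S.P :=
    fun x r => by
      split_ifs
      · exact S.P_pos
      · exact S.slot_lt _ _
  have fbase : ∀ {σ : I → ℕ → ℕ}, ∀ r < S.m, Frm E Φ₄ σ 6 fun x =>
      if S.Turn (Z x t) k then 0 else S.slot (S.state (Z x t) k).pend r := fun r hr =>
    wturn.ite h0 (.wire (sub₄ (Or.inr ⟨r, hr, rfl⟩))) hw (fun _ => by omega) fun x => hslot x r
  have fslot : ∀ {σ : I → ℕ → ℕ}, ∀ r < S.m, Frm E Φ₄ σ 57 fun x =>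
      S.slot (S.state (Z x t) (k + 1)).pend r := by
    intro σ r hr
    have hr' : r < 2 ^ E.w := by have := S.m_le_Q; omega
    have e1 : Frm E Φ₄ σ 14 fun x =>
        if 0 < sym (Z x t) k ∧ S.place (sym (Z x t) k - 1) = r then 1 else 0 :=
      (fpos (Set.subset_insert _ _)).and (Frm.eq (.wire (Or.inr (Or.inr (Or.inl rfl))))
        (.const hr') hw hplace fun _ => hr') hw
    have e2 : Frm E Φ₄ σ 11 fun x =>
        ((if S.Turn (Z x t) k then 0 else S.slot (S.state (Z x t) k).pend r) * (S.Q + 1) +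
          sym (Z x t) k) % S.P := by
      have hb : ∀ x, (if S.Turn (Z x t) k then 0 else S.slot (S.state (Z x t) k).pend r) *
          (S.Q + 1) + sym (Z x t) k < 2 ^ E.w := fun x => by
        have h2 := sym_le (h.lt x t) k
        have h3 := Nat.mul_le_mul_right (S.Q + 1) (hbase x r).le
        refine lt_of_lt_of_le ?_ h.fits.letter
        nlinarith [S.P_pos]
      exact ((((fbase r hr).mul (.const hQ) fun x => (Nat.le_add_right _ _).trans_lt (hb x)).add
        (wsym (Set.subset_insert _ _)) hb).mod (.const hP)).mono (by omega)
    refine ((e1.ite e2 (fbase r hr) hw (fun x => (Nat.mod_lt _ S.P_pos).trans hP) fun x =>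
      (hbase x r).trans hP).congr fun x => (state_succ_slot _ _ _).symm).mono (by omega)
  have fprev : ∀ {Φ' : Set (I → ℕ)} {σ : I → ℕ → ℕ}, Φ₄ ⊆ Φ' → Frm E Φ' σ 5 fun x =>
      (S.state (Z x t) (k + 1)).prev := fun hs =>
    (((wturn.ite (.wire (Or.inr (Or.inl rfl))) (.wire (sub₄ (Or.inl rfl))) hw hpar hprev).congr
      fun x => (state_succ_prev _ _).symm).of_subset hs)
  have A6 := (A5.family (range S.m) (c := fun _ => 57) fun r hr => fslot r (mem_range.1 hr)).frm
    (fprev Set.subset_union_left)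
  refine A6.mono ?_ ?_
  · rw [sum_const, card_range, smul_eq_mul]
    unfold stepCost; omega
  · rintro f (rfl | ⟨r, hr, rfl⟩)
    · exact Or.inl rfl
    · exact Or.inr (Or.inr ⟨r, by simpa using hr, rfl⟩)

/-- A whole trace is processed. -/
theorem Input.scan (h : S.Input E Z) {t : ℕ} (ht : t < S.T) (hA : Avail E s ∅ σ)
    (hσ : Holds S.T σ ρ) (hρ : ∀ x, ρ x t = fun _ => 0) :
    ∃ σ', Avail E (s + (S.F * S.m * S.L + 1) * stepCost S.m) ∅ σ' ∧
      Holds S.T σ' fun x => Function.update (ρ x) t (S.rows (Z x t)) := by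
  have hQ := h.fits.Q_lt
  have h0 : ∀ {Φ : Set (I → ℕ)} {σ}, Frm E Φ σ 1 fun _ => 0 := .const (by omega)
  have key : ∀ k ≤ S.F * S.m * S.L, ∃ σ', Avail E (s + 1 + k * stepCost S.m) (S.scanWires Z t k) σ' ∧
      Holds S.T σ' fun x => Function.update (ρ x) t (S.state (Z x t) k).row := by
    intro k
    induction k with
    | zero =>
      intro _
      refine ⟨σ, (hA.frm h0).mono (by omega) ?_, ?_⟩
      · rintro f (rfl | ⟨r, hr, rfl⟩)
        · exact Or.inl rfl
        · refine Or.inl (funext fun x => ?_)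
          simp [state, Scan.start, slot, strVal]
      · intro x t' ht' f
        rw [hσ x t' ht' f]
        beta_reduce
        by_cases h2 : t' = t
        · subst h2; rw [Function.update_self, hρ]; rfl
        · rw [Function.update_of_ne h2]
    | succ k ih =>
      intro hk
      obtain ⟨σ', h1, h2⟩ := ih (by omega)
      obtain ⟨σ'', h3, h4⟩ := h.step ht (by omega) h1 h2
      exact ⟨σ'', h3.mono (by rw [Nat.add_one_mul k]; omega) subset_rfl, h4⟩
  obtain ⟨σ', h1, h2⟩ := key _ le_rfl
  refine ⟨_, (h1.store (h.frm_address ht subset_rfl) (h.frm_pack subset_rfl)).mono ?_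
    (Set.empty_subset _), ?_⟩
  · rw [Nat.add_one_mul (S.F * S.m * S.L)]
    have : S.m * 7 + 8 ≤ stepCost S.m := by unfold stepCost; omega
    omega
  · have := h2.update ht (fun _ => True)
      (fun x => S.idx (S.state (Z x t) (S.F * S.m * S.L)).pend)
      fun x => S.pack (S.state (Z x t) (S.F * S.m * S.L)).pend
    simp only [if_true, Function.update_idem, Function.update_self] at this
    intro x t' ht' f
    rw [this x t' ht' f]
    simp only [state, List.take_of_length_le (h.length_le _ _)]
    rfl

/-- All traces are processed. -/
theorem Input.scan_all (h : S.Input E Z) :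
    ∃ σ, Avail E (S.T * ((S.F * S.m * S.L + 1) * stepCost S.m)) ∅ σ ∧
      Holds S.T σ fun x t => S.rows (Z x t) := by
  have key : ∀ k ≤ S.T, ∃ σ, Avail E (k * ((S.F * S.m * S.L + 1) * stepCost S.m)) ∅ σ ∧
      Holds S.T σ fun x t => if t < k then S.rows (Z x t) else fun _ => 0 := by
    intro k
    induction k with
    | zero =>
      intro _
      exact ⟨_, (Avail.start E).mono (by omega) subset_rfl, fun x t _ f => by simp⟩
    | succ k ih =>
      intro hk
      obtain ⟨σ, h1, h2⟩ := ih (by omega)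
      obtain ⟨σ', h3, h4⟩ := h.scan (t := k) (by omega) h1 h2 fun x => by simp
      refine ⟨σ', h3.mono (by rw [Nat.add_one_mul k]) subset_rfl, fun x t ht f => ?_⟩
      rw [h4 x t ht f]
      beta_reduce
      by_cases h5 : t = k
      · subst h5; simp
      · rw [Function.update_of_ne h5]
        by_cases h6 : t < k
        · simp [h6, h6.trans (Nat.lt_succ_self k)]
        · simp [h6, show ¬ t < k + 1 by omega]
  obtain ⟨σ, h1, h2⟩ := key _ le_rfl
  exact ⟨σ, h1, fun x t ht f => by rw [h2 x t ht f]; simp [ht]⟩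

/-- The word found from the traces can be computed. -/
theorem Input.avail_word (h : S.Input E Z) :
    ∃ σ, Avail E (S.T * ((S.F * S.m * S.L + 1) * stepCost S.m) + S.F * S.m * (9 * S.T + 4))
      (Set.range fun (j : Fin (S.F * S.m)) x => S.word (Z x) j) σ := by
  obtain ⟨σ, h1, h2⟩ := h.scan_all
  have hP := h.fits.P_lt
  have hs := h.fits.size
  have hPT : S.P ^ S.T < 2 ^ E.w := by unfold Scheme.size at hs; omega
  refine ⟨σ, (h1.family (univ : Finset (Fin (S.F * S.m))) (c := fun _ => 9 * S.T + 4)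
    (f := fun j x => S.word (Z x) j) fun j _ => ?_).mono (by simp) (by simp)⟩
  have hf : (j : ℕ) / S.m < S.F := Nat.div_lt_of_lt_mul (lt_of_lt_of_eq j.2 (mul_comm _ _))
  have hfV := hf.trans_le S.hF
  have hdig : ∀ t < S.T, Frm E (∅ : Set (I → ℕ)) σ 6 fun x =>
      S.rows (Z x t) (j / S.m) / S.P ^ (j % S.m) % S.P := by
    intro t ht
    have haddr : 1 + t + S.T * (j / S.m) < 2 ^ E.w :=
      by
      have h3 := h.fits.idx
      have h4 := Nat.mul_le_mul_left S.T hfV.le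
      rw [show (S.T + 1) * (S.V ^ S.m + 1) = S.T * S.V ^ S.m + S.T + S.V ^ S.m + 1 by ring] at h3
      omega
    have hpow : S.P ^ ((j : ℕ) % S.m) < 2 ^ E.w :=
      (Nat.pow_le_pow_right S.P_pos (Nat.mod_lt _ S.hm).le).trans_lt h.fits.pack
    refine ((((Frm.const haddr).fetch.congr fun x => h2 x t ht _).div (.const hpow)).mod
      (.const hP)).mono (by norm_num)
  have hsum := frm_positional hdig S.P_pos (fun x r => Nat.mod_lt _ S.P_pos) hPT
  have hlt : ∀ x, ∑ t ∈ range S.T, (S.rows (Z x t) (j / S.m) / S.P ^ ((j : ℕ) % S.m) % S.P) * S.P ^ t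
      < S.P ^ S.T := fun x => sum_mul_pow_lt _ fun _ => Nat.mod_lt _ S.P_pos
  refine (((Frm.const hP).add hsum fun x => ?_).look fun x => ?_).congr (fun x => ?_) |>.mono
    (by omega)
  · have := hlt x; unfold Scheme.size at hs; omega
  · have := hlt x; rw [h.size]; unfold Scheme.size; omega
  · rw [h.tab, S.tab_outer (hlt x)]; rfl

end Step

end Scheme

end TraceCode

/-! ### The code and its programs -/

namespace TraceCode

open Finset WordRAM ExpanderCode

theorem filter_map_eq_flatMap {α β : Type*} (l : List α) (p : α → Bool) (f : α → β) :
    (l.filter p).map f = l.flatMap fun a => if p a then [f a] else [] := by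
  induction l with
  | nil => rfl
  | cons a l ih =>
    rw [List.filter_cons, List.flatMap_cons, ← ih]
    split_ifs <;> simp

theorem flatMap_finRange {α : Type*} (n : ℕ) (φ : ℕ → List α) :
    ((List.finRange n).flatMap fun i : Fin n => φ i) = (List.range n).flatMap φ := by
  rw [← List.map_coe_finRange_eq_range, List.flatMap_map]

theorem card_filter_range {N : ℕ} (P : ℕ → Prop) [DecidablePred P] :
    ((range N).filter P).card = (univ.filter fun j : Fin N => P j).card := by
  rw [Finset.card_filter, Finset.card_filter, Finset.sum_range]

/-- A trace of a string that consists of blocks is the concatenation of traces of the blocks. -/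
theorem map_trace_eq {N L Q : ℕ} (c : Fin (N * L) → Fin Q) (g : ℕ → ℕ → ℕ)
    (hc : ∀ i, (c i : ℕ) = g (i / L) (i % L)) (D : Fin (N * L) → Bool) :
    (trace c D).map Fin.val = (List.range N).flatMap fun j =>
      natTrace (fun l : Fin L => if h : j < N then D (finProdFinEquiv (⟨j, h⟩, l)) else false)
        (g j) := by
  rw [trace, List.map_map, filter_map_eq_flatMap]
  set φ : ℕ → List ℕ := fun i => if h : i < N * L then
    if !D ⟨i, h⟩ then [g (i / L) (i % L)] else [] else [] with hφ
  have h1 : ((List.finRange (N * L)).flatMap fun i =>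
      if (!D i) = true then [(Fin.val ∘ c) i] else []) =
      (List.finRange (N * L)).flatMap fun i : Fin (N * L) => φ i :=
    List.flatMap_congr fun i _ => by simp [hφ, hc]
  rw [h1, flatMap_finRange, Scheme.flatMap_range_mul]
  refine List.flatMap_congr fun j hj => ?_
  have hj' := List.mem_range.1 hj
  rw [← flatMap_finRange, natTrace, filter_map_eq_flatMap]
  refine List.flatMap_congr fun l _ => ?_
  have hlt : j * L + l < N * L := by
    have := Nat.mul_le_mul_right L (Nat.succ_le_of_lt hj')
    have := l.2
    rw [Nat.succ_mul] at *; omega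
  have hL : 0 < L := (Nat.zero_le _).trans_lt l.2
  have hdiv : (j * L + l) / L = j := by
    rw [add_comm, Nat.add_mul_div_right _ _ hL, Nat.div_eq_of_lt l.2, zero_add]
  have hmod : (j * L + l) % L = l := by
    rw [add_comm, Nat.add_mul_mod_self_right, Nat.mod_eq_of_lt l.2]
  have hidx : (⟨j * L + l, hlt⟩ : Fin (N * L)) = finProdFinEquiv (⟨j, hj'⟩, l) :=
    Fin.ext (by simp [finProdFinEquiv]; ring)
  simp only [hφ, hlt, hj', dif_pos, hdiv, hmod, hidx]

/-- The residues modulo `M` as the numbers below `M`. -/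
def zmodEquivFin (M : ℕ) [NeZero M] : ZMod M ≃ Fin M where
  toFun z := ⟨z.val, ZMod.val_lt z⟩
  invFun k := (k : ℕ)
  left_inv z := ZMod.natCast_zmod_val z
  right_inv k := Fin.ext (ZMod.val_cast_of_lt k.2)

/-- The message with a given sequence of words as its digits in the base `M`. -/
def messageEquiv (M K : ℕ) [NeZero M] : (Fin K → ZMod M) ≃ Fin (M ^ K) :=
  (Equiv.arrowCongr (Equiv.refl _) (zmodEquivFin M)).trans finFunctionFinEquiv

theorem messageEquiv_div_mod (M K : ℕ) [NeZero M] (x : Fin K → ZMod M) (i : Fin K) :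
    (messageEquiv M K x : ℕ) / M ^ (i : ℕ) % M = (x i).val := by
  have h : (messageEquiv M K x : ℕ) =
      ∑ k ∈ range K, (if h : k < K then (x ⟨k, h⟩).val else 0) * M ^ k := by
    rw [messageEquiv, Equiv.trans_apply, finFunctionFinEquiv_apply, Finset.sum_range]
    exact Finset.sum_congr rfl fun k _ => by simp [zmodEquivFin]
  rw [h, sum_digits_div_mod (NeZero.pos M) _ _ (fun r => ?_) _ i.2]
  · simp
  · split_ifs
    · exact ZMod.val_lt _
    · exact NeZero.pos M

/-- The words of a message can be put together from its bits. -/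
theorem sum_bits (u K : ℕ) [NeZero (2 ^ u)] (x : Fin K → ZMod (2 ^ u)) (i : Fin K) :
    ∑ k ∈ range u, (bits (u * K) (messageEquiv (2 ^ u) K x)).getD (u * i + k) 0 * 2 ^ k =
      (x i).val := by
  rw [← messageEquiv_div_mod]
  set v : ℕ := (messageEquiv (2 ^ u) K x : ℕ)
  rw [← sum_div_mod_mul 2 u (v / (2 ^ u) ^ (i : ℕ) % 2 ^ u) (Nat.mod_lt _ (by positivity))]
  refine Finset.sum_congr rfl fun k hk => ?_
  have hk' := mem_range.1 hk
  have hlt : u * i + k < u * K := by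
    have := Nat.mul_le_mul_left u (Nat.succ_le_of_lt i.2)
    rw [Nat.mul_succ] at this; omega
  rw [bits, List.getD_eq_getElem _ _ (by simpa using hlt)]
  simp only [List.getElem_map, List.getElem_range]
  rw [← Nat.toNat_testBit, Nat.testBit_mod_two_pow, ← pow_mul, Nat.testBit_div_two_pow]
  simp [hk', add_comm]

namespace Scheme

variable (S : Scheme)

/-- The codeword of the concatenated code for a codeword of the outer code. -/
def encode [NeZero S.M] {N : ℕ} (y : Fin N → ZMod S.M) : Fin (N * S.L) → Fin S.Q :=
  fun i => ⟨S.letter (S.extend y) (i / S.L) (i % S.L), S.letter_lt _ _ _⟩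

/-- Strings over the alphabet as strings of natural numbers. -/
def lists (z : Fin S.T → List (Fin S.Q)) (t : ℕ) : List ℕ :=
  if h : t < S.T then (z ⟨t, h⟩).map Fin.val else []

theorem lists_eq_getD (z : Fin S.T → List (Fin S.Q)) (t : ℕ) :
    S.lists z t = (List.ofFn fun j => (z j).map fun a => (a : ℕ)).getD t [] := by
  rw [lists, List.getD_eq_getElem?_getD, List.getElem?_ofFn]
  split_ifs
  · simp [List.map_eq_flatMap]
  · rfl

/-- The word found from the traces, as a word over the alphabet of the outer code. -/
def found {N : ℕ} (z : Fin S.T → List (Fin S.Q)) (j : Fin N) : ZMod S.M := (S.word (S.lists z) j : ℕ)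

theorem val_found {N : ℕ} (z : Fin S.T → List (Fin S.Q)) (j : Fin N) :
    (S.found z j).val = S.word (S.lists z) j := ZMod.val_cast_of_lt (S.decD_lt _)

/-- The statement of `card_word_ne_le` for the traces of a codeword. -/
theorem card_found_ne_le [NeZero S.M] (y : Fin (S.F * S.m) → ZMod S.M)
    (D : Fin S.T → Fin (S.F * S.m * S.L) → Bool) :
    (univ.filter fun j => S.found (fun t => trace (S.encode y) (D t)) j ≠ y j).card ≤
      (4 * S.m * S.T + 1) * (univ.filter fun j => Bad S.e S.e' (blockPattern D j)).card := by
  set D' : ℕ → ℕ → Fin S.L → Bool := fun t j l => if ht : t < S.T then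
    if hj : j < S.F * S.m then D ⟨t, ht⟩ (finProdFinEquiv (⟨j, hj⟩, l)) else false else false with hD'
  have h := S.card_word_ne_le (S.extend y) (S.extend_lt y) D'
    (S.lists fun t => trace (S.encode y) (D t)) fun t ht => by
      rw [lists, dif_pos ht, map_trace_eq _ (S.letter (S.extend y)) fun i => rfl]
      simp [hD', ht]
  rw [card_filter_range, card_filter_range] at h
  convert h using 2
  · refine Finset.filter_congr fun j _ => ?_
    rw [not_iff_not, ← (ZMod.val_injective S.M).eq_iff, val_found]
    simp [extend]
  · congr 1
    refine Finset.filter_congr fun j _ => ?_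
    have : (fun (t : Fin S.T) => D' t j) = blockPattern D j := by
      funext t l; simp [hD', blockPattern]
    rw [this]

/-- The concatenation of an outer code that corrects `r` errors with the inner coding, together with
the programs. The decoder encodes the message that it has found, so that its output is a codeword. -/
theorem exists_coded_reconstruction {u K r B sE sD w s₁ s₂ : ℕ} [NeZero S.M] (hM : S.M = 2 ^ u)
    (hT : 0 < S.T)
    (enc : (Fin K → ZMod S.M) → Fin (S.F * S.m) → ZMod S.M)
    (dec : (Fin (S.F * S.m) → ZMod S.M) → Fin K → ZMod S.M)
    (hdec : ∀ x y, (univ.filter fun j => y j ≠ enc x j).card ≤ r → dec y = x)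
    (henc : Computable B sE enc) (hdec' : Computable B sD dec)
    (hfit : S.Fits w) (hB : B ≤ 2 ^ w) (huK : u * K < 2 ^ w)
    (hs₁ : K * (5 * u + 1) + sE + 8 * (S.F * S.m * S.L) ≤ s₁)
    (hs₂ : S.T * ((S.F * S.m * S.L + 1) * stepCost S.m) + S.F * S.m * (9 * S.T + 4) + sD + sE +
      8 * (S.F * S.m * S.L) ≤ s₂)
    (hw : 14 + 2 * S.T + 3 * s₁ + 3 * s₂ + S.size < 2 ^ w) :
    ∃ (C : Finset (Fin (S.F * S.m * S.L) → Fin S.Q)) (Enc : Fin C.card ≃ C)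
      (Dec : (Fin S.T → List (Fin S.Q)) → C) (d : List ℕ), C.card = S.M ^ K ∧
      (∀ c ∈ C, ∀ D : Fin S.T → Fin (S.F * S.m * S.L) → Bool,
        (4 * S.m * S.T + 1) * (univ.filter fun j => Bad S.e S.e' (blockPattern D j)).card ≤ r →
        (Dec fun t => trace c (D t)) = c) ∧
      d.length ≤ 6 + 3 * s₁ + 3 * s₂ + S.size ∧
      EncodesInTime w (interpreter 1 0) d (45 * s₁ + 5 * (S.F * S.m * S.L) + 20) Enc ∧
      DecodesInTime w (interpreter S.T 2) d
        ((4 * S.T + 41) * s₂ + 5 * (S.F * S.m * S.L) + 20) Dec := by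
  classical
  set n := S.F * S.m * S.L with hn
  set f : (Fin K → ZMod S.M) → Fin n → Fin S.Q := fun x => S.encode (enc x) with hf
  set g : (Fin S.T → List (Fin S.Q)) → Fin K → ZMod S.M := fun z => dec (S.found z) with hg
  have hrec : ∀ x, ∀ D : Fin S.T → Fin n → Bool,
      (4 * S.m * S.T + 1) * (univ.filter fun j => Bad S.e S.e' (blockPattern D j)).card ≤ r →
      g (fun t => trace (f x) (D t)) = x := fun x D hD =>
    hdec _ _ ((S.card_found_ne_le (enc x) D).trans hD)
  have hinj : Function.Injective f := by
    intro x x' hx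
    have h0 : ∀ x, g (fun t => trace (f x) fun _ => false) = x := fun x => by
      refine hrec x (fun _ _ => false) ?_
      rw [Finset.filter_false_of_mem]
      · simp
      · intro j _ hbad
        rcases hbad with hbad | ⟨t, ht⟩
        · have : erased (blockPattern (fun (_ : Fin S.T) (_ : Fin n) => false) j) = 0 := by
            rw [erased, Finset.card_eq_zero, Finset.filter_eq_empty_iff]
            intro l _ h
            have := h ⟨0, hT⟩
            simp [blockPattern] at this
          omega
        · simp [blockPattern] at ht
    rw [← h0 x, ← h0 x', hx]
  set C : Finset (Fin n → Fin S.Q) := univ.image f with hC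
  have hmem : ∀ x, f x ∈ C := fun x => mem_image_of_mem f (mem_univ x)
  have hcard : C.card = S.M ^ K := by
    rw [hC, Finset.card_image_of_injective _ hinj, card_univ, Fintype.card_fun, ZMod.card,
      Fintype.card_fin]
  let toC : (Fin K → ZMod S.M) ≃ C := Equiv.ofBijective (fun x => ⟨f x, hmem x⟩)
    ⟨fun x x' h => hinj (congrArg Subtype.val h), fun c => by
      obtain ⟨x, -, hx⟩ := mem_image.1 c.2
      exact ⟨x, Subtype.ext hx⟩⟩
  let Enc : Fin C.card ≃ C := ((finCongr hcard).trans (messageEquiv S.M K).symm).trans toC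
  let Dec : (Fin S.T → List (Fin S.Q)) → C := fun z => ⟨f (g z), hmem _⟩
  -- the encoding program
  let E₁ : Env (Fin K → ZMod S.M) := ⟨1, w, S.size, S.tab,
    fun x _ i => (bits (u * K) (messageEquiv S.M K x)).getD i 0 % 2 ^ w,
    fun _ _ => u * K % 2 ^ w⟩
  have hE₁ : Evaluates E₁ s₁ n fun x i => (f x i : ℕ) := by
    have hQ := hfit.Q_lt
    have hbit : ∀ x i, (bits (u * K) (messageEquiv S.M K x)).getD i 0 ≤ 1 := fun x i => by
      rw [List.getD_eq_getElem?_getD]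
      cases h : (bits (u * K) (messageEquiv S.M K x))[i]? with
      | none => simp
      | some b =>
        obtain ⟨h1, h2⟩ := List.getElem?_eq_some_iff.1 h
        rw [Option.getD_some, ← h2]
        simp only [bits, List.getElem_map]
        exact Bool.toNat_le _
    have hone : 1 < 2 ^ w := by have := S.Q_pos; omega
    have hMw : S.M < 2 ^ w := by
      have h1 := hfit.size
      have : S.M ≤ S.M * S.L := Nat.le_mul_of_pos_right _ S.L_pos
      unfold Scheme.size at h1; omega
    have hsum : ∀ x (i : Fin K), ∑ k ∈ range u,
        (bits (u * K) (messageEquiv S.M K x)).getD (u * i + k) 0 * 2 ^ k = (x i).val := by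
      intro x i
      have key : ∀ (M : ℕ) [NeZero M] (_ : M = 2 ^ u) (x : Fin K → ZMod M), ∑ k ∈ range u,
          (bits (u * K) (messageEquiv M K x)).getD (u * i + k) 0 * 2 ^ k = (x i).val := by
        intro M _ hM x
        subst hM
        exact sum_bits u K x i
      exact key S.M hM x
    have hword : ∀ i ∈ (univ : Finset (Fin K)),
        Frm E₁ ∅ (fun _ _ => 0) (5 * u + 1) fun x => (x i).val := by
      intro i _
      have hval : ∀ x : Fin K → ZMod S.M, ∑ k ∈ range u,
          (bits (u * K) (messageEquiv S.M K x)).getD (u * i + k) 0 * 2 ^ k < 2 ^ w := fun x => by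
        rw [hsum]; exact (ZMod.val_lt _).trans hMw
      refine ((Frm.sum (range u) (c := fun _ => 4) (f := fun k x =>
        (bits (u * K) (messageEquiv S.M K x)).getD (u * i + k) 0 * 2 ^ k) (fun k hk => ?_)
          hval).congr fun x => hsum x i).mono ?_
      · have hk' := mem_range.1 hk
        have hlt : u * i + k < 2 ^ w := by
          have := Nat.mul_le_mul_left u (Nat.succ_le_of_lt i.2)
          rw [Nat.mul_succ] at this; omega
        have hin : ∀ x, E₁.inp x 1 (u * i + k) =
            (bits (u * K) (messageEquiv S.M K x)).getD (u * i + k) 0 := fun x =>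
          Nat.mod_eq_of_lt ((hbit x _).trans_lt hone)
        refine (((Frm.input (j := 1) le_rfl le_rfl (Frm.const hlt)).congr hin).mul
          (Frm.const ?_) fun x => ?_)
        · refine lt_trans ?_ hMw
          rw [hM]; exact Nat.pow_lt_pow_right (by norm_num) hk'
        · exact (Finset.single_le_sum (f := fun k => (bits (u * K) (messageEquiv S.M K x)).getD
            (u * i + k) 0 * 2 ^ k) (fun _ _ => Nat.zero_le _) hk).trans_lt (hval x)
      · simp; omega
    have h1 := (Avail.start E₁).family _ hword
    have h2 := henc E₁ _ _ _ (fun x => x) hB (fun i => Or.inr ⟨i, by simp, rfl⟩) h1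
    obtain ⟨l, h3, h4⟩ := evaluates_letters hfit rfl rfl (y := fun x => enc x)
      (fun j => Or.inr ⟨j, rfl⟩) h2
    refine ⟨l, h3.trans ?_, h4⟩
    simp only [sum_const, card_univ, Fintype.card_fin, smul_eq_mul]
    omega
  -- the decoding program
  let I₂ := {z : Fin S.T → List (Fin S.Q) // ∀ j, (z j).length ≤ n}
  let E₂ : Env I₂ := ⟨S.T, w, S.size, S.tab, fun z j i => (S.lists z.1 (j - 1)).getD i 0 % 2 ^ w,
    fun z j => (S.lists z.1 (j - 1)).length % 2 ^ w⟩
  have hE₂ : Evaluates E₂ s₂ n fun z i => ((Dec z.1).1 i : ℕ) := by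
    have hin : S.Input E₂ fun z => S.lists z.1 := by
      refine ⟨hfit, rfl, rfl, fun _ _ _ => rfl, fun _ _ _ => rfl, fun z t a ha => ?_,
        fun z t => ?_, rfl⟩
      · rw [lists] at ha
        split_ifs at ha with h
        · obtain ⟨b, -, rfl⟩ := List.mem_map.1 ha; exact b.2
        · simp at ha
      · rw [lists]
        split_ifs
        · rw [List.length_map]; exact z.2 _
        · simp
    obtain ⟨σ, h1⟩ := hin.avail_word
    have h2 := hdec' E₂ (Set.range fun (j : Fin (S.F * S.m)) z => S.word (S.lists z.1) j) σ _
      (fun z => S.found z.1) hB (fun i => ⟨i, funext fun z => (S.val_found z.1 i).symm⟩) h1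
    have h3 := henc E₂ _ _ _ (fun z => g z.1) hB (fun i => Or.inr ⟨i, rfl⟩) h2
    obtain ⟨l, h4, h5⟩ := evaluates_letters hfit rfl rfl (y := fun z : I₂ => enc (g z.1))
      (fun j => Or.inr ⟨j, rfl⟩) h3
    exact ⟨l, h4.trans (by omega), h5⟩
  obtain ⟨d, hd, hdE, hdD⟩ := exists_description (J₁ := 1) (J₂ := S.T) (w := w) (size := S.size)
    (tab := S.tab) ⟨rfl, rfl, rfl, rfl⟩ ⟨rfl, rfl, rfl, rfl⟩ hE₁ hE₂ (by omega) (fun i hi => by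
      have h1 := hfit.size
      have hM1 : S.M ≤ S.M * S.L := Nat.le_mul_of_pos_right _ S.L_pos
      have h2 : S.tab i < max (S.V ^ S.m) (max S.M S.H) := by
        unfold tab
        split_ifs
        · exact lt_max_of_lt_left ((S.decI_lt _).trans_le (Nat.le_self_pow S.hm.ne' _))
        · exact lt_max_of_lt_right (lt_max_of_lt_left (S.decD_lt _))
        · exact lt_max_of_lt_right (lt_max_of_lt_right (S.codeD_lt _ _))
      refine h2.trans (max_lt ?_ (max_lt ?_ ?_))
      · exact lt_of_le_of_lt (by nlinarith [Nat.zero_le (S.T * (S.V ^ S.m + 1))]) hfit.idx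
      · unfold Scheme.size at h1; omega
      · have := S.H_le_Q; have := hfit.Q_lt; omega)
  refine ⟨C, Enc, Dec, d, hcard, ?_, hd, ?_, ?_⟩
  · intro c hc D hD
    obtain ⟨x, -, rfl⟩ := mem_image.1 hc
    exact congrArg f (hrec x D hD)
  · intro k
    set x := (messageEquiv S.M K).symm (finCongr hcard k) with hx
    have hxk : (messageEquiv S.M K x : ℕ) = k := by rw [hx, Equiv.apply_symm_apply]; rfl
    have hclog : Nat.clog 2 C.card = u * K := by
      rw [hcard, hM, ← pow_mul, Nat.clog_pow _ _ (by norm_num)]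
    have := hdE x [bits (Nat.clog 2 C.card) k] rfl fun j hj => by
      obtain rfl : j = 0 := by omega
      refine ⟨?_, ?_⟩
      · rw [hclog, ← hxk]; rfl
      · rw [hclog]; simp [bits, E₁]
    exact this
  · intro z hz
    refine hdD ⟨z, hz⟩ _ (by simp) fun j hj => ?_
    rw [← lists_eq_getD]
    exact ⟨rfl, rfl⟩

end Scheme

end TraceCode

/-! ### The choice of the parameters -/

namespace TraceCode

open Finset WordRAM ExpanderCode

theorem exists_linear_le_two_pow (A B : ℕ) : ∃ n : ℕ, 3 ≤ n ∧ A * n + B ≤ 2 ^ (n - 3) := by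
  have h : ∀ n : ℕ, n * n ≤ 2 ^ n * 2 := by
    intro n
    induction n with
    | zero => simp
    | succ n ih =>
      rw [pow_succ]
      rcases Nat.lt_or_ge n 3 with h | h
      · interval_cases n <;> norm_num
      · nlinarith
  refine ⟨16 * (A + B + 1) + 3, by omega, ?_⟩
  have := h (16 * (A + B + 1))
  rw [Nat.add_sub_cancel]
  nlinarith [Nat.zero_le A, Nat.zero_le B, Nat.zero_le (A * B)]

/-- With `X = 2 ^ k`, the quantity `T (2 + a + g + h) + b + 2` is at most a constant times `X ^ 3` for
the choices of `exists_parameters`. Hence it is below `2 ^ a`, where `a` is a large multiple of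
`k`. -/
theorem cost_le {T c k e g C₁ C₂ X : ℕ} (hk : 1 ≤ k) (hkX : k ≤ X) (heX : e ≤ X) (hT : T ≤ c * k) :
    T * (2 + C₂ * k + g + e * k * C₁) + (k + 4) + 2 ≤ X * (X * X) * (c * (2 + C₂ + g + C₁) + 7) := by
  have hX : 1 ≤ X := hk.trans hkX
  have e1 : 2 + C₂ * k + g + e * k * C₁ ≤ X * X * (2 + C₂ + g + C₁) := by
    have a1 : k ≤ X * X := hkX.trans (Nat.le_mul_of_pos_left _ hX)
    have a2 : e * k ≤ X * X := Nat.mul_le_mul heX hkX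
    have a3 : 1 ≤ X * X := Nat.mul_pos hX hX
    nlinarith [Nat.mul_le_mul_left C₂ a1, Nat.mul_le_mul_right C₁ a2, Nat.mul_le_mul_right g a3]
  have e2 : T * (2 + C₂ * k + g + e * k * C₁) ≤ c * X * (X * X * (2 + C₂ + g + C₁)) :=
    Nat.mul_le_mul (hT.trans (Nat.mul_le_mul_left c hkX)) e1
  have e3 : (k + 4) + 2 ≤ X * (X * X) * 7 := by
    have a3 : 1 ≤ X * X := Nat.mul_pos hX hX
    have := Nat.mul_le_mul_left X a3
    omega
  calc _ ≤ c * X * (X * X * (2 + C₂ + g + C₁)) + X * (X * X) * 7 := by omega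
    _ = _ := by ring

/-- The parameters of the code for a given deletion probability and a given loss of rate: `T` is the
number of traces, the letters record `a + 1` bits for the place, `g` bits for the number of the
frame, and `h` bits of data, and the outer code has a rate of at least `1 - 4 / 2 ^ b`. -/
theorem exists_parameters {q : ℝ} (hq : q ∈ Set.Ioo (0 : ℝ) 1) :
    ∃ K' : ℝ, 0 < K' ∧ ∀ ε ∈ Set.Ioo (0 : ℝ) 1, ∃ T a b g h : ℕ,
      1 ≤ T ∧ T ≤ ⌈4 * Real.logb (1 / q) (2 / ε)⌉₊ ∧ q ^ T < ε / 8 ∧ 6 ≤ g * (1 - q) ∧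
      32 / ε ≤ 2 ^ b ∧ 16 * T ≤ ε * h ∧ 8 * (1 + a + g : ℕ) ≤ ε * h ∧
      T * (2 + a + g + h) + b + 2 ≤ 2 ^ a ∧
      ((1 + a + g + h : ℕ) : ℝ) ≤ K' * (1 / ε * Real.logb 2 (2 / ε)) := by
  obtain ⟨hq0, hq1⟩ := hq
  have hlq : 0 < Real.log (1 / q) := Real.log_pos (by rw [lt_div_iff₀ hq0]; linarith)
  set c : ℕ := ⌈4 * (Real.log 2 / Real.log (1 / q))⌉₊ + 1 with hc
  set g : ℕ := ⌈6 / (1 - q)⌉₊ with hg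
  obtain ⟨C₂, hC₃, hC₂⟩ := exists_linear_le_two_pow (c * 9) (c * (2 + g + 16 * c + 8 + 8 * g) + 7)
  set C₁ : ℕ := 16 * c + 8 * (1 + C₂ + g) with hC₁
  refine ⟨4 * (1 + C₂ + g + C₁ : ℕ), by positivity, fun ε hε => ?_⟩
  obtain ⟨hε0, hε1⟩ := hε
  have h2ε : 2 ≤ 2 / ε := by rw [le_div_iff₀ hε0]; linarith
  set ℓ := Real.logb 2 (2 / ε) with hℓ
  have hℓ1 : 1 ≤ ℓ := by
    rw [hℓ, Real.le_logb_iff_rpow_le (by norm_num) (by positivity)]; simpa using h2ε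
  set k : ℕ := ⌈ℓ⌉₊ with hk
  have hk1 : 1 ≤ k := Nat.one_le_ceil_iff.2 (by linarith)
  have hkℓ : ℓ ≤ k := Nat.le_ceil _
  have hkℓ' : (k : ℝ) ≤ 2 * ℓ := by
    have := (Nat.ceil_lt_add_one (by linarith : 0 ≤ ℓ)).le
    linarith
  have h2k : 2 / ε ≤ 2 ^ k := by
    rw [← Real.rpow_natCast, ← Real.logb_le_iff_le_rpow (by norm_num) (by positivity)]
    exact hkℓ
  set e : ℕ := ⌈1 / ε⌉₊ with he
  have hε2 : 1 ≤ 1 / ε := by rw [le_div_iff₀ hε0]; linarith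
  have he1 : 1 / ε ≤ e := Nat.le_ceil _
  have he2 : (e : ℝ) ≤ 2 * (1 / ε) := by
    have := (Nat.ceil_lt_add_one (by positivity : 0 ≤ 1 / ε)).le
    linarith
  have he3 : 1 ≤ e := by exact_mod_cast hε2.trans he1
  have hek : e ≤ 2 ^ k := by
    have : (e : ℝ) ≤ 2 ^ k := he2.trans (by rw [mul_one_div]; exact h2k)
    exact_mod_cast this
  have hlog : Real.logb (1 / q) (2 / ε) = Real.log 2 / Real.log (1 / q) * ℓ := by
    rw [hℓ, Real.logb, Real.logb]
    have : Real.log 2 ≠ 0 := (Real.log_pos (by norm_num)).ne'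
    field_simp
  set T : ℕ := ⌈4 * Real.logb (1 / q) (2 / ε)⌉₊ with hT
  have hlog0 : 0 < Real.logb (1 / q) (2 / ε) := by
    rw [hlog]; have := Real.log_pos (by norm_num : (1 : ℝ) < 2); positivity
  have hT1 : 1 ≤ T := Nat.one_le_ceil_iff.2 (by linarith)
  have hTc : T ≤ c * k := by
    have h1 : (T : ℝ) ≤ 4 * Real.logb (1 / q) (2 / ε) + 1 :=
      (Nat.ceil_lt_add_one (by linarith)).le
    have h2 : 4 * (Real.log 2 / Real.log (1 / q)) ≤ (c : ℝ) - 1 := by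
      rw [hc]; push_cast
      have := Nat.le_ceil (4 * (Real.log 2 / Real.log (1 / q)))
      linarith
    have h3 : (T : ℝ) ≤ c * k := by
      rw [hlog] at h1
      have hk1' : (1 : ℝ) ≤ k := by exact_mod_cast hk1
      have hc1 : (0 : ℝ) ≤ (c : ℝ) - 1 := by rw [hc]; push_cast; simp
      have h4 : 4 * (Real.log 2 / Real.log (1 / q)) * ℓ ≤ ((c : ℝ) - 1) * k :=
        mul_le_mul h2 hkℓ (by linarith) hc1
      linarith
    exact_mod_cast h3
  -- `k` is about `log (2 / ε)`, and `e` about `1 / ε`, so that `T` and `a` have the order of `k`, and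
  -- `h` has the order of `e * k`
  refine ⟨T, C₂ * k, k + 4, g, e * k * C₁, hT1, le_rfl, ?_, ?_, ?_, ?_, ?_, ?_, ?_⟩
  · have h1 : (2 / ε) ^ (4 : ℝ) ≤ (1 / q) ^ (T : ℝ) := by
      have h3 : 4 * Real.logb (1 / q) (2 / ε) ≤ T := Nat.le_ceil _
      have hb : 1 < 1 / q := by rw [lt_div_iff₀ hq0]; linarith
      have h4 : (1 / q) ^ (Real.logb (1 / q) (2 / ε)) = 2 / ε :=
        Real.rpow_logb (by positivity) hb.ne' (by positivity)
      calc (2 / ε) ^ (4 : ℝ) = (1 / q) ^ (Real.logb (1 / q) (2 / ε) * 4) := by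
            rw [Real.rpow_mul (by positivity), h4]
        _ ≤ (1 / q) ^ (T : ℝ) := Real.rpow_le_rpow_of_exponent_le hb.le (by linarith)
    rw [Real.rpow_natCast, div_pow, one_pow, le_div_iff₀ (by positivity)] at h1
    have h2 : (2 / ε) * 8 ≤ (2 / ε) ^ (4 : ℝ) := by
      have : (2 / ε) ^ (4 : ℝ) = (2 / ε) ^ 4 := by norm_cast
      rw [this, show (2 / ε) ^ 4 = (2 / ε) * (2 / ε) ^ 3 by ring]
      gcongr
      calc (8 : ℝ) = 2 ^ 3 := by norm_num
        _ ≤ _ := by gcongr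
    have h3 : 2 / ε * 8 * q ^ T ≤ 1 := (mul_le_mul_of_nonneg_right h2 (by positivity)).trans h1
    have h4 : 2 / ε * 8 * q ^ T = 16 * q ^ T / ε := by ring
    rw [h4, div_le_iff₀ hε0] at h3
    linarith
  · have : 6 / (1 - q) ≤ g := Nat.le_ceil _
    rwa [div_le_iff₀ (by linarith)] at this
  · rw [pow_add]
    calc 32 / ε = 2 / ε * 2 ^ 4 := by ring
      _ ≤ _ := by gcongr
  all_goals have hC : (k : ℝ) * C₁ ≤ ε * (e * k * C₁ : ℕ) := by
              push_cast
              have : 1 ≤ ε * e := by rwa [div_le_iff₀' hε0] at he1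
              calc (k : ℝ) * C₁ = 1 * (k * C₁) := by ring
                _ ≤ ε * e * (k * C₁) := by gcongr
                _ = _ := by ring
  · refine le_trans ?_ hC
    have : 16 * T ≤ k * C₁ := by rw [hC₁]; nlinarith
    exact_mod_cast this
  · refine le_trans ?_ hC
    have : 8 * (1 + C₂ * k + g) ≤ k * C₁ := by
      rw [hC₁]; nlinarith [Nat.mul_le_mul_right g hk1, Nat.zero_le (c * k)]
    exact_mod_cast this
  · have hk2 : k ≤ 2 ^ k := Nat.lt_two_pow_self.le
    have h1 := cost_le (C₁ := C₁) (C₂ := C₂) (g := g) hk1 hk2 hek hTc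
    refine h1.trans ?_
    have h2 : c * (2 + C₂ + g + C₁) + 7 ≤ 2 ^ (C₂ - 3) := by
      refine le_trans (le_of_eq ?_) hC₂
      rw [hC₁]; ring
    calc 2 ^ k * (2 ^ k * 2 ^ k) * (c * (2 + C₂ + g + C₁) + 7)
        ≤ 2 ^ (3 * k) * (2 ^ (C₂ - 3)) ^ k := by
          rw [show 2 ^ k * (2 ^ k * 2 ^ k) = 2 ^ (3 * k) by rw [← pow_add, ← pow_add]; ring_nf]
          exact Nat.mul_le_mul_left _ (h2.trans (Nat.le_self_pow (by omega) _))
      _ = 2 ^ (C₂ * k) := by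
          rw [← pow_mul, ← pow_add, ← Nat.add_mul]
          congr 2; omega
  · have h1 : 1 + C₂ * k + g + e * k * C₁ ≤ e * k * (1 + C₂ + g + C₁) := by
      have a1 : 1 ≤ e * k := Nat.mul_pos he3 hk1
      nlinarith [Nat.mul_le_mul_left C₂ (Nat.le_mul_of_pos_left k he3), Nat.mul_le_mul_right g a1]
    calc ((1 + C₂ * k + g + e * k * C₁ : ℕ) : ℝ) ≤ ((e * k * (1 + C₂ + g + C₁) : ℕ) : ℝ) := by
          exact_mod_cast h1
      _ = e * k * (1 + C₂ + g + C₁ : ℕ) := by push_cast; ring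
      _ ≤ (2 * (1 / ε)) * (2 * ℓ) * (1 + C₂ + g + C₁ : ℕ) := by gcongr
      _ = _ := by ring

/-! ### The failure probability -/

/-- If the blocks are long enough, then it is exponentially unlikely that a constant fraction of
the blocks is bad. -/
theorem exists_prob_many_bad_lt {q : ℝ} (hq : q ∈ Set.Ioo (0 : ℝ) 1) {T : ℕ} {τ τ' κ : ℝ}
    (hτ : q ^ T < τ) (hτ' : q < τ') (hκ : 0 < κ) :
    ∃ γ : ℝ, 0 < γ ∧ ∃ L₀ : ℕ, ∀ L ≥ L₀, ∀ N s : ℕ, 0 < N → κ * N ≤ s →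
      ∑ D : Fin T → Fin (N * L) → Bool,
        (if s ≤ (univ.filter fun j => Bad ⌊τ * L⌋₊ ⌊τ' * L⌋₊ (blockPattern D j)).card
          then patternsProb q D else 0) < (2 : ℝ) ^ (-(γ * (N * L : ℕ))) := by
  obtain ⟨ρ, hρ0, hρ1, hρ⟩ := exists_prob_bad_le hq hτ hτ'
  -- `ρ ^ κ = 2 ^ (-θ)`
  set θ : ℝ := -(κ * Real.logb 2 ρ) with hθ
  have hlog : Real.logb 2 ρ < 0 := Real.logb_neg (by norm_num) hρ0 hρ1
  have hθ0 : 0 < θ := by rw [hθ]; nlinarith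
  obtain ⟨L₀, hL₀⟩ := exists_nat_gt (Real.logb 2 (T + 2) / (θ / 2))
  refine ⟨θ / 2, by positivity, L₀, fun L hL N s hN hs => ?_⟩
  have hT2 : (T + 2 : ℝ) < (2 : ℝ) ^ (θ / 2 * L) := by
    rw [← Real.logb_lt_iff_lt_rpow (by norm_num) (by positivity)]
    rw [div_lt_iff₀ (by positivity)] at hL₀
    have : (L₀ : ℝ) ≤ L := by exact_mod_cast hL
    nlinarith
  have hρL : 0 < ρ ^ L := by positivity
  have hρL1 : ρ ^ L ≤ 1 := pow_le_one₀ hρ0.le hρ1.le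
  refine (sum_bad_blocks_le hq _ (hρ L) (y := (ρ ^ L)⁻¹) (one_le_inv_iff₀.2 ⟨hρL, hρL1⟩) s).trans_lt
    ?_
  have h1 : 1 + (T + 1) * ρ ^ L * ((ρ ^ L)⁻¹ - 1) ≤ T + 2 := by
    have : (T + 1) * ρ ^ L * ((ρ ^ L)⁻¹ - 1) = (T + 1) - (T + 1) * ρ ^ L := by field_simp
    rw [this]; nlinarith [Nat.cast_nonneg (α := ℝ) T]
  have h0 : 0 ≤ 1 + (T + 1) * ρ ^ L * ((ρ ^ L)⁻¹ - 1) := by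
    have : 0 ≤ (ρ ^ L)⁻¹ - 1 := by linarith [one_le_inv_iff₀.2 ⟨hρL, hρL1⟩]
    positivity
  have h2 : ρ ^ (L * s) ≤ (2 : ℝ) ^ (-(θ * ((N : ℝ) * L))) := by
    have h3 : ρ = 2 ^ Real.logb 2 ρ := (Real.rpow_logb (by norm_num) (by norm_num) hρ0).symm
    rw [← Real.rpow_natCast]
    nth_rewrite 1 [h3]
    rw [← Real.rpow_mul (by norm_num)]
    refine Real.rpow_le_rpow_of_exponent_le (by norm_num) ?_
    push_cast
    have : κ * N * L ≤ s * L := by gcongr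
    rw [hθ]; nlinarith
  calc _ = (1 + (T + 1) * ρ ^ L * ((ρ ^ L)⁻¹ - 1)) ^ N * ρ ^ (L * s) := by
        rw [inv_pow, div_inv_eq_mul, ← pow_mul]
    _ ≤ (T + 2 : ℝ) ^ N * (2 : ℝ) ^ (-(θ * ((N : ℝ) * L))) := by gcongr
    _ < ((2 : ℝ) ^ (θ / 2 * L)) ^ N * (2 : ℝ) ^ (-(θ * ((N : ℝ) * L))) := by
        have : (T + 2 : ℝ) ^ N < ((2 : ℝ) ^ (θ / 2 * L)) ^ N := by
          gcongr
        have h4 : (0 : ℝ) < (2 : ℝ) ^ (-(θ * ((N : ℝ) * L))) := by positivity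
        nlinarith
    _ = _ := by
        rw [← Real.rpow_natCast, ← Real.rpow_mul (by norm_num), ← Real.rpow_add (by norm_num)]
        congr 1; push_cast; ring

/-- If decoding succeeds outside an event, then the probability of the event bounds that of failure. -/
theorem failProb_lt {n Q T : ℕ} {C : Finset (Fin n → Fin Q)} {q δ : ℝ}
    (hq : q ∈ Set.Ioo (0 : ℝ) 1) {Dec : (Fin T → List (Fin Q)) → C} {c : Fin n → Fin Q}
    (P : (Fin T → Fin n → Bool) → Prop) [DecidablePred P]
    (hP : ∀ D, ¬ P D → (Dec (fun t => trace c (D t)) : Fin n → Fin Q) = c)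
    (h : ∑ D, (if P D then patternsProb q D else 0) < δ) : failProb q Dec c < δ := by
  refine lt_of_le_of_lt (Finset.sum_le_sum fun D _ => ?_) h
  have h0 := patternsProb_nonneg hq D
  by_cases hD : P D
  · rw [if_pos hD]
    split_ifs
    · exact le_rfl
    · exact h0
  · rw [if_neg hD, if_neg (by simpa using hP D hD)]

end TraceCode

/-! ### The family of codes -/

namespace TraceCode

open Finset WordRAM ExpanderCode

/-- The numbers that the programs handle are polynomial in the length `n`. -/
theorem Scheme.fits {S : Scheme} {n ν w : ℕ} (hn : n = S.F * S.m * S.L) (hν : n < 2 ^ ν)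
    (hν1 : 1 ≤ ν) (hT : 1 ≤ S.T) (hP : S.P ^ S.T ≤ n) (hV : S.V ≤ n) (hM : S.M * S.L ≤ n)
    (hw : (S.Q + S.m + S.T + 3) * ν ≤ w) : S.Fits w := by
  have hPn : S.P ≤ n := (Nat.le_self_pow (by omega) _).trans hP
  have hmono : ∀ {k : ℕ}, k ≤ (S.Q + S.m + S.T + 3) * ν → 2 ^ k ≤ 2 ^ w := fun h =>
    Nat.pow_le_pow_right (by norm_num) (h.trans hw)
  have e : (S.Q + S.m + S.T + 3) * ν = S.Q * ν + S.m * ν + S.T * ν + 3 * ν := by ring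
  have eQ : S.Q ≤ S.Q * ν := Nat.le_mul_of_pos_right _ hν1
  have eT : S.T ≤ S.T * ν := Nat.le_mul_of_pos_right _ hν1
  refine ⟨?_, ?_, ?_, ?_, ?_⟩
  · calc (S.P + 1) * (S.Q + 2) ≤ 2 ^ ν * 2 ^ (S.Q + 1) :=
          Nat.mul_le_mul (by omega) (Nat.lt_two_pow_self (n := S.Q + 1))
      _ = 2 ^ (ν + (S.Q + 1)) := (pow_add _ _ _).symm
      _ ≤ 2 ^ w := hmono (by omega)
  · calc S.P ^ S.m < (2 ^ ν) ^ S.m := Nat.pow_lt_pow_left (by omega) S.hm.ne'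
      _ = 2 ^ (S.m * ν) := by rw [← pow_mul, mul_comm]
      _ ≤ 2 ^ w := hmono (by omega)
  · have h1 : S.V ^ S.m + 1 ≤ 2 ^ (S.m * ν) := by
      rw [mul_comm, pow_mul]; exact Nat.pow_lt_pow_left (by omega) S.hm.ne'
    calc (S.T + 1) * (S.V ^ S.m + 1) ≤ 2 ^ S.T * 2 ^ (S.m * ν) :=
          Nat.mul_le_mul Nat.lt_two_pow_self h1
      _ = 2 ^ (S.T + S.m * ν) := (pow_add _ _ _).symm
      _ < 2 ^ (S.T + S.m * ν + 1) := Nat.pow_lt_pow_right (by norm_num) (by omega)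
      _ ≤ 2 ^ w := hmono (by omega)
  · calc S.size ≤ 3 * n := by unfold Scheme.size; omega
      _ < 2 ^ (ν + 2) := by rw [pow_add]; omega
      _ ≤ 2 ^ w := hmono (by omega)
  · rw [← hn]
    exact hν.trans_le (hmono (by omega))

/-- The rate of a code with `2 ^ (u K)` codewords, where `K = 2 ^ (i + b)`. The outer code and the
part of the letters that is not data each cost a factor `1 - ε / 8`, and the redundancy `h L - u` of
the inner code costs a factor `1 - ε / 4`. -/
theorem rate_bound {ε : ℝ} (hε : ε ∈ Set.Ioo (0 : ℝ) 1) {a b g h i u L : ℕ} (hL : 0 < L)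
    (hb : 32 / ε ≤ 2 ^ b) (hu : (h : ℝ) * L * (1 - ε / 4) ≤ u) (hh : 8 * (1 + a + g : ℕ) ≤ ε * h) :
    1 - ε ≤ ((u : ℝ) * 2 ^ (i + b)) / (2 ^ i * (2 ^ b + 4) * L * (1 + a + g + h : ℕ)) := by
  obtain ⟨hε0, hε1⟩ := hε
  have hL' : (0 : ℝ) < L := by exact_mod_cast hL
  rw [div_le_iff₀ hε0] at hb
  rw [le_div_iff₀ (by positivity), pow_add]
  have h1 : (2 ^ b + 4 : ℝ) * (1 - ε / 8) ≤ 2 ^ b := by nlinarith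
  have h2 : ((1 + a + g + h : ℕ) : ℝ) * (1 - ε / 8) ≤ h := by
    push_cast at hh ⊢
    nlinarith
  have h0 : (0 : ℝ) ≤ 1 - ε / 4 := by linarith
  have h3 : (1 - ε : ℝ) ≤ (1 - ε / 8) * (1 - ε / 8) * (1 - ε / 4) := by
    have : 1 - ε / 4 ≤ (1 - ε / 8) * (1 - ε / 8) := by nlinarith [sq_nonneg ε]
    nlinarith [sq_nonneg ε, mul_le_mul_of_nonneg_right this h0]
  have h0' : (0 : ℝ) ≤ 1 - ε / 8 := by linarith
  calc (1 - ε) * (2 ^ i * (2 ^ b + 4) * L * (1 + a + g + h : ℕ))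
      ≤ (1 - ε / 8) * (1 - ε / 8) * (1 - ε / 4) *
          (2 ^ i * (2 ^ b + 4) * L * (1 + a + g + h : ℕ)) := by gcongr
    _ = (((1 + a + g + h : ℕ) : ℝ) * (1 - ε / 8)) * L * (1 - ε / 4) *
          (2 ^ i * ((2 ^ b + 4) * (1 - ε / 8))) := by ring
    _ ≤ (h * L * (1 - ε / 4)) * (2 ^ i * 2 ^ b) := by gcongr
    _ ≤ _ := by gcongr

/-- The inner codes for blocks of length `L`. The index code is decoded from a single trace, that is,
it is the case `T = 1` of `exists_nat_block_code`. -/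
theorem exists_inner_codes {q ε : ℝ} (hq : q ∈ Set.Ioo (0 : ℝ) 1) (hε : ε ∈ Set.Ioo (0 : ℝ) 1)
    {T g h L : ℕ} (hg : 6 ≤ g * (1 - q)) (hh : 16 * T ≤ ε * h) :
    ∃ (u : ℕ) (codeI : ℕ → ℕ → ℕ) (decI : List ℕ → ℕ) (codeD : ℕ → ℕ → ℕ)
      (decD : (Fin T → List ℕ) → ℕ), u ≤ h * L ∧ (h : ℝ) * L * (1 - ε / 4) ≤ u ∧
      (∀ v l, codeI v l < 2 ^ g) ∧ (∀ z, decI z < 2 ^ L) ∧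
      (∀ y l, codeD y l < 2 ^ h) ∧ (∀ z, decD z < 2 ^ u) ∧
      (∀ v < 2 ^ L, ∀ D : Fin L → Bool,
        (univ.filter fun l => D l = true).card ≤ ⌊(1 + q) / 2 * L⌋₊ →
        decI (natTrace D (codeI v)) = v) ∧
      ∀ y < 2 ^ u, ∀ D : Fin T → Fin L → Bool, erased D ≤ ⌊ε / 8 * L⌋₊ →
        decD (fun t => natTrace (D t) (codeD y)) = y := by
  obtain ⟨hq0, hq1⟩ := hq
  obtain ⟨hε0, hε1⟩ := hε
  set e' := ⌊(1 + q) / 2 * L⌋₊ with he'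
  set e := ⌊ε / 8 * L⌋₊ with he
  have he'L : (e' : ℝ) ≤ (1 + q) / 2 * L := Nat.floor_le (by positivity)
  have heL : (e : ℝ) ≤ ε / 8 * L := Nat.floor_le (by positivity)
  have hI : 2 ^ L * (4 ^ (L * 1) * (2 ^ g) ^ e') ≤ (2 ^ g) ^ L := by
    rw [show (4 : ℕ) = 2 ^ 2 by norm_num, ← pow_mul, ← pow_mul, ← pow_mul, ← pow_add, ← pow_add]
    refine Nat.pow_le_pow_right (by norm_num) ?_
    have h1 : (g : ℝ) * e' ≤ g * ((1 + q) / 2 * L) := by gcongr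
    have h2 : (3 : ℝ) * L ≤ g * (1 - q) / 2 * L := by gcongr; linarith
    have h3 : ((L + (2 * (L * 1) + g * e') : ℕ) : ℝ) ≤ (g * L : ℕ) := by push_cast; nlinarith
    exact_mod_cast h3
  obtain ⟨codeI, decI, hI1, hI2, hI3⟩ := exists_nat_block_code (by positivity) (by positivity) hI
  have hred : h * e + 2 * (L * T) ≤ h * L ∧
      (h : ℝ) * L * (1 - ε / 4) ≤ (h * L : ℝ) - (h * e + 2 * (L * T)) := by
    have h1 : (h : ℝ) * e ≤ h * (ε / 8 * L) := by gcongr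
    have h2 : (16 : ℝ) * T * L ≤ ε * h * L := by gcongr
    have h3 : (h : ℝ) * L * ε ≤ h * L * 1 := by gcongr
    constructor
    · have : ((h * e + 2 * (L * T) : ℕ) : ℝ) ≤ (h * L : ℕ) := by push_cast; nlinarith
      exact_mod_cast this
    · nlinarith
  have hD : 2 ^ (h * L - (h * e + 2 * (L * T))) * (4 ^ (L * T) * (2 ^ h) ^ e) ≤ (2 ^ h) ^ L := by
    rw [show (4 : ℕ) = 2 ^ 2 by norm_num, ← pow_mul, ← pow_mul, ← pow_mul, ← pow_add, ← pow_add]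
    exact Nat.pow_le_pow_right (by norm_num) (by omega)
  obtain ⟨codeD, decD, hD1, hD2, hD3⟩ := exists_nat_block_code (by positivity) (by positivity) hD
  refine ⟨h * L - (h * e + 2 * (L * T)), codeI, fun z => decI fun _ => z, codeD, decD,
    Nat.sub_le _ _, ?_, hI1, fun z => hI2 _, hD1, hD2, fun v hv D hDe => ?_, hD3⟩
  · rw [Nat.cast_sub hred.1]; push_cast; exact hred.2
  · refine hI3 v hv (fun _ => D) (le_trans (le_of_eq ?_) hDe)
    simp [erased]

/-- The constant in the bounds for the lengths of the programs. -/
def lengthConst (T a b h τ ρ : ℕ) : ℕ :=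
  17 + 2 * T + 3 * (5 * h + 309) + 3 * (T * (2 * Scheme.stepCost (2 ^ a)) + (9 * T + 4) +
    (300 + 8 * ρ) * (a + τ + b + 1) + 308)

/-- The constant in the bounds for time, space and word length. -/
def timeConst (T a b h τ ρ Q : ℕ) : ℕ :=
  Q + 2 ^ a + T + h + 50 + (4 * T + 45) * lengthConst T a b h τ ρ

/-- The encoding program has linear size: `K` words of `u` bits are read, the outer code takes `300 K`
operations, and every letter takes a constant number. -/
theorem encode_cost_le {K N L n u h : ℕ} (hK : K ≤ N) (hu : u ≤ h * L) (hn : n = N * L)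
    (hL : 0 < L) : K * (5 * u + 1) + 300 * K + 8 * n ≤ (5 * h + 309) * n := by
  have hNn : N ≤ n := by rw [hn]; exact Nat.le_mul_of_pos_right _ hL
  have h1 : K * u ≤ h * n := by
    calc K * u ≤ N * (h * L) := Nat.mul_le_mul hK hu
      _ = h * n := by rw [hn]; ring
  rw [show K * (5 * u + 1) = 5 * (K * u) + K by ring,
    show (5 * h + 309) * n = 5 * (h * n) + 309 * n by ring]
  omega

/-- The decoding program has linear size. The outer decoder takes `O(N log N)` operations, where `N` is
smaller than `n` by the factor `L`, and `log N` is at most a constant times `L`. -/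
theorem decode_cost_le {K N L n a b i τ T s R : ℕ} (hK : K ≤ N) (hn : n = N * L) (hL : 0 < L)
    (hn0 : 0 < n) (hi : i = a + L * τ) :
    T * ((n + 1) * s) + N * (9 * T + 4) + R * K * (i + b + 1) + 300 * K + 8 * n ≤
      (T * (2 * s) + (9 * T + 4) + R * (a + τ + b + 1) + 308) * n := by
  have hNn : N ≤ n := by rw [hn]; exact Nat.le_mul_of_pos_right _ hL
  have e1 : T * ((n + 1) * s) ≤ T * (2 * s) * n := by
    calc _ ≤ T * ((2 * n) * s) := by gcongr; omega
      _ = _ := by ring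
  have e2 : N * (9 * T + 4) ≤ (9 * T + 4) * n := by
    rw [mul_comm]; exact Nat.mul_le_mul_left _ hNn
  have e3 : i + b + 1 ≤ L * (a + τ + b + 1) := by
    rw [hi]; nlinarith [Nat.le_mul_of_pos_left (a + b + 1) hL]
  have e4 : R * K * (i + b + 1) ≤ R * (a + τ + b + 1) * n := by
    calc _ ≤ R * N * (L * (a + τ + b + 1)) := by gcongr
      _ = _ := by rw [hn]; ring
  calc _ ≤ T * (2 * s) * n + (9 * T + 4) * n + R * (a + τ + b + 1) * n + 308 * n := by omega
    _ = _ := by ring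

/-- The outer code and the inner codes together, with the programs. -/
theorem Scheme.exists_linear_time (S : Scheme) {a b h u i n τ τ₀ A : ℕ} (hm : S.m = 2 ^ a)
    (hF : S.F = 2 ^ (S.L * τ) * (2 ^ b + 4)) (hM : S.M = 2 ^ u) (hu : u ≤ h * S.L)
    (hV : S.V = 2 ^ S.L) (hT : 1 ≤ S.T) (hQ : S.Q + 1 ≤ 2 ^ τ₀) (hτ : τ = S.T * τ₀)
    (hτ₀ : h + 1 ≤ τ₀) (hi : i = a + S.L * τ) (hn : n = S.F * S.m * S.L)
    (hA : A = timeConst S.T a b h τ roundCost S.Q) :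
    ∃ (C : Finset (Fin (S.F * S.m * S.L) → Fin S.Q)) (Enc : Fin C.card ≃ C)
      (Dec : (Fin S.T → List (Fin S.Q)) → C) (d : List ℕ), C.card = 2 ^ (u * 2 ^ (i + b)) ∧
      (∀ c ∈ C, ∀ D : Fin S.T → Fin (S.F * S.m * S.L) → Bool,
        (4 * S.m * S.T + 1) * (univ.filter fun j => Bad S.e S.e' (blockPattern D j)).card ≤
          ⌊expansion (b + 1) / 3 * 2 ^ i⌋₊ →
        (Dec fun t => trace c (D t)) = c) ∧
      d.length ≤ A * n ∧
      EncodesInTime (A * (Nat.log 2 n + 1)) (interpreter 1 0) d (A * n) Enc ∧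
      DecodesInTime (A * (Nat.log 2 n + 1)) (interpreter S.T 2) d (A * (n * S.T)) Dec := by
  have hM0 : NeZero S.M := ⟨by rw [hM]; positivity⟩
  set N := S.F * S.m with hN
  have hNi : N = 2 ^ i * (2 ^ b + 4) := by rw [hN, hF, hm, hi, pow_add]; ring
  have hL := S.L_pos
  have hKN : 2 ^ (i + b) ≤ N := by
    rw [hNi, pow_add]; exact Nat.mul_le_mul_left _ (by omega)
  have hNn : N ≤ n := by rw [hn]; exact Nat.le_mul_of_pos_right _ hL
  have hK0 : 0 < 2 ^ (i + b) := by positivity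
  have hn0 : 0 < n := by omega
  have hbig : 2 ^ (S.L * τ) ≤ n := by
    refine le_trans ?_ hNn
    rw [hNi, hi]
    calc 2 ^ (S.L * τ) ≤ 2 ^ (a + S.L * τ) := Nat.pow_le_pow_right (by norm_num) (by omega)
      _ ≤ _ := Nat.le_mul_of_pos_right _ (by positivity)
  have hτ0τ : τ₀ ≤ τ := by rw [hτ]; exact Nat.le_mul_of_pos_left _ hT
  have hPT : S.P ^ S.T ≤ n := by
    refine le_trans ?_ hbig
    calc S.P ^ S.T ≤ ((2 ^ τ₀) ^ S.L) ^ S.T := by unfold Scheme.P; gcongr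
      _ = 2 ^ (S.L * τ) := by rw [← pow_mul, ← pow_mul, hτ]; congr 1; ring
  have hVn : S.V ≤ n := by
    rw [hV]
    exact (Nat.pow_le_pow_right (by norm_num) (Nat.le_mul_of_pos_right _ (by omega))).trans hbig
  have hMn : S.M * S.L ≤ n := by
    refine le_trans ?_ hbig
    calc S.M * S.L ≤ 2 ^ (h * S.L) * 2 ^ S.L := by
          rw [hM]
          exact Nat.mul_le_mul (Nat.pow_le_pow_right (by norm_num) hu) Nat.lt_two_pow_self.le
      _ = 2 ^ (S.L * (h + 1)) := by rw [← pow_add]; congr 1; ring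
      _ ≤ _ := Nat.pow_le_pow_right (by norm_num) (Nat.mul_le_mul_left _ (by omega))
  have hMn' : S.M ≤ n := (Nat.le_mul_of_pos_right _ hL).trans hMn
  set ν := Nat.log 2 n + 1 with hν
  have hnν : n < 2 ^ ν := Nat.lt_pow_succ_log_self (by norm_num) n
  have hν1 : 1 ≤ ν := by omega
  -- the product of a constant and `n` is a word if the constant is less than `A`
  set X := lengthConst S.T a b h τ roundCost with hX
  have hXA : S.Q + 2 ^ a + S.T + h + 50 + (4 * S.T + 45) * X ≤ A := hA.ge
  have hword : ∀ k, k + 1 ≤ A → k * n < 2 ^ (A * ν) := by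
    intro k hk
    calc k * n ≤ 2 ^ k * n := Nat.mul_le_mul_right _ Nat.lt_two_pow_self.le
      _ < 2 ^ k * 2 ^ ν := Nat.mul_lt_mul_of_pos_left hnν (by positivity)
      _ = 2 ^ (k + ν) := (pow_add _ _ _).symm
      _ ≤ 2 ^ (A * ν) := Nat.pow_le_pow_right (by norm_num) (by nlinarith)
  have hX' : X = 17 + 2 * S.T + 3 * (5 * h + 309) + 3 * (S.T * (2 * Scheme.stepCost (2 ^ a)) +
    (9 * S.T + 4) + (300 + 8 * roundCost) * (a + τ + b + 1) + 308) := rfl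
  clear_value X ν
  have hn'' : n = N * S.L := hn
  have hAν : 50 * ν ≤ A * ν := Nat.mul_le_mul_right _ (by omega)
  have hTX : (4 * S.T + 45) * X = 4 * (S.T * X) + 45 * X := by ring
  have huK : 2 ^ (i + b) * u ≤ h * n := by
    calc 2 ^ (i + b) * u ≤ N * (h * S.L) := Nat.mul_le_mul hKN hu
      _ = h * n := by rw [hn'']; ring
  have hB : 400 * 2 ^ (i + b) * (S.M + 1) ≤ 2 ^ (A * ν) := by
    calc 400 * 2 ^ (i + b) * (S.M + 1) ≤ 2 ^ 9 * 2 ^ ν * 2 ^ ν :=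
          Nat.mul_le_mul (Nat.mul_le_mul (by norm_num) (by omega)) (by omega)
      _ = 2 ^ (9 + ν + ν) := by rw [pow_add, pow_add]
      _ ≤ _ := Nat.pow_le_pow_right (by norm_num) (by omega)
  have hs₁ := encode_cost_le hKN hu hn'' hL
  set c₂ := S.T * (2 * Scheme.stepCost (2 ^ a)) + (9 * S.T + 4) +
    (300 + 8 * roundCost) * (a + τ + b + 1) + 308 with hc₂
  have hs₂ : S.T * ((n + 1) * Scheme.stepCost S.m) + N * (9 * S.T + 4) +
      (300 + 8 * roundCost) * 2 ^ (i + b) * (i + b + 1) + 300 * 2 ^ (i + b) + 8 * n ≤ c₂ * n := by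
    rw [hm]
    exact decode_cost_le hKN hn'' hL hn0 hi
  have hXn : 17 * n + 2 * S.T * n + 3 * ((5 * h + 309) * n) + 3 * (c₂ * n) = X * n := by
    rw [hX']; ring
  have hTn : S.T ≤ S.T * n := Nat.le_mul_of_pos_right _ hn0
  have hsize : S.size ≤ 3 * n := by
    have := Nat.le_self_pow (show S.T ≠ 0 by omega) S.P
    unfold Scheme.size; omega
  have hTn' : 2 * S.T * n = 2 * (S.T * n) := by ring
  have hsum : 14 + 2 * S.T + 3 * ((5 * h + 309) * n) + 3 * (c₂ * n) + S.size ≤ X * n := by omega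
  have hX1 : X ≤ (4 * S.T + 45) * X := Nat.le_mul_of_pos_left _ (by omega)
  have hcode := exists_code_high_rate S.M (400 * 2 ^ (i + b) * (S.M + 1)) i b le_rfl
  rw [← hNi] at hcode
  obtain ⟨enc, dec, hdec, henc, hdecC⟩ := hcode
  have hfit : S.Fits (A * ν) := Scheme.fits hn hnν hν1 hT hPT hVn hMn
    (Nat.mul_le_mul_right _ (by rw [hm]; omega))
  obtain ⟨C, Enc, Dec, d, k1, k2, k3, k4, k5⟩ := S.exists_coded_reconstruction (u := u)
    (K := 2 ^ (i + b)) (r := ⌊expansion (b + 1) / 3 * 2 ^ i⌋₊) (w := A * ν)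
    (s₁ := (5 * h + 309) * n) (s₂ := c₂ * n) hM hT enc dec
    (fun x y hxy => hdec x y (by
      rw [dist_eq]
      refine le_trans ?_ (Nat.floor_le (by have := expansion_pos (b + 1); positivity))
      exact_mod_cast hxy)) henc hdecC hfit hB
    (by rw [mul_comm]; exact huK.trans_lt (hword h (by omega))) (hn ▸ hs₁) (hn ▸ hs₂)
    (hsum.trans_lt (hword X (by omega)))
  have hAn : ∀ k, k ≤ A → k * n ≤ A * n := fun k hk => Nat.mul_le_mul_right n hk
  refine ⟨C, Enc, Dec, d, ?_, k2, ?_, fun m => ?_, fun z hz => ?_⟩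
  · rw [k1, hM, ← pow_mul]
  · refine le_trans (le_trans k3 ?_) (hAn X (by omega))
    omega
  · obtain ⟨t', ht', hr⟩ := k4 m
    refine ⟨t', ht'.trans ?_, hr⟩
    refine le_trans ?_ (hAn (45 * X + 25) (by omega))
    have : (45 * X + 25) * n = 45 * (X * n) + 25 * n := by ring
    rw [← hn]
    omega
  · obtain ⟨t', ht', hr⟩ := k5 z hz
    refine ⟨t', ht'.trans ?_, hr⟩
    refine le_trans ?_ ((hAn ((4 * S.T + 41) * X + 25) (by rw [show (4 * S.T + 41) * X = 4 * (S.T * X) + 41 * X by ring]; omega)).trans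
      (Nat.mul_le_mul_left _ (Nat.le_mul_of_pos_right n hT)))
    have e1 : ((4 * S.T + 41) * X + 25) * n = (4 * S.T + 41) * (X * n) + 25 * n := by ring
    have e2 : (4 * S.T + 41) * (c₂ * n) ≤ (4 * S.T + 41) * (X * n) :=
      Nat.mul_le_mul_left _ (by omega)
    rw [← hn]
    omega

/-- For fixed parameters, the concatenated codes form a family of unbounded length. -/
theorem exists_family {q ε : ℝ} (hq : q ∈ Set.Ioo (0 : ℝ) 1) (hε : ε ∈ Set.Ioo (0 : ℝ) 1)
    {T a b g h : ℕ} (hT : 1 ≤ T) (hqT : q ^ T < ε / 8) (hg : 6 ≤ g * (1 - q))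
    (hb : 32 / ε ≤ 2 ^ b) (hh : 16 * T ≤ ε * h) (hh' : 8 * (1 + a + g : ℕ) ≤ ε * h)
    (ha : T * (2 + a + g + h) + b + 2 ≤ 2 ^ a) :
    ∃ (γ : ℝ) (A L₀ : ℕ), 0 < γ ∧ ∀ L ≥ L₀, ∃ n, L ≤ n ∧
      ∃ (C : Finset (Fin n → Fin (2 * 2 ^ a * 2 ^ g * 2 ^ h))) (Enc : Fin C.card ≃ C)
        (Dec : (Fin T → List (Fin (2 * 2 ^ a * 2 ^ g * 2 ^ h))) → C) (d : List ℕ),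
        1 - ε ≤ rate C ∧ Reconstructs q ((2 : ℝ) ^ (-(γ * n))) Dec ∧ d.length ≤ A * n ∧
        EncodesInTime (A * (Nat.log 2 n + 1)) (interpreter 1 0) d (A * n) Enc ∧
        DecodesInTime (A * (Nat.log 2 n + 1)) (interpreter T 2) d (A * (n * T)) Dec := by
  have hβ0 : 0 < expansion (b + 1) / 3 := by have := expansion_pos (b + 1); positivity
  set β : ℝ := expansion (b + 1) / 3 with hβ
  set κ : ℝ := β / ((2 ^ b + 4) * (4 * 2 ^ a * T + 1)) with hκ
  obtain ⟨γ, hγ, L₀, hprob⟩ := exists_prob_many_bad_lt hq hqT (τ' := (1 + q) / 2)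
    (by linarith [hq.2]) (show 0 < κ by positivity)
  set τ := T * (2 + a + g + h) with hτ
  refine ⟨γ, timeConst T a b h τ roundCost (2 * 2 ^ a * 2 ^ g * 2 ^ h), L₀ + 1, hγ,
    fun L hL => ?_⟩
  have hL1 : 1 ≤ L := by omega
  obtain ⟨u, codeI, decI, codeD, decD, hu, hu', hI1, hI2, hD1, hD2, hI3, hD3⟩ :=
    exists_inner_codes hq hε (L := L) hg hh
  have hb1 : 2 ^ b + 4 ≤ 2 ^ (b + 2) := by
    have h1 : (2 : ℝ) ≤ 2 ^ b := le_trans (by rw [le_div_iff₀ hε.1]; linarith [hε.2]) hb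
    have h2 : 2 ≤ 2 ^ b := by exact_mod_cast h1
    rw [pow_add]; omega
  have hF : 2 ^ (L * τ) * (2 ^ b + 4) ≤ (2 ^ L) ^ 2 ^ a := by
    calc 2 ^ (L * τ) * (2 ^ b + 4) ≤ 2 ^ (L * τ) * 2 ^ (b + 2) := Nat.mul_le_mul_left _ hb1
      _ = 2 ^ (L * τ + (b + 2)) := (pow_add _ _ _).symm
      _ ≤ 2 ^ (L * 2 ^ a) := Nat.pow_le_pow_right (by norm_num) (by nlinarith)
      _ = _ := pow_mul _ _ _
  obtain ⟨S, hST, hSL, hSm, hSF, hSM, hSV, hSe, hSe', hSQ⟩ : ∃ S : Scheme, S.T = T ∧ S.L = L ∧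
      S.m = 2 ^ a ∧ S.F = 2 ^ (S.L * τ) * (2 ^ b + 4) ∧ S.M = 2 ^ u ∧ S.V = 2 ^ S.L ∧
      S.e = ⌊ε / 8 * L⌋₊ ∧ S.e' = ⌊(1 + q) / 2 * L⌋₊ ∧ S.Q = 2 * 2 ^ a * 2 ^ g * 2 ^ h :=
    ⟨{  T := T, L := L, m := 2 ^ a, F := 2 ^ (L * τ) * (2 ^ b + 4), G := 2 ^ g, H := 2 ^ h
        V := 2 ^ L, M := 2 ^ u, e := ⌊ε / 8 * L⌋₊, e' := ⌊(1 + q) / 2 * L⌋₊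
        codeI := codeI, decI := decI, codeD := codeD, decD := decD
        hm := by positivity
        hG := by positivity
        hH := by positivity
        hF := hF
        he' := by
          rw [Nat.floor_lt (by have := hq.1; positivity)]
          have : (1 : ℝ) ≤ L := by exact_mod_cast hL1
          nlinarith [hq.2]
        codeI_lt := hI1, decI_lt := hI2, codeD_lt := hD1, decD_lt := hD2
        decI_trace := hI3, decD_trace := hD3 }, rfl, rfl, rfl, rfl, rfl, rfl, rfl, rfl, rfl⟩
  subst hST
  subst hSL
  rw [← hSQ]
  have hQ : S.Q = 2 ^ (1 + a + g + h) := by rw [hSQ, pow_add, pow_add, pow_add, pow_one]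
  obtain ⟨C, Enc, Dec, d, k1, k2, k3, k4, k5⟩ := S.exists_linear_time (u := u) (τ₀ := 2 + a + g + h)
    hSm hSF hSM hu hSV hT (by
      rw [hQ, show 2 + a + g + h = 1 + a + g + h + 1 by ring, pow_succ]
      have := Nat.one_le_two_pow (n := 1 + a + g + h); omega) hτ (by omega) rfl rfl rfl
  have hN : S.F * S.m = 2 ^ (a + S.L * τ) * (2 ^ b + 4) := by rw [hSF, hSm, pow_add]; ring
  have hN0 : 0 < S.F * S.m := by rw [hN]; positivity
  refine ⟨S.F * S.m * S.L, Nat.le_mul_of_pos_left _ hN0, C, Enc, Dec, d, ?_, ?_, k3, k4, k5⟩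
  · have hr := rate_bound (i := a + S.L * τ) hε S.L_pos hb hu' hh'
    refine hr.trans (le_of_eq ?_)
    have hlog : Real.log 2 ≠ 0 := (Real.log_pos (by norm_num)).ne'
    rw [rate, k1, hQ, hN]
    push_cast
    rw [Real.log_pow, Real.log_pow]
    push_cast
    field_simp
  · intro c hc
    set s : ℕ := ⌈κ * (S.F * S.m : ℕ)⌉₊ with hs
    refine failProb_lt hq (fun D => s ≤ (univ.filter fun j =>
      Bad S.e S.e' (blockPattern (N := S.F * S.m) (L := S.L) D j)).card) (fun D hD => ?_) ?_
    · refine k2 c hc D (Nat.le_floor ?_)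
      have h1 := (Nat.lt_ceil.1 (not_le.1 hD)).le
      have h2 : κ * (S.F * S.m : ℕ) = β * 2 ^ (a + S.L * τ) / (4 * 2 ^ a * S.T + 1) := by
        rw [hκ, hN]; push_cast; field_simp
      rw [h2, le_div_iff₀ (by positivity)] at h1
      have h3 : (S.m : ℝ) = 2 ^ a := by exact_mod_cast hSm
      push_cast
      rw [h3, mul_comm]
      exact h1
    · have := hprob S.L (by omega) (S.F * S.m) s hN0 (Nat.le_ceil _)
      rw [← hSe, ← hSe'] at this
      convert this

end TraceCode

theorem theorem5 :
    -- `K` is absolute, `K'` depends on `q` only; both are uniform in `ε`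
    ∃ K : ℝ, 0 < K ∧ ∀ q ∈ Set.Ioo (0 : ℝ) 1, ∃ K' : ℝ, 0 < K' ∧ ∀ ε ∈ Set.Ioo (0 : ℝ) 1,
    -- everything here depends on `q` and `ε` only, not on the length `n`
    ∃ (T Q : ℕ) (γ : ℝ) (A : ℕ) (pEnc pDec : WordRAM.Prog),
      1 ≤ T ∧ T ≤ ⌈K * Real.logb (1 / q) (2 / ε)⌉₊ ∧
      2 ≤ Q ∧ (Q : ℝ) ≤ (2 : ℝ) ^ (K' * ((1 / ε) * Real.logb 2 (2 / ε))) ∧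
      0 < γ ∧
      {n : ℕ | ∃ (C : Finset (Fin n → Fin Q)) (Enc : Fin C.card ≃ C)
          (Dec : (Fin T → List (Fin Q)) → C) (d : List ℕ),
        1 - ε ≤ TraceCode.rate C ∧
        TraceCode.Reconstructs q ((2 : ℝ) ^ (-(γ * n))) Dec ∧
        d.length ≤ A * n ∧
        TraceCode.EncodesInTime (A * (Nat.log 2 n + 1)) pEnc d (A * n) Enc ∧
        TraceCode.DecodesInTime (A * (Nat.log 2 n + 1)) pDec d (A * (n * T)) Dec}.Infinite := by
  refine ⟨4, by norm_num, fun q hq => ?_⟩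
  obtain ⟨K', hK', h⟩ := TraceCode.exists_parameters hq
  refine ⟨K', hK', fun ε hε => ?_⟩
  obtain ⟨T, a, b, g, h, hT, hT', hqT, hg, hb, hh, hh', ha, hQ⟩ := h ε hε
  obtain ⟨γ, A, L₀, hγ, hfam⟩ := TraceCode.exists_family hq hε hT hqT hg hb hh hh' ha
  have hQ' : 2 * 2 ^ a * 2 ^ g * 2 ^ h = 2 ^ (1 + a + g + h) := by
    rw [pow_add, pow_add, pow_add, pow_one]
  refine ⟨T, 2 * 2 ^ a * 2 ^ g * 2 ^ h, γ, A, WordRAM.interpreter 1 0, WordRAM.interpreter T 2, hT, hT', ?_, ?_, hγ,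
    Set.infinite_of_forall_exists_gt fun l => ?_⟩
  · rw [hQ']; exact Nat.le_self_pow (by omega) 2
  · rw [hQ']
    push_cast
    rw [← Real.rpow_natCast]
    exact Real.rpow_le_rpow_of_exponent_le (by norm_num) hQ
  · obtain ⟨n, hn, hC⟩ := hfam (max L₀ (l + 1)) (le_max_left _ _)
    exact ⟨n, hC, (le_max_right _ _).trans hn⟩
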